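/- Let $N\ge 2$ and $0\le r<R$. Let $g:\mathbb R\to\mathbb R$ be locally Lipschitz continuous, and suppose that for some $a>0$ the function $g$ is positive and convex on $[a,\infty)$ and $$\int_a^{+\infty}\frac{dt}{\sqrt{G(t)}}<+\infty,\qquad G(t)=\int_a^t g(s)\,ds .$$ Let $u\in C^2(\{x\in\mathbb R^N: r<|x|<R\})$ satisfy $$-\Delta u+g(u)=0\quad\text{in } \{r<|x|<R\},\qquad \lim_{|x|\to R}u(x)=+\infty ,$$ the limit being uniform with respect to $x/|x|$ (no condition is imposed at $|x|=r$). Write $\frac{\partial u}{\partial r}(x)=\langle Du(x),x/|x|\rangle$ for the radial derivative and $\nabla_\tau u(x)=Du(x)-\frac{\partial u}{\partial r}(x)\,\frac{x}{|x|}$ for the tangential gradient of $u$. Then $$\lim_{|x|\to R}\nabla_\tau u(x)=0,\qquad \lim_{|x|\to R}\frac{\partial u}{\partial r}(x)=+\infty ,$$ both limits being uniform with respect to $x/|x|$, and $$\frac{\partial u}{\partial r}(x)>0\qquad\text{whenever } \frac{R+r}{2}<|x|<R .$$ -/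

import Mathlib

open Set Filter Topology MeasureTheory

/-- The open annulus `r < |x| < R` in `ℝ^N` (Euclidean norm). -/
noncomputable def annulus (N : ℕ) (r R : ℝ) : Set (EuclideanSpace ℝ (Fin N)) :=
  {x | r < ‖x‖ ∧ ‖x‖ < R}

/-- The filter of `|x| → R` from inside, uniformly in the direction `x / |x|`: its basic sets are
the shells `R - δ < |x| < R`. A limit along it is a limit uniform over the spheres `|x| = ρ`
as `ρ ↑ R`. -/
noncomputable def towardsSphere (N : ℕ) (R : ℝ) : Filter (EuclideanSpace ℝ (Fin N)) :=
  comap (fun x => ‖x‖) (𝓝[<] R)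

/-- The radial derivative `∂u/∂r (x) = ⟨Du(x), x / |x|⟩`. -/
noncomputable def radialDeriv {N : ℕ} (u : EuclideanSpace ℝ (Fin N) → ℝ)
    (x : EuclideanSpace ℝ (Fin N)) : ℝ :=
  inner ℝ (gradient u x) (‖x‖⁻¹ • x)

/-- The tangential gradient `Du(x) - ∂u/∂r (x) x / |x|`. -/
noncomputable def tangentialGradient {N : ℕ} (u : EuclideanSpace ℝ (Fin N) → ℝ)
    (x : EuclideanSpace ℝ (Fin N)) : EuclideanSpace ℝ (Fin N) :=
  gradient u x - radialDeriv u x • (‖x‖⁻¹ • x)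

/-- For some `a > 0`, the function `g` is positive and convex on `[a, ∞)` and satisfies the
Keller-Osserman condition `∫_a^∞ dt / √(G t) < ∞`, where `G t = ∫_a^t g`. -/
def ConvexKellerOsserman (g : ℝ → ℝ) : Prop :=
  ∃ a : ℝ, 0 < a ∧ (∀ t ∈ Ici a, 0 < g t) ∧ ConvexOn ℝ (Ici a) g ∧
    IntegrableOn (fun t : ℝ => 1 / Real.sqrt (∫ s in a..t, g s)) (Ioi a)

/-- `u` is a classical (`C²`) solution of `-Δu + g(u) = 0` in the annulus `r < |x| < R` which
tends to `+∞` (uniformly) as `|x| → R`; nothing is asked at `|x| = r`. -/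
structure IsOuterLargeSolution {N : ℕ} (g : ℝ → ℝ) (r R : ℝ)
    (u : EuclideanSpace ℝ (Fin N) → ℝ) : Prop where
  contDiffOn : ContDiffOn ℝ 2 u (annulus N r R)
  equation : ∀ x ∈ annulus N r R, -(Laplacian.laplacian u x) + g (u x) = 0
  blowUp : Tendsto u (towardsSphere N R) atTop

/-! The two limits come from comparing `u` with its own rotations; the sign of the radial derivative
comes from moving planes.

Near the outer sphere `u` is large, and there `g (u)` equals `f (u - t₀)` with `f` convex on the
whole line, strictly increasing, zero at `0` and Keller-Osserman
(`ConvexKellerOsserman.exists_isConvexAbsorption`). In inverse form the one-dimensional profile is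
`A t = ∫_t^∞ 1/√(2F)`, where `F` is the primitive of `f`. At a critical point of `A(u) + |x|` one
has `|A'(u)| |Du| = 1`, so the gradient disappears from the Laplacian and the maximum principle
applies. With a corrected profile `B` absorbing the curvature term `(N-1)/|x|`, this encloses every
large solution and shows that the quotient of two of them tends to `1` (`eventually_le_mul`).

Convexity of `f` turns this into control of differences. The function `(1+κ)u - κv` is a
supersolution where it is negative and is nonnegative near the outer sphere; letting `κ → ∞`, `v -
u` is at most its inner-boundary bound times a cutoff vanishing on the outer sphere
(`sub_le_quadraticCutoff`). A similar bound holds for `v₁ + v₂ - 2u` (`add_sub_le_quadraticCutoff`).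

Take `v`, `v₁`, `v₂` to be rotations of `u` by `±θ`: on the inner sphere their first and second
differences are `O(θ)` and `O(θ²)`. Dividing by `θ` and `θ²`, the tangential gradient is bounded by
a multiple of the cutoff, hence tends to `0`, and the second tangential derivatives are bounded
above. The equation then makes `s^(N-1) ∂u/∂r` nondecreasing along rays near the sphere. Since `u`
blows up, the mean value theorem forces `∂u/∂r → ∞`.

These limits make `u` increasing near the outer sphere in any direction `e` at a definite acute
angle to the normal, which starts the moving planes `⟨x, e⟩ = l` from `l` near `R` and controls them
where they meet the outer sphere. The Hopf barrier yields both the strong maximum principle in caps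
and the sign of `∂u/∂e` on the plane. Nothing stops the plane while the reflected cap avoids the
inner ball, that is for `l > (R+r)/2`. The last claim follows with `e = x/|x|` and `l = |x|`. -/

/-! ### Calculus of the Laplacian through second derivatives along lines. -/

section LaplacianTools

variable {E : Type*} [NormedAddCommGroup E] [InnerProductSpace ℝ E]

/-- If the second derivative were negative, the second derivative test would make `t` a local
maximum too, so `φ` would be locally constant with second derivative `0`. -/
theorem IsLocalMin.deriv_deriv_nonneg {φ : ℝ → ℝ} {t : ℝ} (h : IsLocalMin φ t)
    (hc : ContinuousAt φ t) : 0 ≤ deriv (deriv φ) t := by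
  by_contra! hneg
  have hmax := isLocalMax_of_deriv_deriv_neg hneg h.deriv_eq_zero hc
  have hconst : φ =ᶠ[𝓝 t] fun _ => φ t := by
    filter_upwards [h, hmax] with s h1 h2 using le_antisymm h2 h1
  have := hconst.deriv.deriv_eq
  simp at this
  linarith

theorem hasDerivAt_line {u : E → ℝ} {x e : E} {t : ℝ} (hu : DifferentiableAt ℝ u (x + t • e)) :
    HasDerivAt (fun s : ℝ => u (x + s • e)) (fderiv ℝ u (x + t • e) e) t := by
  have h1 : HasDerivAt (fun s : ℝ => x + s • e) e t := by
    simpa using ((hasDerivAt_id t).smul_const e).const_add x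
  exact hu.hasFDerivAt.comp_hasDerivAt t h1

theorem ContDiffAt.eventually_differentiableAt {u : E → ℝ} {x : E} (hu : ContDiffAt ℝ 2 u x) :
    ∀ᶠ y in 𝓝 x, DifferentiableAt ℝ u y :=
  (hu.eventually (by simp)).mono fun _ hy => hy.differentiableAt (by simp)

theorem ContDiffAt.differentiableAt_fderiv {u : E → ℝ} {x : E} (hu : ContDiffAt ℝ 2 u x) :
    DifferentiableAt ℝ (fderiv ℝ u) x :=
  (hu.fderiv_right (m := 1) (by norm_num)).differentiableAt (by simp)

theorem tendsto_line (x e : E) : Tendsto (fun s : ℝ => x + s • e) (𝓝 0) (𝓝 x) := by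
  have : Continuous fun s : ℝ => x + s • e := by fun_prop
  simpa using this.tendsto 0

theorem deriv_line_eventuallyEq {u : E → ℝ} {x : E} (hu : ContDiffAt ℝ 2 u x) (e : E) :
    deriv (fun s : ℝ => u (x + s • e)) =ᶠ[𝓝 0] fun s => fderiv ℝ u (x + s • e) e := by
  filter_upwards [(tendsto_line x e).eventually hu.eventually_differentiableAt] with s hs
  exact (hasDerivAt_line hs).deriv

theorem hasDerivAt_fderiv_line {u : E → ℝ} {x : E} (hu : ContDiffAt ℝ 2 u x) (e e' : E) :
    HasDerivAt (fun s : ℝ => fderiv ℝ u (x + s • e) e') (fderiv ℝ (fderiv ℝ u) x e e') 0 := by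
  have h2 : HasFDerivAt (fderiv ℝ u) (fderiv ℝ (fderiv ℝ u) x) x :=
    hu.differentiableAt_fderiv.hasFDerivAt
  have h3 : HasFDerivAt (fun y => fderiv ℝ u y e')
      ((fderiv ℝ (fderiv ℝ u) x).flip e') x := by
    simpa using! (ContinuousLinearMap.apply ℝ ℝ e').hasFDerivAt.comp x h2
  have h4 := hasDerivAt_line (u := fun y => fderiv ℝ u y e') (x := x) (e := e) (t := 0)
    (by simpa using h3.differentiableAt)
  simpa [h3.fderiv] using h4

theorem deriv_deriv_line {u : E → ℝ} {x : E} (hu : ContDiffAt ℝ 2 u x) (e : E) :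
    deriv (deriv (fun s : ℝ => u (x + s • e))) 0 = fderiv ℝ (fderiv ℝ u) x e e := by
  rw [(deriv_line_eventuallyEq hu e).deriv_eq]
  exact (hasDerivAt_fderiv_line hu e e).deriv

theorem fderiv_fderiv_comp {u : E → ℝ} {x : E} {A : ℝ → ℝ} (hu : ContDiffAt ℝ 2 u x)
    (hA : ContDiffAt ℝ 2 A (u x)) (e : E) :
    fderiv ℝ (fderiv ℝ (fun y => A (u y))) x e e =
      deriv (deriv A) (u x) * (fderiv ℝ u x e) ^ 2
        + deriv A (u x) * fderiv ℝ (fderiv ℝ u) x e e := by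
  have hcomp : ContDiffAt ℝ 2 (fun y => A (u y)) x := hA.comp x hu
  have hAd : ∀ᶠ t in 𝓝 (u x), DifferentiableAt ℝ A t :=
    (hA.eventually (by simp)).mono fun _ hy => hy.differentiableAt (by simp)
  have hA2 : DifferentiableAt ℝ (deriv A) (u x) :=
    (hA.differentiableAt_fderiv.clm_apply (differentiableAt_const (1 : ℝ))).congr_of_eventuallyEq
      (Eventually.of_forall fun t => by simp)
  have hline : Tendsto (fun s : ℝ => u (x + s • e)) (𝓝 0) (𝓝 (u x)) :=
    hu.continuousAt.tendsto.comp (tendsto_line x e)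
  have hux : DifferentiableAt ℝ u x := hu.differentiableAt (by simp)
  rw [← deriv_deriv_line hcomp, ← deriv_deriv_line hu]
  have h1 : deriv (fun s : ℝ => A (u (x + s • e))) =ᶠ[𝓝 0]
      fun s => deriv A (u (x + s • e)) * deriv (fun s : ℝ => u (x + s • e)) s := by
    filter_upwards [hline.eventually hAd,
      (tendsto_line x e).eventually hu.eventually_differentiableAt] with s hs1 hs2
    exact (hs1.hasDerivAt.comp s (hasDerivAt_line hs2).differentiableAt.hasDerivAt).deriv
  rw [h1.deriv_eq]
  have h0 : HasDerivAt (fun s : ℝ => u (x + s • e)) (fderiv ℝ u x e) 0 := by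
    simpa using hasDerivAt_line (u := u) (x := x) (e := e) (t := 0) (by simpa using hux)
  have h2 : HasDerivAt (fun s : ℝ => deriv A (u (x + s • e)))
      (deriv (deriv A) (u x) * fderiv ℝ u x e) 0 := by
    have hA3 : HasDerivAt (deriv A) (deriv (deriv A) (u x)) (u (x + (0 : ℝ) • e)) := by
      simpa using hA2.hasDerivAt
    exact hA3.comp 0 h0
  have h3 : DifferentiableAt ℝ (deriv (fun s : ℝ => u (x + s • e))) 0 :=
    (hasDerivAt_fderiv_line hu e e).differentiableAt.congr_of_eventuallyEq
      (deriv_line_eventuallyEq hu e)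
  have h4 := (h2.mul h3.hasDerivAt).deriv
  rw [h0.deriv] at h4
  refine h4.trans ?_
  simp
  ring

theorem contDiffAt_sub_norm_sq (c x : E) : ContDiffAt ℝ 2 (fun y : E => ‖y - c‖ ^ 2) x :=
  (contDiffAt_id.sub contDiffAt_const).norm_sq ℝ

theorem norm_fderiv_sub_norm_sq (c x : E) :
    ‖fderiv ℝ (fun y : E => ‖y - c‖ ^ 2) x‖ = 2 * ‖x - c‖ := by
  have h : HasFDerivAt (fun y : E => ‖y - c‖ ^ 2) (2 • innerSL ℝ (x - c)) x := by
    simpa using ((hasFDerivAt_id x).sub_const c).norm_sq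
  rw [h.fderiv, ← Nat.cast_smul_eq_nsmul ℝ, norm_smul, innerSL_apply_norm]
  simp

theorem norm_fderiv_norm_eq_one {x : E} (hx : x ≠ 0) : ‖fderiv ℝ (fun y : E => ‖y‖) x‖ = 1 := by
  have : Nontrivial E := ⟨x, 0, hx⟩
  exact norm_fderiv_norm ((contDiffAt_norm ℝ hx (n := 1)).differentiableAt (by simp))

variable [FiniteDimensional ℝ E]

theorem laplacian_eq_sum_fderiv {ι : Type*} [Fintype ι] (b : OrthonormalBasis ι ℝ E) (u : E → ℝ)
    (x : E) : Laplacian.laplacian u x = ∑ i, fderiv ℝ (fderiv ℝ u) x (b i) (b i) := by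
  rw [InnerProductSpace.laplacian_eq_iteratedFDeriv_orthonormalBasis u b]
  simp [iteratedFDeriv_two_apply]

theorem laplacian_nonneg_of_isLocalMin {u : E → ℝ} {x : E} (hu : ContDiffAt ℝ 2 u x)
    (h : IsLocalMin u x) : 0 ≤ Laplacian.laplacian u x := by
  rw [laplacian_eq_sum_fderiv (stdOrthonormalBasis ℝ E)]
  refine Finset.sum_nonneg fun i _ => ?_
  rw [← deriv_deriv_line hu]
  have hl := tendsto_line x (stdOrthonormalBasis ℝ E i)
  apply IsLocalMin.deriv_deriv_nonneg
  · have := hl.eventually h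
    simpa [IsLocalMin, IsMinFilter] using this
  · have : ContinuousAt u (x + (0 : ℝ) • stdOrthonormalBasis ℝ E i) := by
      simpa using hu.continuousAt
    exact ContinuousAt.comp (f := fun s : ℝ => x + s • stdOrthonormalBasis ℝ E i) this
      (by fun_prop)

theorem laplacian_nonpos_of_isLocalMax {u : E → ℝ} {x : E} (hu : ContDiffAt ℝ 2 u x)
    (h : IsLocalMax u x) : Laplacian.laplacian u x ≤ 0 := by
  have := laplacian_nonneg_of_isLocalMin hu.neg h.neg
  rw [show (fun x => -u x) = -u from rfl, InnerProductSpace.laplacian_neg] at this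
  simpa using this

theorem sum_sq_apply_orthonormalBasis {ι : Type*} [Fintype ι] (b : OrthonormalBasis ι ℝ E)
    (L : E →L[ℝ] ℝ) : ∑ i, (L (b i)) ^ 2 = ‖L‖ ^ 2 := by
  set v := (InnerProductSpace.toDual ℝ E).symm L
  have hv : ∀ y, L y = inner ℝ v y := fun y => by simp [v]
  have := b.sum_sq_norm_inner_left v
  have hn : ‖L‖ = ‖v‖ := by simp [v]
  rw [hn, ← this]
  exact Finset.sum_congr rfl fun i _ => by simp [hv]

theorem laplacian_comp {u : E → ℝ} {x : E} {A : ℝ → ℝ} (hu : ContDiffAt ℝ 2 u x)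
    (hA : ContDiffAt ℝ 2 A (u x)) :
    Laplacian.laplacian (fun y => A (u y)) x =
      deriv (deriv A) (u x) * ‖fderiv ℝ u x‖ ^ 2 + deriv A (u x) * Laplacian.laplacian u x := by
  simp only [laplacian_eq_sum_fderiv (stdOrthonormalBasis ℝ E), fderiv_fderiv_comp hu hA,
    Finset.sum_add_distrib, ← Finset.mul_sum, sum_sq_apply_orthonormalBasis]

/-- The Laplacian may be computed in any orthonormal basis: using a basis on one side and its image
under `L` on the other, the sums agree term by term. -/
theorem laplacian_comp_affineIsometry {u : E → ℝ} (L : E ≃ₗᵢ[ℝ] E) (c x : E)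
    (hu : ContDiffAt ℝ 2 u (c + L x)) :
    Laplacian.laplacian (fun y => u (c + L y)) x = Laplacian.laplacian u (c + L x) := by
  have hcomp : ContDiffAt ℝ 2 (fun y => u (c + L y)) x := by
    have : ContDiffAt ℝ 2 (fun y => c + L y) x :=
      contDiffAt_const.add L.contDiff.contDiffAt
    exact hu.comp x this
  rw [laplacian_eq_sum_fderiv (stdOrthonormalBasis ℝ E),
    laplacian_eq_sum_fderiv ((stdOrthonormalBasis ℝ E).map L)]
  refine Finset.sum_congr rfl fun i _ => ?_
  rw [← deriv_deriv_line hcomp, ← deriv_deriv_line hu]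
  simp [add_assoc]

theorem laplacian_sub_norm_sq (c x : E) :
    Laplacian.laplacian (fun y : E => ‖y - c‖ ^ 2) x = 2 * Module.finrank ℝ E := by
  have hb : ∀ i, fderiv ℝ (fderiv ℝ (fun y : E => ‖y - c‖ ^ 2)) x (stdOrthonormalBasis ℝ E i)
      (stdOrthonormalBasis ℝ E i) = 2 := by
    intro i
    set e := stdOrthonormalBasis ℝ E i
    have he : ‖e‖ = 1 := (stdOrthonormalBasis ℝ E).orthonormal.1 i
    rw [← deriv_deriv_line (contDiffAt_sub_norm_sq c x)]
    have h1 : (fun s : ℝ => ‖x + s • e - c‖ ^ 2) =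
        fun s => ‖x - c‖ ^ 2 + 2 * inner ℝ (x - c) e * s + s ^ 2 := by
      funext s
      rw [show x + s • e - c = (x - c) + s • e by abel, norm_add_sq_real, inner_smul_right,
        norm_smul, he]
      simp; ring
    have h2 : deriv (fun s : ℝ => ‖x + s • e - c‖ ^ 2) =
        fun s => 2 * inner ℝ (x - c) e + 2 * s := by
      funext s
      rw [h1]
      have := (((hasDerivAt_id s).const_mul (2 * inner ℝ (x - c) e)).const_add
        (‖x - c‖ ^ 2)).add ((hasDerivAt_id s).pow 2)
      simpa using! this.deriv
    rw [h2]
    simp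
  rw [laplacian_eq_sum_fderiv (stdOrthonormalBasis ℝ E)]
  simp [hb, mul_comm]

/-- Obtained without differentiating the norm twice: the chain rule for `t ↦ t ^ 2` gives an
equation for the unknown Laplacian, since that of `‖y‖ ^ 2` is known. -/
theorem laplacian_norm {x : E} (hx : x ≠ 0) :
    Laplacian.laplacian (fun y : E => ‖y‖) x = (Module.finrank ℝ E - 1) / ‖x‖ := by
  have hn : (0 : ℝ) < ‖x‖ := norm_pos_iff.2 hx
  have h1 := laplacian_comp (A := fun t => t ^ 2) (contDiffAt_norm ℝ hx (n := 2))
    (contDiff_id.pow 2).contDiffAt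
  have h2 : Laplacian.laplacian (fun y : E => ‖y‖ ^ 2) x = 2 * Module.finrank ℝ E := by
    simpa using laplacian_sub_norm_sq (0 : E) x
  have hd : deriv (fun t : ℝ => t ^ 2) = fun t => 2 * t := by
    funext t; simp
  have hdd : deriv (fun t : ℝ => 2 * t) = fun _ => 2 := by
    funext t; simp
  rw [h2, hd, hdd, norm_fderiv_norm_eq_one hx] at h1
  field_simp
  linarith

/-- At a critical point `A'(u) Du = -D|x|` has norm `1`, so `|Du|²` can be replaced by `1 / A'(u)²`.
The sign of the Laplacian at an extremum then depends on one-variable quantities only. -/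
theorem laplacian_comp_add_norm_of_fderiv_eq_zero {u : E → ℝ} {x : E} {A : ℝ → ℝ}
    (hu : ContDiffAt ℝ 2 u x) (hA : ContDiffAt ℝ 2 A (u x)) (hx : x ≠ 0)
    (h : fderiv ℝ (fun y => A (u y) + ‖y‖) x = 0) :
    deriv A (u x) ≠ 0 ∧ Laplacian.laplacian (fun y => A (u y) + ‖y‖) x =
      deriv (deriv A) (u x) / (deriv A (u x)) ^ 2 + deriv A (u x) * Laplacian.laplacian u x
        + (Module.finrank ℝ E - 1) / ‖x‖ := by
  have hn := contDiffAt_norm ℝ hx (n := 2)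
  have hcomp : ContDiffAt ℝ 2 (fun y => A (u y)) x := hA.comp x hu
  have hfd : fderiv ℝ (fun y => A (u y)) x = deriv A (u x) • fderiv ℝ u x := by
    have h1 := (hA.differentiableAt (by simp)).hasDerivAt.comp_hasFDerivAt x
      (hu.differentiableAt (by simp)).hasFDerivAt
    exact h1.fderiv
  have hsum : fderiv ℝ (fun y => A (u y) + ‖y‖) x =
      fderiv ℝ (fun y => A (u y)) x + fderiv ℝ (fun y : E => ‖y‖) x :=
    ((hcomp.differentiableAt (by simp)).hasFDerivAt.add
      (hn.differentiableAt (by simp)).hasFDerivAt).fderiv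
  have hnorm : |deriv A (u x)| * ‖fderiv ℝ u x‖ = 1 := by
    rw [← Real.norm_eq_abs, ← norm_smul, ← hfd, ← norm_fderiv_norm_eq_one hx,
      eq_neg_of_add_eq_zero_left (hsum.symm.trans h), norm_neg]
  have h0 : deriv A (u x) ≠ 0 := by
    intro h0; simp [h0] at hnorm
  have hsq : ‖fderiv ℝ u x‖ ^ 2 = 1 / (deriv A (u x)) ^ 2 := by
    rw [eq_div_iff (pow_ne_zero 2 h0), ← sq_abs (deriv A (u x)), ← mul_pow, mul_comm, hnorm,
      one_pow]
  refine ⟨h0, ?_⟩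
  have hadd := hcomp.laplacian_add hn
  rw [laplacian_norm hx, laplacian_comp hu hA, hsq] at hadd
  rw [mul_one_div] at hadd
  exact hadd

end LaplacianTools

/-! ### One-dimensional profiles and barriers for a convex absorption. -/

/-- A strictly increasing convex absorption, normalised by `f 0 = 0`, with the Keller-Osserman
condition. -/
structure IsConvexAbsorption (f : ℝ → ℝ) : Prop where
  convexOn : ConvexOn ℝ univ f
  map_zero : f 0 = 0
  strictMono : StrictMono f
  integrableOn : ∃ c : ℝ, 0 < c ∧ IntegrableOn (fun t : ℝ => 1 / √(∫ s in (0:ℝ)..t, f s)) (Ioi c)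

namespace IsConvexAbsorption

theorem continuous {f : ℝ → ℝ} (hf : IsConvexAbsorption f) : Continuous f := by
  rw [← continuousOn_univ]
  exact hf.convexOn.continuousOn isOpen_univ

end IsConvexAbsorption

section Tail

variable {w : ℝ → ℝ} {c : ℝ}

/-- A primitive of `-w` on `(0, ∞)` which vanishes at infinity. -/
noncomputable def tailIntegral (w : ℝ → ℝ) (c t : ℝ) : ℝ :=
  (∫ s in Ioi c, w s) - ∫ s in c..t, w s

/-- Since the tail is a constant minus an integral from `c`, continuity of `w` suffices here;
integrability at infinity enters only through the limit and the positivity. -/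
theorem hasDerivAt_tailIntegral (hc : 0 < c) (hw : ContinuousOn w (Ioi 0)) {t : ℝ} (ht : 0 < t) :
    HasDerivAt (tailIntegral w c) (-w t) t := by
  have hsub : uIcc c t ⊆ Ioi 0 := fun s hs => lt_of_lt_of_le (lt_min hc ht) hs.1
  have h1 : HasDerivAt (fun t => ∫ s in c..t, w s) (w t) t :=
    intervalIntegral.integral_hasDerivAt_right ((hw.mono hsub).intervalIntegrable)
      (hw.stronglyMeasurableAtFilter isOpen_Ioi t ht) (hw.continuousAt (Ioi_mem_nhds ht))
  exact h1.const_sub _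

theorem deriv_tailIntegral (hc : 0 < c) (hw : ContinuousOn w (Ioi 0)) {t : ℝ} (ht : 0 < t) :
    deriv (tailIntegral w c) t = -w t :=
  (hasDerivAt_tailIntegral hc hw ht).deriv

theorem contDiffOn_tailIntegral (hc : 0 < c) (hw : ContDiffOn ℝ 1 w (Ioi 0)) :
    ContDiffOn ℝ 2 (tailIntegral w c) (Ioi 0) := by
  rw [show (2 : WithTop ℕ∞) = 1 + 1 by norm_num, contDiffOn_succ_iff_deriv_of_isOpen isOpen_Ioi]
  refine ⟨fun t ht => (hasDerivAt_tailIntegral hc hw.continuousOn ht).differentiableAt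
    |>.differentiableWithinAt, by simp, ?_⟩
  exact hw.neg.congr fun t ht => deriv_tailIntegral hc hw.continuousOn ht

theorem deriv_deriv_tailIntegral (hc : 0 < c) (hw : ContinuousOn w (Ioi 0)) {t w' : ℝ}
    (ht : 0 < t) (h : HasDerivAt w w' t) : deriv (deriv (tailIntegral w c)) t = -w' := by
  have : deriv (tailIntegral w c) =ᶠ[𝓝 t] fun s => -w s := by
    filter_upwards [Ioi_mem_nhds ht] with s hs using deriv_tailIntegral hc hw hs
  rw [this.deriv_eq]
  exact h.neg.deriv

theorem tendsto_tailIntegral (hi : IntegrableOn w (Ioi c)) :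
    Tendsto (tailIntegral w c) atTop (𝓝 0) := by
  have := (intervalIntegral_tendsto_integral_Ioi c hi tendsto_id).const_sub (∫ s in Ioi c, w s)
  simpa [tailIntegral] using! this

theorem strictAntiOn_tailIntegral (hc : 0 < c) (hw : ContinuousOn w (Ioi 0))
    (hpos : ∀ t, 0 < t → 0 < w t) : StrictAntiOn (tailIntegral w c) (Ioi 0) := by
  apply strictAntiOn_of_deriv_neg (convex_Ioi 0)
  · exact fun t ht => (hasDerivAt_tailIntegral hc hw ht).continuousAt.continuousWithinAt
  · intro t ht
    rw [interior_Ioi] at ht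
    rw [deriv_tailIntegral hc hw ht]
    linarith [hpos t ht]

theorem tailIntegral_pos (hc : 0 < c) (hw : ContinuousOn w (Ioi 0))
    (hpos : ∀ t, 0 < t → 0 < w t) (hi : IntegrableOn w (Ioi c)) {t : ℝ} (ht : 0 < t) :
    0 < tailIntegral w c t := by
  have hanti := strictAntiOn_tailIntegral hc hw hpos
  have h1 : 0 ≤ tailIntegral w c (t + 1) := by
    refine le_of_tendsto (tendsto_tailIntegral hi) ?_
    filter_upwards [eventually_ge_atTop (t + 1)] with s hs
    exact hanti.antitoneOn (mem_Ioi.2 (by linarith)) (mem_Ioi.2 (by linarith)) hs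
  exact h1.trans_lt (hanti (mem_Ioi.2 ht) (mem_Ioi.2 (by linarith)) (by linarith))

end Tail

namespace IsConvexAbsorption

variable {f : ℝ → ℝ}

theorem apply_pos (hf : IsConvexAbsorption f) {t : ℝ} (ht : 0 < t) : 0 < f t := by
  simpa [hf.map_zero] using hf.strictMono ht

/-- The speed `√(2F)` of the one-dimensional profile of level `t`. -/
noncomputable def speed (f : ℝ → ℝ) (t : ℝ) : ℝ := √(2 * ∫ s in (0:ℝ)..t, f s)

theorem hasDerivAt_primitive (hf : IsConvexAbsorption f) (t : ℝ) :
    HasDerivAt (fun t => ∫ s in (0:ℝ)..t, f s) (f t) t :=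
  intervalIntegral.integral_hasDerivAt_right (hf.continuous.intervalIntegrable _ _)
    (hf.continuous.stronglyMeasurableAtFilter _ _) hf.continuous.continuousAt

theorem primitive_pos (hf : IsConvexAbsorption f) {t : ℝ} (ht : 0 < t) :
    0 < ∫ s in (0:ℝ)..t, f s :=
  intervalIntegral.intervalIntegral_pos_of_pos_on (hf.continuous.intervalIntegrable _ _)
    (fun _ hs => hf.apply_pos hs.1) ht

/-- Convexity and `f 0 = 0` give `f s ≤ (s / t) f t` on `[0, t]`; integrate. -/
theorem two_mul_primitive_le (hf : IsConvexAbsorption f) {t : ℝ} (ht : 0 < t) :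
    2 * ∫ s in (0:ℝ)..t, f s ≤ t * f t := by
  have h1 : ∫ s in (0:ℝ)..t, f s ≤ ∫ s in (0:ℝ)..t, f t / t * s := by
    refine intervalIntegral.integral_mono_on ht.le (hf.continuous.intervalIntegrable _ _)
      (Continuous.intervalIntegrable (by fun_prop) _ _) fun s hs => ?_
    have := hf.convexOn.2 (mem_univ 0) (mem_univ t) (show 0 ≤ 1 - s / t by rw [sub_nonneg, div_le_one ht]; exact hs.2)
      (div_nonneg hs.1 ht.le) (by ring)
    simp only [smul_eq_mul, mul_zero, hf.map_zero, zero_add] at this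
    rw [div_mul_cancel₀ _ ht.ne'] at this
    calc f s ≤ s / t * f t := this
      _ = f t / t * s := by ring
  rw [intervalIntegral.integral_const_mul, integral_id] at h1
  have h2 : f t / t * ((t ^ 2 - 0 ^ 2) / 2) = t * f t / 2 := by field_simp; ring
  linarith

theorem speed_pos (hf : IsConvexAbsorption f) {t : ℝ} (ht : 0 < t) : 0 < speed f t :=
  Real.sqrt_pos.2 (by linarith [hf.primitive_pos ht])

theorem speed_sq (hf : IsConvexAbsorption f) {t : ℝ} (ht : 0 < t) :
    speed f t ^ 2 = 2 * ∫ s in (0:ℝ)..t, f s :=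
  Real.sq_sqrt (by linarith [hf.primitive_pos ht])

theorem hasDerivAt_speed (hf : IsConvexAbsorption f) {t : ℝ} (ht : 0 < t) :
    HasDerivAt (speed f) (f t / speed f t) t := by
  have h1 := ((hf.hasDerivAt_primitive t).const_mul 2).sqrt
    (by linarith [hf.primitive_pos ht] : (2 * ∫ s in (0:ℝ)..t, f s) ≠ 0)
  rw [mul_div_mul_left _ _ two_ne_zero] at h1
  exact h1

theorem contDiffOn_speed (hf : IsConvexAbsorption f) : ContDiffOn ℝ 1 (speed f) (Ioi 0) := by
  have h1 : ContDiff ℝ 1 (fun t => 2 * ∫ s in (0:ℝ)..t, f s) := by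
    refine contDiff_const.mul ?_
    rw [contDiff_one_iff_deriv]
    refine ⟨fun t => (hf.hasDerivAt_primitive t).differentiableAt, ?_⟩
    rw [show deriv (fun t => ∫ s in (0:ℝ)..t, f s) = f from
      funext fun t => (hf.hasDerivAt_primitive t).deriv]
    exact hf.continuous
  exact h1.contDiffOn.sqrt fun t ht => by linarith [hf.primitive_pos ht]

theorem speed_monotoneOn (hf : IsConvexAbsorption f) : MonotoneOn (speed f) (Ioi 0) := by
  apply monotoneOn_of_deriv_nonneg (convex_Ioi 0) hf.contDiffOn_speed.continuousOn
  · rw [interior_Ioi]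
    exact fun t ht => (hf.hasDerivAt_speed ht).differentiableAt.differentiableWithinAt
  · rw [interior_Ioi]
    intro t ht
    rw [(hf.hasDerivAt_speed ht).deriv]
    exact div_nonneg (hf.apply_pos ht).le (hf.speed_pos ht).le

theorem hasDerivAt_div_speed (hf : IsConvexAbsorption f) {t : ℝ} (ht : 0 < t) :
    HasDerivAt (fun t => t / speed f t)
      ((speed f t - t * (f t / speed f t)) / speed f t ^ 2) t := by
  have := (hasDerivAt_id t).div (hf.hasDerivAt_speed ht) (hf.speed_pos ht).ne'
  simpa using! this

/-- The derivative has the sign of `2F(t) - t f(t)`, which is nonpositive by `two_mul_primitive_le`.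
-/
theorem div_speed_antitoneOn (hf : IsConvexAbsorption f) :
    AntitoneOn (fun t => t / speed f t) (Ioi 0) := by
  apply antitoneOn_of_deriv_nonpos (convex_Ioi 0)
  · exact fun t ht => (hf.hasDerivAt_div_speed ht).continuousAt.continuousWithinAt
  · rw [interior_Ioi]
    exact fun t ht => (hf.hasDerivAt_div_speed ht).differentiableAt.differentiableWithinAt
  · rw [interior_Ioi]
    intro t ht
    have hp := hf.speed_pos ht
    rw [(hf.hasDerivAt_div_speed ht).deriv]
    apply div_nonpos_of_nonpos_of_nonneg _ (sq_nonneg _)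
    rw [sub_nonpos, mul_div_assoc', le_div_iff₀ hp, ← sq, hf.speed_sq ht]
    exact hf.two_mul_primitive_le ht

theorem exists_integrableOn_inv_speed (hf : IsConvexAbsorption f) :
    ∃ c : ℝ, 0 < c ∧ IntegrableOn (fun t => 1 / speed f t) (Ioi c) := by
  obtain ⟨c, hc, hi⟩ := hf.integrableOn
  refine ⟨c, hc, IntegrableOn.congr_fun (hi.const_mul (1 / √2)) (fun t _ => ?_)
    measurableSet_Ioi⟩
  simp only [speed]
  rw [Real.sqrt_mul (by norm_num)]
  ring

theorem continuousOn_inv_speed (hf : IsConvexAbsorption f) :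
    ContinuousOn (fun t => 1 / speed f t) (Ioi 0) :=
  continuousOn_const.div hf.contDiffOn_speed.continuousOn fun _ ht => (hf.speed_pos ht).ne'

theorem inv_speed_mul_sub_le (hf : IsConvexAbsorption f) {c s t : ℝ} (hc : 0 < c) (hs : 0 < s)
    (hst : s ≤ t) :
    (t - s) / speed f t ≤ tailIntegral (fun t => 1 / speed f t) c s
      - tailIntegral (fun t => 1 / speed f t) c t := by
  have hd : ∀ x, 0 < x → HasDerivAt (fun x => tailIntegral (fun t => 1 / speed f t) c x
      + x / speed f t) (-(1 / speed f x) + 1 / speed f t) x := fun x hx =>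
    (hasDerivAt_tailIntegral hc hf.continuousOn_inv_speed hx).add
      ((hasDerivAt_id x).div_const _)
  have hsub : Icc s t ⊆ Ioi 0 := fun x hx => hs.trans_le hx.1
  have hanti : AntitoneOn (fun x => tailIntegral (fun t => 1 / speed f t) c x
      + x / speed f t) (Icc s t) := by
    apply antitoneOn_of_deriv_nonpos (convex_Icc s t)
    · exact fun x hx => (hd x (hsub hx)).continuousAt.continuousWithinAt
    · exact fun x hx => (hd x (hsub (interior_subset hx))).differentiableAt.differentiableWithinAt
    · intro x hx
      have hx := interior_subset hx
      rw [(hd x (hsub hx)).deriv]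
      have := one_div_le_one_div_of_le (hf.speed_pos (hsub hx))
        (hf.speed_monotoneOn (hsub hx) (hs.trans_le hst) hx.2)
      linarith
  have := hanti (left_mem_Icc.2 hst) (right_mem_Icc.2 hst) hst
  simp only at this
  rw [sub_div]
  linarith

/-- The tail integral of `1 / speed` over `[t/2, t]` is at least `(t/2) / speed f t`, since the
speed is nondecreasing, and it tends to `0` by Keller-Osserman. -/
theorem tendsto_div_speed (hf : IsConvexAbsorption f) :
    Tendsto (fun t => t / speed f t) atTop (𝓝 0) := by
  obtain ⟨c, hc, hi⟩ := hf.exists_integrableOn_inv_speed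
  have hA := tendsto_tailIntegral hi
  have h2 : Tendsto (fun t : ℝ => t / 2) atTop atTop := tendsto_id.atTop_div_const (by norm_num)
  have h3 := ((hA.comp h2).sub hA).const_mul 2
  rw [sub_zero, mul_zero] at h3
  refine squeeze_zero' ?_ ?_ h3
  · filter_upwards [eventually_gt_atTop 0] with t ht
    exact div_nonneg ht.le (hf.speed_pos ht).le
  · filter_upwards [eventually_gt_atTop 0] with t ht
    have := hf.inv_speed_mul_sub_le hc (s := t / 2) (t := t) (by linarith) (by linarith)
    rw [show t - t / 2 = t / 2 by ring, div_div, mul_comm, ← div_div] at this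
    simp only [Function.comp]
    linarith

end IsConvexAbsorption

namespace IsConvexAbsorption

variable {f : ℝ → ℝ}

/-- One-dimensional barriers: `A` is the exact one-dimensional profile in inverse form, and
`B` the profile in inverse form of a supersolution in the presence of a first-order term of
size `κ`. -/
theorem exists_barriers (hf : IsConvexAbsorption f) {κ : ℝ} (hκ : 0 ≤ κ) :
    ∃ (A B : ℝ → ℝ) (m c : ℝ), 0 < m ∧ 0 < c ∧
      (∀ t, 0 < t → ContDiffAt ℝ 2 A t ∧ deriv A t < 0 ∧
        deriv (deriv A) t / deriv A t ^ 2 + deriv A t * f t = 0) ∧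
      (∀ t, 0 < t → ContDiffAt ℝ 2 B t ∧ deriv B t < 0) ∧
      (∀ t, m ≤ t → deriv (deriv B) t / deriv B t ^ 2 + deriv B t * f t + κ < 0) ∧
      Tendsto A atTop (𝓝 0) ∧ AntitoneOn A (Ioi 0) ∧ (∀ t, 0 < t → 0 < B t) ∧
      ∀ s t, 0 < s → s ≤ t → A s ≤ B t → t - s ≤ c * t * A t := by
  obtain ⟨c, hc, hi⟩ := hf.exists_integrableOn_inv_speed
  -- Below, `η = k t / q` corrects the profile: `A' = -1/q` and `B' = -(1 + η)/q`. Once `η ≤ 1`, the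
  -- correction gains at least `k / (1 + η)² ≥ k / 4 > κ`.
  set k : ℝ := 4 * κ + 1 with hk
  have hk0 : 0 < k := by positivity
  set q := speed f with hq
  have hq0 : ∀ t, 0 < t → 0 < q t := fun t ht => hf.speed_pos ht
  set wA : ℝ → ℝ := fun t => 1 / q t with hwA
  set η : ℝ → ℝ := fun t => k * (t / q t) with hη
  set wB : ℝ → ℝ := fun t => (1 + η t) * wA t with hwB
  have hη0 : ∀ t, 0 < t → 0 < η t := fun t ht => mul_pos hk0 (div_pos ht (hq0 t ht))
  have hηanti : AntitoneOn η (Ioi 0) := fun s hs t ht hst =>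
    mul_le_mul_of_nonneg_left (hf.div_speed_antitoneOn hs ht hst) hk0.le
  have hwA1 : ContDiffOn ℝ 1 wA (Ioi 0) :=
    contDiffOn_const.div hf.contDiffOn_speed fun t ht => (hq0 t ht).ne'
  have hη1 : ContDiffOn ℝ 1 η (Ioi 0) :=
    contDiffOn_const.mul (contDiffOn_id.div hf.contDiffOn_speed fun t ht => (hq0 t ht).ne')
  have hwB1 : ContDiffOn ℝ 1 wB (Ioi 0) := (contDiffOn_const.add hη1).mul hwA1
  have hwA0 : ∀ t, 0 < t → 0 < wA t := fun t ht => one_div_pos.2 (hq0 t ht)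
  have hwB0 : ∀ t, 0 < t → 0 < wB t := fun t ht =>
    mul_pos (by linarith [hη0 t ht]) (hwA0 t ht)
  have hiB : IntegrableOn wB (Ioi c) := by
    refine Integrable.mono' (hi.const_mul (1 + η c)) ?_ ?_
    · exact (hwB1.continuousOn.mono (Ioi_subset_Ioi hc.le)).aestronglyMeasurable
        measurableSet_Ioi
    · filter_upwards [ae_restrict_mem measurableSet_Ioi] with t ht
      have ht0 : 0 < t := hc.trans ht
      rw [Real.norm_eq_abs, abs_of_pos (hwB0 t ht0)]
      exact mul_le_mul_of_nonneg_right
        (by linarith [hηanti (mem_Ioi.2 hc) (mem_Ioi.2 ht0) (le_of_lt ht)]) (hwA0 t ht0).le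
  have hq' : ∀ t, 0 < t → HasDerivAt q (f t / q t) t := fun t ht => hf.hasDerivAt_speed ht
  have hwA' : ∀ t, 0 < t → HasDerivAt wA (-(f t / q t) / q t ^ 2) t := fun t ht => by
    simpa [hwA] using! (hq' t ht).inv (hq0 t ht).ne'
  have hη' : ∀ t, 0 < t → HasDerivAt η (k * ((q t - t * (f t / q t)) / q t ^ 2)) t :=
    fun t ht => (hf.hasDerivAt_div_speed ht).const_mul k
  have hwB' : ∀ t, 0 < t → HasDerivAt wB (k * ((q t - t * (f t / q t)) / q t ^ 2) * wA t
      + (1 + η t) * (-(f t / q t) / q t ^ 2)) t := fun t ht =>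
    ((hη' t ht).const_add 1).mul (hwA' t ht)
  obtain ⟨m, hm0, hm⟩ : ∃ m, 0 < m ∧ ∀ t, m ≤ t → η t ≤ 1 := by
    have h1 : Tendsto η atTop (𝓝 0) := by simpa using hf.tendsto_div_speed.const_mul k
    obtain ⟨m, hm⟩ := eventually_atTop.1 (h1.eventually (eventually_le_nhds (zero_lt_one)))
    exact ⟨max m 1, by positivity, fun t ht => hm t ((le_max_left _ _).trans ht)⟩
  have hA2 := contDiffOn_tailIntegral hc hwA1
  have hB2 := contDiffOn_tailIntegral hc hwB1
  have hdA : ∀ t, 0 < t → deriv (tailIntegral wA c) t = -wA t :=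
    fun t ht => deriv_tailIntegral hc hwA1.continuousOn ht
  have hdB : ∀ t, 0 < t → deriv (tailIntegral wB c) t = -wB t :=
    fun t ht => deriv_tailIntegral hc hwB1.continuousOn ht
  refine ⟨tailIntegral wA c, tailIntegral wB c, m, k, hm0, hk0, fun t ht => ⟨hA2.contDiffAt
    (Ioi_mem_nhds ht), ?_, ?_⟩, fun t ht => ⟨hB2.contDiffAt (Ioi_mem_nhds ht), ?_⟩, fun t ht => ?_,
    tendsto_tailIntegral hi,
    (strictAntiOn_tailIntegral hc hwA1.continuousOn hwA0).antitoneOn,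
    fun t ht => tailIntegral_pos hc hwB1.continuousOn hwB0 hiB ht, ?_⟩
  · rw [hdA t ht]; linarith [hwA0 t ht]
  · rw [hdA t ht, deriv_deriv_tailIntegral hc hwA1.continuousOn ht (hwA' t ht)]
    have := hq0 t ht
    simp only [hwA]
    field_simp
    ring
  · rw [hdB t ht]; linarith [hwB0 t ht]
  · have ht0 : 0 < t := hm0.trans_le ht
    rw [hdB t ht0, deriv_deriv_tailIntegral hc hwB1.continuousOn ht0 (hwB' t ht0)]
    have hqt := hq0 t ht0
    have hη1 := hm t ht
    have hη0 := hη0 t ht0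
    set p := f t / q t with hp
    have hp0 : 0 < p := div_pos (hf.apply_pos ht0) hqt
    have hfp : f t = p * q t := by rw [hp]; field_simp
    have hkt : k * t = η t * q t := by simp only [hη]; field_simp
    have e1 : -(k * ((q t - t * p) / q t ^ 2) * wA t + (1 + η t) * (-p / q t ^ 2)) / (-wB t) ^ 2
        = ((1 + 2 * η t) * p - k) / (1 + η t) ^ 2 := by
      have : k * ((q t - t * p) / q t ^ 2) = (k * q t - η t * q t * p) / q t ^ 2 := by
        rw [← hkt]; ring
      rw [this]
      simp only [hwB, hwA]
      have : (1 + η t) ≠ 0 := by positivity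
      field_simp
      ring
    have e2 : -wB t * f t = -(1 + η t) * p := by
      rw [hfp]; simp only [hwB, hwA]; field_simp
    rw [e1, e2]
    -- The terms in `p` compare by `1 + 2η ≤ (1 + η)³`; the constant terms by `(1 + η)² κ ≤ 4κ < k`.
    have h3 : ((1 + 2 * η t) * p - k) / (1 + η t) ^ 2 < (1 + η t) * p - κ := by
      rw [div_lt_iff₀ (by positivity)]
      have h4 : (1 + 2 * η t) * p ≤ (1 + η t) ^ 3 * p := by
        apply mul_le_mul_of_nonneg_right _ hp0.le
        nlinarith [pow_pos hη0 3, pow_pos hη0 2]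
      have h5 : (1 + η t) ^ 2 ≤ 4 := by nlinarith
      nlinarith [mul_le_mul_of_nonneg_left h5 hκ]
    linarith
  -- The chain is `(t - s)/q(t) ≤ A(s) - A(t) ≤ B(t) - A(t) = ∫_t^∞ η/q ≤ η(t) A(t)`, the last step
  -- because `η` is nonincreasing. Multiplying by `q(t)` gives the constant `k`.
  · intro s t hs hst hAB
    have ht : 0 < t := hs.trans_le hst
    have h1 := hf.inv_speed_mul_sub_le hc hs hst
    have hd : ∀ x, 0 < x → HasDerivAt (fun x => η t * tailIntegral wA c x
        - (tailIntegral wB c x - tailIntegral wA c x))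
        (η t * (-wA x) - (-wB x - -wA x)) x := fun x hx =>
      ((hasDerivAt_tailIntegral hc hwA1.continuousOn hx).const_mul _).sub
        ((hasDerivAt_tailIntegral hc hwB1.continuousOn hx).sub
          (hasDerivAt_tailIntegral hc hwA1.continuousOn hx))
    have hsub : Ici t ⊆ Ioi 0 := fun x hx => ht.trans_le hx
    have hanti : AntitoneOn (fun x => η t * tailIntegral wA c x
        - (tailIntegral wB c x - tailIntegral wA c x)) (Ici t) := by
      apply antitoneOn_of_deriv_nonpos (convex_Ici t)
      · exact fun x hx => (hd x (hsub hx)).continuousAt.continuousWithinAt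
      · exact fun x hx =>
          (hd x (hsub (interior_subset hx))).differentiableAt.differentiableWithinAt
      · intro x hx
        have hx := interior_subset hx
        rw [(hd x (hsub hx)).deriv]
        have h2 := mul_le_mul_of_nonneg_right (hηanti (mem_Ioi.2 ht) (hsub hx) hx)
          (hwA0 x (hsub hx)).le
        simp only [hwB]
        linarith
    have hlim : Tendsto (fun x => η t * tailIntegral wA c x
        - (tailIntegral wB c x - tailIntegral wA c x)) atTop (𝓝 0) := by
      have := ((tendsto_tailIntegral hi).const_mul (η t)).sub
        ((tendsto_tailIntegral hiB).sub (tendsto_tailIntegral hi))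
      simpa using! this
    have h2 : 0 ≤ η t * tailIntegral wA c t
        - (tailIntegral wB c t - tailIntegral wA c t) := by
      refine le_of_tendsto hlim ?_
      filter_upwards [eventually_ge_atTop t] with x hx
      exact hanti self_mem_Ici hx hx
    have h3 : (t - s) / q t ≤ η t * tailIntegral wA c t := by
      refine h1.trans ?_
      change tailIntegral wA c s - tailIntegral wA c t ≤ _
      linarith
    rw [div_le_iff₀ (hq0 t ht)] at h3
    refine h3.trans_eq ?_
    simp only [hη]
    have := hq0 t ht
    field_simp

end IsConvexAbsorption

/-! ### Replacing the nonlinearity by a normalised convex absorption. -/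

theorem not_integrableOn_one_div_sqrt {a : ℝ} (ha : 0 < a) :
    ¬ IntegrableOn (fun t : ℝ => 1 / √t) (Ioi a) := by
  intro h
  have h1 : IntegrableOn (fun t : ℝ => t ^ (-(1 / 2) : ℝ)) (Ioi a) := by
    refine IntegrableOn.congr_fun h (fun t ht => ?_) measurableSet_Ioi
    rw [Real.rpow_neg (ha.trans ht).le, ← Real.sqrt_eq_rpow, one_div]
  rw [integrableOn_Ioi_rpow_iff ha] at h1
  norm_num at h1

/-- Otherwise `g ≤ g a` on `[a, ∞)`, so `G(t) ≤ g(a) t`, and integrability of `1/√G` would imply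
that of `1/√t`. -/
theorem ConvexKellerOsserman.exists_lt {g : ℝ → ℝ} (hg : Continuous g) {a : ℝ} (ha : 0 < a)
    (hpos : ∀ t ∈ Ici a, 0 < g t)
    (hi : IntegrableOn (fun t : ℝ => 1 / √(∫ s in a..t, g s)) (Ioi a)) :
    ∃ s t, a ≤ s ∧ s < t ∧ g s < g t := by
  by_contra! hcon
  have hga := hpos a self_mem_Ici
  apply not_integrableOn_one_div_sqrt ha
  refine Integrable.mono' (hi.const_mul (√(g a))) ?_ ?_
  · refine ContinuousOn.aestronglyMeasurable (fun t ht => ?_) measurableSet_Ioi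
    exact (continuousAt_const.div Real.continuous_sqrt.continuousAt
      (Real.sqrt_pos.2 (ha.trans ht)).ne').continuousWithinAt
  · filter_upwards [ae_restrict_mem measurableSet_Ioi] with t ht
    have ht' : a < t := ht
    have hG : ∫ s in a..t, g s ≤ g a * t := by
      have : ∫ s in a..t, g s ≤ ∫ _ in a..t, g a := by
        refine intervalIntegral.integral_mono_on ht'.le (hg.intervalIntegrable _ _)
          (by simp) fun s hs => ?_
        rcases hs.1.eq_or_lt with h | h
        · rw [h]
        · exact hcon a s le_rfl h
      rw [intervalIntegral.integral_const, smul_eq_mul] at this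
      nlinarith
    have hG0 : 0 < ∫ s in a..t, g s :=
      intervalIntegral.intervalIntegral_pos_of_pos_on (hg.intervalIntegrable _ _)
        (fun s hs => hpos s hs.1.le) ht'
    rw [Real.norm_of_nonneg (by positivity), mul_one_div, div_le_div_iff₀
      (Real.sqrt_pos.2 (ha.trans ht')) (Real.sqrt_pos.2 hG0), one_mul,
      ← Real.sqrt_mul hga.le]
    exact Real.sqrt_le_sqrt hG

/-- Replacing a function to the left of `b` by the line of slope `m` through `(b, g b)`. -/
noncomputable def lineExtension (g : ℝ → ℝ) (b m t : ℝ) : ℝ :=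
  if t < b then g b + m * (t - b) else g t

section LineExtension

variable {g : ℝ → ℝ} {b m : ℝ}

theorem lineExtension_of_le {t : ℝ} (ht : b ≤ t) : lineExtension g b m t = g t :=
  if_neg ht.not_gt

theorem lineExtension_of_lt {t : ℝ} (ht : t < b) :
    lineExtension g b m t = g b + m * (t - b) :=
  if_pos ht

/-- The hypothesis on `m` says that the line is no steeper than any chord of `g` to the right of
`b`, so slopes of adjacent chords still increase across the junction. -/
theorem convexOn_lineExtension (hg : ConvexOn ℝ (Ici b) g)
    (hm : ∀ x y, b ≤ x → x < y → m ≤ (g y - g x) / (y - x)) :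
    ConvexOn ℝ univ (lineExtension g b m) := by
  apply convexOn_of_slope_mono_adjacent convex_univ
  intro x y z _ _ hxy hyz
  rcases le_or_gt b x with hx | hx
  · rw [lineExtension_of_le hx, lineExtension_of_le (hx.trans hxy.le),
      lineExtension_of_le ((hx.trans hxy.le).trans hyz.le)]
    exact hg.slope_mono_adjacent hx ((hx.trans hxy.le).trans hyz.le) hxy hyz
  · have hyx : 0 < y - x := sub_pos.2 hxy
    have hzy : 0 < z - y := sub_pos.2 hyz
    rw [lineExtension_of_lt hx]
    rcases le_or_gt b y with hy | hy
    · rw [lineExtension_of_le hy, lineExtension_of_le (hy.trans hyz.le)]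
      rcases hy.eq_or_lt with rfl | hby
      · have h1 := hm b z le_rfl hyz
        refine le_trans (le_of_eq ?_) h1
        field_simp
        ring
      -- The slope over `[x, y]` is a weighted mean of `m` and the slope over `[b, y]`, hence at
      -- most the latter.
      · have h1 := hg.slope_mono_adjacent (mem_Ici.2 le_rfl) (mem_Ici.2 (hy.trans hyz.le)) hby hyz
        have h2 := hm b y le_rfl hby
        refine le_trans ?_ h1
        have hyb : 0 < y - b := sub_pos.2 hby
        rw [le_div_iff₀ hyb] at h2
        rw [div_le_div_iff₀ hyx hyb]
        nlinarith
    · rw [lineExtension_of_lt hy]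
      have e1 : (g b + m * (y - b) - (g b + m * (x - b))) / (y - x) = m := by
        field_simp; ring
      rw [e1, le_div_iff₀ hzy]
      rcases le_or_gt b z with hz | hz
      · rw [lineExtension_of_le hz]
        rcases hz.eq_or_lt with rfl | hbz
        · linarith
        · have h2 := hm b z le_rfl hbz
          rw [le_div_iff₀ (sub_pos.2 hbz)] at h2
          linarith
      · rw [lineExtension_of_lt hz]
        linarith

theorem strictMono_lineExtension (hm0 : 0 < m)
    (hm : ∀ x y, b ≤ x → x < y → m ≤ (g y - g x) / (y - x)) :
    StrictMono (lineExtension g b m) := by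
  have hmono : ∀ x y, b ≤ x → x < y → g x < g y := fun x y hx hxy => by
    have h1 := hm x y hx hxy
    rw [le_div_iff₀ (sub_pos.2 hxy)] at h1
    nlinarith [mul_pos hm0 (sub_pos.2 hxy)]
  intro x y hxy
  rcases le_or_gt b x with hx | hx
  · rw [lineExtension_of_le hx, lineExtension_of_le (hx.trans hxy.le)]
    exact hmono x y hx hxy
  · rw [lineExtension_of_lt hx]
    rcases le_or_gt b y with hy | hy
    · rw [lineExtension_of_le hy]
      have h1 : g b ≤ g y := by
        rcases hy.eq_or_lt with rfl | h
        · exact le_rfl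
        · exact (hmono b y le_rfl h).le
      nlinarith
    · rw [lineExtension_of_lt hy]
      nlinarith

end LineExtension

/-- Under the convex Keller-Osserman condition, `g` agrees for large arguments with a translate of
a normalised convex absorption. -/
theorem ConvexKellerOsserman.exists_isConvexAbsorption {g : ℝ → ℝ} (hg : Continuous g)
    (h : ConvexKellerOsserman g) :
    ∃ (f : ℝ → ℝ) (t₀ b : ℝ), IsConvexAbsorption f ∧ t₀ < b ∧ ∀ t, b ≤ t → f (t - t₀) = g t := by
  obtain ⟨a, ha, hpos, hconv, hi⟩ := h
  obtain ⟨s, b, has, hsb, hgsb⟩ := ConvexKellerOsserman.exists_lt hg ha hpos hi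
  have hab : a ≤ b := has.trans hsb.le
  -- A positive chord slope to the left of `b`; by convexity it lies below every chord slope to the
  -- right of `b`.
  set m := (g b - g s) / (b - s) with hmdef
  have hm0 : 0 < m := div_pos (sub_pos.2 hgsb) (sub_pos.2 hsb)
  have hm : ∀ x y, b ≤ x → x < y → m ≤ (g y - g x) / (y - x) := by
    intro x y hx hxy
    have hy : a ≤ y := hab.trans (hx.trans hxy.le)
    have key : ∀ x y, a ≤ x → s < x → x < y → (g x - g s) / (x - s) ≤ (g y - g x) / (y - x) :=
      fun x y hx hsx hxy => hconv.slope_mono_adjacent has (mem_Ici.2 (hx.trans hxy.le)) hsx hxy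
    rcases hx.eq_or_lt with rfl | hbx
    · exact key b y hab hsb hxy
    · have h1 := hconv.slope_mono_adjacent has (mem_Ici.2 (hab.trans hx)) hsb hbx
      have h2 := hconv.slope_mono_adjacent (mem_Ici.2 hab) (mem_Ici.2 hy) hbx hxy
      exact h1.trans h2
  have hgb := hpos b hab
  -- The zero of the extending line; translating it to the origin gives `f 0 = 0`.
  set t₀ := b - g b / m with ht₀
  have ht₀b : t₀ < b := by
    have := div_pos hgb hm0
    linarith
  set f : ℝ → ℝ := fun t => lineExtension g b m (t + t₀) with hf
  have hfg : ∀ t, b ≤ t → f (t - t₀) = g t := fun t ht => by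
    simp only [hf, sub_add_cancel]
    exact lineExtension_of_le ht
  have hconvf : ConvexOn ℝ univ f := by
    have := (convexOn_lineExtension (hconv.subset (Ici_subset_Ici.2 hab) (convex_Ici b))
      hm).translate_left t₀
    simpa using! this
  have hmonof : StrictMono f := fun x y hxy =>
    strictMono_lineExtension hm0 hm (by linarith)
  have hf0 : f 0 = 0 := by
    simp only [hf, zero_add]
    rw [lineExtension_of_lt ht₀b, ht₀]
    field_simp
    ring
  refine ⟨f, t₀, b, ⟨hconvf, hf0, hmonof, ?_⟩, ht₀b, hfg⟩
  have hfc : Continuous f := by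
    rw [← continuousOn_univ]
    exact hconvf.continuousOn isOpen_univ
  set β := b - t₀ with hβ
  have hβ0 : 0 < β := sub_pos.2 ht₀b
  set K := ∫ s in a..b, g s with hK
  set P := ∫ s in (0:ℝ)..β, f s with hP
  have hFG : ∀ t, β ≤ t → ∫ s in (0:ℝ)..t, f s = P + ((∫ s in a..(t + t₀), g s) - K) := by
    intro t ht
    rw [hP, ← intervalIntegral.integral_add_adjacent_intervals (b := β)
      (hfc.intervalIntegrable _ _) (hfc.intervalIntegrable _ _), hK,
      intervalIntegral.integral_interval_sub_left (hg.intervalIntegrable _ _)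
      (hg.intervalIntegrable _ _)]
    congr 1
    have h1 : ∫ s in β..t, f s = ∫ s in β..t, g (s + t₀) := by
      refine intervalIntegral.integral_congr fun s hs => ?_
      rw [uIcc_of_le ht] at hs
      rw [← hfg (s + t₀) (by linarith [hs.1])]
      simp
    rw [h1, intervalIntegral.integral_comp_add_right]
    simp [hβ]
  have hGlow : ∀ t, b ≤ t → g b * (t - b) + K ≤ ∫ s in a..t, g s := by
    intro t ht
    rw [← sub_nonneg, add_comm, ← sub_sub, hK, intervalIntegral.integral_interval_sub_left
      (hg.intervalIntegrable _ _) (hg.intervalIntegrable _ _), sub_nonneg]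
    have : ∫ _ in b..t, g b ≤ ∫ s in b..t, g s := by
      refine intervalIntegral.integral_mono_on ht (by simp) (hg.intervalIntegrable _ _)
        fun s hs => ?_
      have := (strictMono_lineExtension hm0 hm).monotone hs.1
      rwa [lineExtension_of_le le_rfl, lineExtension_of_le hs.1] at this
    rw [intervalIntegral.integral_const, smul_eq_mul] at this
    linarith
  -- The primitives of `f` and of the translated `g` differ by the constant `P - K`. Beyond `T` the
  -- second is at least `2(K - P)`, so it is at most twice the first; this transfers Keller-Osserman
  -- to `f`.
  obtain ⟨T, hT⟩ : ∃ T, ∀ t, T ≤ t → 2 * (K - P) ≤ g b * (t + t₀ - b) + K ∧ β ≤ t ∧ 0 < t ∧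
      a ≤ t + t₀ := by
    refine ⟨max (|K| / g b + 2 * |P| / g b + b - t₀) (max β (a - t₀)), fun t ht => ?_⟩
    have h1 := (le_max_left _ _).trans ht
    have h2 := (le_max_left _ _).trans ((le_max_right _ _).trans ht)
    have h3 := (le_max_right _ _).trans ((le_max_right _ _).trans ht)
    refine ⟨?_, h2, hβ0.trans_le h2, by linarith⟩
    have h4 : |K| / g b + 2 * |P| / g b ≤ t + t₀ - b := by linarith
    have h5 := mul_le_mul_of_nonneg_left h4 hgb.le
    have h6 : g b * (|K| / g b + 2 * |P| / g b) = |K| + 2 * |P| := by field_simp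
    linarith [le_abs_self K, neg_abs_le P]
  set c := max T 1 with hc
  have hc0 : 0 < c := by positivity
  refine ⟨c, hc0, ?_⟩
  have hshift : IntegrableOn (fun t : ℝ => 1 / √(∫ s in a..(t + t₀), g s)) (Ioi c) := by
    have h1 : IntegrableOn (fun t : ℝ => 1 / √(∫ s in a..(t + t₀), g s)) (Ioi (a - t₀)) := by
      have := (measurePreserving_add_right volume t₀).integrableOn_comp_preimage
        (measurableEmbedding_addRight t₀) (f := fun t : ℝ => 1 / √(∫ s in a..t, g s))
        (s := Ioi a)
      simpa [Function.comp_def] using this.2 hi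
    refine h1.mono_set (Ioi_subset_Ioi ?_)
    have := (hT c (le_max_left _ _)).2.2.2
    linarith
  have hFpos : ∀ t, 0 < t → 0 < ∫ s in (0:ℝ)..t, f s := fun t ht =>
    intervalIntegral.intervalIntegral_pos_of_pos_on (hfc.intervalIntegrable _ _)
      (fun s hs => by simpa [hf0] using hmonof hs.1) ht
  refine Integrable.mono' (hshift.const_mul (√2)) ?_ ?_
  · refine ContinuousOn.aestronglyMeasurable (fun t ht => ?_) measurableSet_Ioi
    have hFc : Continuous fun t => ∫ s in (0:ℝ)..t, f s :=
      intervalIntegral.continuous_primitive (fun _ _ => hfc.intervalIntegrable _ _) 0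
    exact (continuousAt_const.div hFc.continuousAt.sqrt
      (Real.sqrt_pos.2 (hFpos t (hc0.trans ht))).ne').continuousWithinAt
  · filter_upwards [ae_restrict_mem measurableSet_Ioi] with t ht
    obtain ⟨h1, h2, h3, h4⟩ := hT t ((le_max_left _ _).trans (le_of_lt ht))
    have h5 := hGlow (t + t₀) (by linarith)
    have h6 := hFG t h2
    have h7 := hFpos t h3
    have h8 : (∫ s in a..(t + t₀), g s) ≤ 2 * ∫ s in (0:ℝ)..t, f s := by linarith
    have h9 : 0 < ∫ s in a..(t + t₀), g s := by
      by_cases h : t + t₀ = a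
      · have hab' : a = b := le_antisymm hab (by linarith)
        linarith
      · exact intervalIntegral.intervalIntegral_pos_of_pos_on (hg.intervalIntegrable _ _)
          (fun s hs => hpos s hs.1.le) (lt_of_le_of_ne h4 (Ne.symm h))
    rw [Real.norm_of_nonneg (by positivity), mul_one_div, div_le_div_iff₀
      (Real.sqrt_pos.2 h7) (Real.sqrt_pos.2 h9), one_mul, ← Real.sqrt_mul (by norm_num)]
    exact Real.sqrt_le_sqrt h8

/-! ### Spherical shells and the minimum principle. -/

theorem eventually_towardsSphere {N : ℕ} {R : ℝ} {p : EuclideanSpace ℝ (Fin N) → Prop} :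
    (∀ᶠ x in towardsSphere N R, p x) ↔ ∃ ρ < R, ∀ x, ρ < ‖x‖ → ‖x‖ < R → p x := by
  rw [towardsSphere, eventually_comap]
  constructor
  · intro h
    obtain ⟨ρ, hρ, hs⟩ := mem_nhdsLT_iff_exists_Ioo_subset.1 h
    exact ⟨ρ, hρ, fun x h1 h2 => hs ⟨h1, h2⟩ x rfl⟩
  · rintro ⟨ρ, hρ, h⟩
    filter_upwards [Ioo_mem_nhdsLT hρ] with t ht x hx
    exact h x (hx ▸ ht.1) (hx ▸ ht.2)

theorem tendsto_norm_towardsSphere (N : ℕ) (R : ℝ) :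
    Tendsto (fun x : EuclideanSpace ℝ (Fin N) => ‖x‖) (towardsSphere N R) (𝓝 R) :=
  tendsto_comap.mono_right nhdsWithin_le_nhds

theorem eventually_mem_shell {N : ℕ} {ρ R : ℝ} (h : ρ < R) :
    ∀ᶠ x in towardsSphere N R, ρ ≤ ‖x‖ ∧ ‖x‖ < R :=
  eventually_towardsSphere.2 ⟨ρ, h, fun _ h1 h2 => ⟨h1.le, h2⟩⟩

theorem isCompact_shell (N : ℕ) (s t : ℝ) :
    IsCompact {x : EuclideanSpace ℝ (Fin N) | s ≤ ‖x‖ ∧ ‖x‖ ≤ t} := by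
  refine (isCompact_closedBall (0 : EuclideanSpace ℝ (Fin N)) t).of_isClosed_subset ?_ ?_
  · exact (isClosed_le continuous_const continuous_norm).inter
      (isClosed_le continuous_norm continuous_const)
  · intro x hx
    simpa using hx.2

theorem isOpen_shell (N : ℕ) (s t : ℝ) :
    IsOpen {x : EuclideanSpace ℝ (Fin N) | s < ‖x‖ ∧ ‖x‖ < t} :=
  (isOpen_lt continuous_const continuous_norm).inter (isOpen_lt continuous_norm continuous_const)

/-- Minimum principle in a shell, in its elementary form: a continuous function which has no
negative interior local minimum is nonnegative if it is so on the boundary. -/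
theorem nonneg_on_shell {N : ℕ} {ρ R : ℝ} {h : EuclideanSpace ℝ (Fin N) → ℝ}
    (hc : ContinuousOn h {x | ρ ≤ ‖x‖ ∧ ‖x‖ < R})
    (hin : ∀ x, ‖x‖ = ρ → 0 ≤ h x)
    (hout : ∀ ε > 0, ∀ᶠ x in towardsSphere N R, -ε ≤ h x)
    (hmin : ∀ x, ρ < ‖x‖ → ‖x‖ < R → h x < 0 → ¬ IsLocalMin h x) :
    ∀ x, ρ ≤ ‖x‖ → ‖x‖ < R → 0 ≤ h x := by
  intro x₀ hx₀ hx₀R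
  by_contra! hneg
  -- Beyond `ρ'` the function is at least `h x₀ / 2 > h x₀`. A minimiser on the compact shell up to
  -- `R'` is therefore a local minimum even if it lies on `|x| = R'`.
  obtain ⟨ρ', hρ', hh⟩ := eventually_towardsSphere.1 (hout (-h x₀ / 2) (by linarith))
  set R' := max ρ' ‖x₀‖ with hR'
  have hR'R : R' < R := max_lt hρ' hx₀R
  obtain ⟨y, hy, hymin⟩ := (isCompact_shell N ρ R').exists_isMinOn
    ⟨x₀, hx₀, le_max_right _ _⟩ (hc.mono fun x hx => ⟨hx.1, hx.2.trans_lt hR'R⟩)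
  have hyx : h y ≤ h x₀ := hymin ⟨hx₀, le_max_right _ _⟩
  have hylt : ρ < ‖y‖ := by
    refine lt_of_le_of_ne hy.1 fun h' => ?_
    linarith [hin y h'.symm]
  have hyR : ‖y‖ < R := hy.2.trans_lt hR'R
  refine hmin y hylt hyR (hyx.trans_lt hneg) ?_
  filter_upwards [(isOpen_shell N ρ R).mem_nhds ⟨hylt, hyR⟩] with x hx
  rcases le_or_gt ‖x‖ R' with hxR' | hxR'
  · exact hymin ⟨hx.1.le, hxR'⟩
  · have := hh x ((le_max_left _ _).trans_lt hxR') hx.2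
    linarith

/-! ### Comparison of large solutions in a shell. -/

/-- A positive solution of `Δu = f(u)` in the shell `ρ ≤ |x| < R` which blows up at `|x| = R`. -/
structure IsShellLargeSolution {N : ℕ} (f : ℝ → ℝ) (ρ R : ℝ) (u : EuclideanSpace ℝ (Fin N) → ℝ) :
    Prop where
  contDiffAt : ∀ x, ρ ≤ ‖x‖ → ‖x‖ < R → ContDiffAt ℝ 2 u x
  laplacian_eq : ∀ x, ρ ≤ ‖x‖ → ‖x‖ < R → Laplacian.laplacian u x = f (u x)
  pos : ∀ x, ρ ≤ ‖x‖ → ‖x‖ < R → 0 < u x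
  blowUp : Tendsto u (towardsSphere N R) atTop

namespace IsShellLargeSolution

variable {N : ℕ} {f : ℝ → ℝ} {ρ R : ℝ} {u v v₁ v₂ : EuclideanSpace ℝ (Fin N) → ℝ}

theorem continuousOn (hu : IsShellLargeSolution f ρ R u) :
    ContinuousOn u {x | ρ ≤ ‖x‖ ∧ ‖x‖ < R} :=
  fun x hx => (hu.contDiffAt x hx.1 hx.2).continuousAt.continuousWithinAt

theorem mono {ρ' : ℝ} (hu : IsShellLargeSolution f ρ R u) (h : ρ ≤ ρ') :
    IsShellLargeSolution f ρ' R u :=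
  ⟨fun x hx => hu.contDiffAt x (h.trans hx), fun x hx => hu.laplacian_eq x (h.trans hx),
    fun x hx => hu.pos x (h.trans hx), hu.blowUp⟩

theorem exists_le_on_sphere {w : EuclideanSpace ℝ (Fin N) → ℝ} (hρR : ρ < R)
    (hw : ContinuousOn w {x | ρ ≤ ‖x‖ ∧ ‖x‖ < R}) :
    ∃ M, 0 ≤ M ∧ ∀ x, ‖x‖ = ρ → w x ≤ M := by
  obtain ⟨M, hM⟩ := (isCompact_shell N ρ ρ).bddAbove_image
    (hw.mono fun x hx => ⟨hx.1, hx.2.trans_lt hρR⟩)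
  exact ⟨max M 0, le_max_right _ _, fun x hx =>
    (hM ⟨x, ⟨hx.ge, hx.le⟩, rfl⟩).trans (le_max_left _ _)⟩

/-- A lower bound for large solutions in inverse form. -/
theorem exists_inverse_le (hu : IsShellLargeSolution f ρ R u) (hf : StrictMono f) (hN : 2 ≤ N)
    (hρ : 0 < ρ) (hρR : ρ < R) {A : ℝ → ℝ}
    (hA : ∀ t, 0 < t → ContDiffAt ℝ 2 A t ∧ deriv A t < 0 ∧
        deriv (deriv A) t / deriv A t ^ 2 + deriv A t * f t = 0)
    (hlim : Tendsto A atTop (𝓝 0)) (hanti : AntitoneOn A (Ioi 0)) :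
    ∃ C, 0 < C ∧ ∀ x, ρ ≤ ‖x‖ → ‖x‖ < R → A (u x + C) ≤ R - ‖x‖ := by
  obtain ⟨C, hC0, hC⟩ : ∃ C, 0 < C ∧ A C ≤ R - ρ :=
    ((eventually_gt_atTop 0).and
      (hlim.eventually (eventually_le_nhds (sub_pos.2 hρR)))).exists
  refine ⟨C, hC0, fun x hx hxR => ?_⟩
  have key := nonneg_on_shell (h := fun x => -(A (u x + C) + ‖x‖) + R) (ρ := ρ) (R := R) ?_ ?_ ?_ ?_
    x hx hxR
  · linarith
  · refine ContinuousOn.add (ContinuousOn.neg (ContinuousOn.add (fun x hx => ?_)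
      continuous_norm.continuousOn)) continuousOn_const
    have h1 := (hA (u x + C) (by linarith [hu.pos x hx.1 hx.2])).1.continuousAt
    exact (ContinuousAt.comp (f := fun x => u x + C) h1
      ((hu.contDiffAt x hx.1 hx.2).continuousAt.add continuousAt_const)).continuousWithinAt
  · intro y hy
    have h1 := hu.pos y hy.ge (hy ▸ hρR)
    have := hanti (mem_Ioi.2 hC0) (mem_Ioi.2 (by linarith : 0 < u y + C)) (by linarith)
    rw [hy]; linarith
  · intro ε hε
    have h1 : Tendsto (fun x => A (u x + C)) (towardsSphere N R) (𝓝 0) :=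
      hlim.comp (tendsto_atTop_add_const_right _ C hu.blowUp)
    filter_upwards [h1.eventually (eventually_le_nhds hε), eventually_mem_shell hρR] with y hy hy2
    linarith
  · intro y hy hyR _ hmin
    have hu2 := (hu.contDiffAt y hy.le hyR).add (contDiffAt_const (c := C))
    have hy0 : y ≠ 0 := norm_pos_iff.1 (hρ.trans hy)
    have hupos := hu.pos y hy.le hyR
    obtain ⟨hA1, hA2, hA3⟩ := hA (u y + C) (by linarith)
    have hmax : IsLocalMax (fun x => A (u x + C) + ‖x‖) y := by
      filter_upwards [hmin] with z hz
      linarith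
    have hlap : Laplacian.laplacian (fun x => u x + C) y = f (u y) := by
      have := (hu.contDiffAt y hy.le hyR).laplacian_add (contDiffAt_const (c := C))
      rw [← hu.laplacian_eq y hy.le hyR]
      refine this.trans ?_
      rw [InnerProductSpace.laplacian_const]
      simp
    obtain ⟨-, h2⟩ := laplacian_comp_add_norm_of_fderiv_eq_zero hu2 hA1 hy0 hmax.fderiv_eq_zero
    have h3 := laplacian_nonpos_of_isLocalMax
      ((hA1.comp y hu2).add (contDiffAt_norm ℝ hy0)) hmax
    have h4 : Laplacian.laplacian (fun x => A (u x + C) + ‖x‖) y ≤ 0 := h3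
    rw [h2, hlap, finrank_euclideanSpace_fin] at h4
    -- As `A' < 0`, replacing `f (u + C)` by `f (u)` increases the profile equation's left side.
    -- With the positive curvature term the Laplacian is positive, which is impossible at a local
    -- maximum.
    have h5 : f (u y) < f (u y + C) := hf (by linarith)
    have h6 : 0 < ((N : ℝ) - 1) / ‖y‖ := by
      have : (2 : ℝ) ≤ N := by exact_mod_cast hN
      exact div_pos (by linarith) (norm_pos_iff.2 hy0)
    nlinarith

/-- An upper bound for large solutions in inverse form. -/
theorem exists_le_inverse (hu : IsShellLargeSolution f ρ R u) (hf : StrictMono f) (hN : 2 ≤ N)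
    (hρ : 0 < ρ) (hρR : ρ < R) {B : ℝ → ℝ} {m : ℝ} (hm : 0 < m)
    (hB : ∀ t, 0 < t → ContDiffAt ℝ 2 B t ∧ deriv B t < 0)
    (hB' : ∀ t, m ≤ t →
      deriv (deriv B) t / deriv B t ^ 2 + deriv B t * f t + (N - 1) / ρ < 0)
    (hpos : ∀ t, 0 < t → 0 < B t) :
    ∃ M, 0 ≤ M ∧ ∀ᶠ x in towardsSphere N R, R - ‖x‖ ≤ B (u x - M) := by
  -- The barrier inequality for `B` holds only from `m` on, so `u - M` is truncated at `m`. With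
  -- this `ρ'` the compared function is nonnegative wherever the truncation acts, so a negative
  -- minimum lies where `u - M > m`.
  set ρ' := max ρ (R - B m) with hρ'
  have hρ'R : ρ' < R := max_lt hρR (by linarith [hpos m hm])
  have hρρ' : ρ ≤ ρ' := le_max_left _ _
  have hBm : R - ρ' ≤ B m := by linarith [le_max_right ρ (R - B m)]
  have hu' := hu.mono hρρ'
  obtain ⟨M, hM0, hM⟩ := exists_le_on_sphere hρ'R hu'.continuousOn
  refine ⟨M, hM0, ?_⟩
  have hmaxpos : ∀ x, 0 < max (u x - M) m := fun x => hm.trans_le (le_max_right _ _)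
  have key := nonneg_on_shell (h := fun x => B (max (u x - M) m) + ‖x‖ - R) (ρ := ρ') (R := R)
    ?_ ?_ ?_ ?_
  · filter_upwards [eventually_mem_shell hρ'R, hu.blowUp.eventually_ge_atTop (M + m)] with x hx hxu
    have := key x hx.1 hx.2
    rw [max_eq_left (by linarith)] at this
    linarith
  · refine ((ContinuousOn.add (fun x hx => ?_) continuous_norm.continuousOn)).sub
      continuousOn_const
    have h1 := (hB _ (hmaxpos x)).1.continuousAt
    exact (ContinuousAt.comp (f := fun x => max (u x - M) m) h1
      (((hu'.contDiffAt x hx.1 hx.2).continuousAt.sub continuousAt_const).max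
        continuousAt_const)).continuousWithinAt
  · intro y hy
    rw [max_eq_right (by linarith [hM y hy]), hy]
    linarith
  · intro ε hε
    filter_upwards [(tendsto_norm_towardsSphere N R).eventually
      (eventually_ge_nhds (by linarith : R - ε < R))] with y hy
    linarith [hpos _ (hmaxpos y)]
  · intro y hy hyR hneg hmin
    have hyρ : ρ ≤ ‖y‖ := hρρ'.trans hy.le
    have hum : m < u y - M := by
      by_contra! hle
      rw [max_eq_right hle] at hneg
      linarith
    have hu2 := (hu.contDiffAt y hyρ hyR).sub (contDiffAt_const (c := M))
    have hy0 : y ≠ 0 := norm_pos_iff.1 (hρ.trans_le hyρ)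
    obtain ⟨hB1, hB2⟩ := hB (u y - M) (by linarith)
    have hB3 := hB' (u y - M) hum.le
    have hmin' : IsLocalMin (fun x => B (u x - M) + ‖x‖) y := by
      have hev : ∀ᶠ z in 𝓝 y, m < u z - M :=
        hu2.continuousAt.eventually (lt_mem_nhds hum)
      filter_upwards [hmin, hev] with z hz hz2
      rw [max_eq_left hum.le, max_eq_left hz2.le] at hz
      linarith
    have hlap : Laplacian.laplacian (fun x => u x - M) y = f (u y) := by
      have := (hu.contDiffAt y hyρ hyR).laplacian_sub (contDiffAt_const (c := M))
      rw [← hu.laplacian_eq y hyρ hyR]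
      refine this.trans ?_
      rw [InnerProductSpace.laplacian_const]
      simp
    obtain ⟨-, h2⟩ := laplacian_comp_add_norm_of_fderiv_eq_zero hu2 hB1 hy0 hmin'.fderiv_eq_zero
    have h3 := laplacian_nonneg_of_isLocalMin
      ((hB1.comp y hu2).add (contDiffAt_norm ℝ hy0)) hmin'
    have h4 : 0 ≤ Laplacian.laplacian (fun x => B (u x - M) + ‖x‖) y := h3
    rw [h2, hlap, finrank_euclideanSpace_fin] at h4
    have h5 : f (u y - M) ≤ f (u y) := hf.monotone (by linarith)
    have h6 : ((N : ℝ) - 1) / ‖y‖ ≤ (N - 1) / ρ := by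
      have : (2 : ℝ) ≤ N := by exact_mod_cast hN
      exact div_le_div_of_nonneg_left (by linarith) hρ hyρ
    nlinarith

/-- Any two large solutions have the same first-order behaviour. -/
theorem eventually_le_mul (hu : IsShellLargeSolution f ρ R u) (hv : IsShellLargeSolution f ρ R v)
    (hf : IsConvexAbsorption f) (hN : 2 ≤ N) (hρ : 0 < ρ) (hρR : ρ < R) {ε : ℝ} (hε : 0 < ε) :
    ∀ᶠ x in towardsSphere N R, v x ≤ (1 + ε) * u x := by
  have hκ : 0 ≤ ((N : ℝ) - 1) / ρ := by
    have : (2 : ℝ) ≤ N := by exact_mod_cast hN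
    exact div_nonneg (by linarith) hρ.le
  obtain ⟨A, B, m, c, hm, hc, hA, hB, hB', hAlim, hAanti, hB0, hcomp⟩ :=
    hf.exists_barriers hκ
  obtain ⟨C, hC0, hC⟩ := hu.exists_inverse_le hf.strictMono hN hρ hρR hA hAlim hAanti
  obtain ⟨M, hM0, hM⟩ := hv.exists_le_inverse hf.strictMono hN hρ hρR hm hB hB' hB0
  -- With `δ = ε / (2 + ε)` one has `1 / (1 - δ) = 1 + ε / 2`. The other half of `ε` absorbs the
  -- additive constants `C` and `M`.
  have hδ : 0 < ε / (2 + ε) := by positivity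
  have hlim : Tendsto (fun x => c * A (v x - M)) (towardsSphere N R) (𝓝 0) := by
    have := (hAlim.comp (tendsto_atTop_add_const_right _ (-M) hv.blowUp)).const_mul c
    simpa [sub_eq_add_neg] using! this
  filter_upwards [hM, eventually_mem_shell hρR, hlim.eventually (eventually_le_nhds hδ),
    hv.blowUp.eventually_gt_atTop M,
    hu.blowUp.eventually_ge_atTop (((1 + ε / 2) * C + M) / (ε / 2))] with x h1 h2 h3 h4 h5
  have hux := hu.pos x h2.1 h2.2
  have hτ : 0 < v x - M := by linarith
  have key : v x - M ≤ (1 + ε / 2) * (u x + C) := by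
    rcases le_or_gt (v x - M) (u x + C) with h6 | h6
    · nlinarith
    · have h7 := hcomp (u x + C) (v x - M) (by linarith) h6.le ((hC x h2.1 h2.2).trans h1)
      have h8 : c * (v x - M) * A (v x - M) ≤ ε / (2 + ε) * (v x - M) := by
        rw [mul_right_comm]
        exact mul_le_mul_of_nonneg_right h3 hτ.le
      have h9 : (v x - M) * (2 / (2 + ε)) ≤ u x + C := by
        have : (v x - M) * (2 / (2 + ε)) = (v x - M) - ε / (2 + ε) * (v x - M) := by
          field_simp; ring
        linarith
      have h10 := mul_le_mul_of_nonneg_left h9 (by positivity : 0 ≤ 1 + ε / 2)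
      have h11 : (1 + ε / 2) * ((v x - M) * (2 / (2 + ε))) = v x - M := by field_simp
      linarith
  rw [div_le_iff₀ (by positivity)] at h5
  linarith

/-- The quadratic function equal to `1` on `|x| = ρ` and to `0` on `|x| = R`. -/
noncomputable def quadraticCutoff (ρ R : ℝ) (x : EuclideanSpace ℝ (Fin N)) : ℝ :=
  (R ^ 2 - ‖x‖ ^ 2) / (R ^ 2 - ρ ^ 2)

theorem contDiff_quadraticCutoff (ρ R : ℝ) :
    ContDiff ℝ 2 (quadraticCutoff (N := N) ρ R) :=
  (contDiff_const.sub (contDiff_norm_sq ℝ)).div_const _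

/-- The comparison arguments need only superharmonicity of nonnegative multiples of the cutoff, so
no harmonic function of the shell has to be used. -/
theorem laplacian_quadraticCutoff (ρ R : ℝ) (x : EuclideanSpace ℝ (Fin N)) :
    Laplacian.laplacian (quadraticCutoff (N := N) ρ R) x = -(2 * N / (R ^ 2 - ρ ^ 2)) := by
  have h1 : quadraticCutoff (N := N) ρ R = (fun _ => R ^ 2 / (R ^ 2 - ρ ^ 2)) -
      ((R ^ 2 - ρ ^ 2)⁻¹ • fun y => ‖y - 0‖ ^ 2) := by
    funext y
    simp [quadraticCutoff, div_eq_inv_mul, mul_sub]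
  have h2 := contDiffAt_sub_norm_sq (0 : EuclideanSpace ℝ (Fin N)) x
  have h3 : ContDiffAt ℝ 2 ((R ^ 2 - ρ ^ 2)⁻¹ • fun y : EuclideanSpace ℝ (Fin N) => ‖y - 0‖ ^ 2) x :=
    h2.const_smul (R ^ 2 - ρ ^ 2)⁻¹
  rw [h1, contDiffAt_const.laplacian_sub h3, InnerProductSpace.laplacian_const,
    InnerProductSpace.laplacian_smul _ h2, laplacian_sub_norm_sq, finrank_euclideanSpace_fin]
  simp
  ring

theorem quadraticCutoff_nonneg (hρ : 0 < ρ) (hρR : ρ < R) {x : EuclideanSpace ℝ (Fin N)}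
    (hx : ‖x‖ < R) : 0 ≤ quadraticCutoff ρ R x :=
  div_nonneg (by nlinarith [norm_nonneg x]) (by nlinarith)

theorem quadraticCutoff_eq_one (hρ : 0 < ρ) (hρR : ρ < R) {x : EuclideanSpace ℝ (Fin N)}
    (hx : ‖x‖ = ρ) : quadraticCutoff ρ R x = 1 := by
  rw [quadraticCutoff, hx]
  exact div_self (by nlinarith)

theorem quadraticCutoff_le_one (hρ : 0 < ρ) (hρR : ρ < R) {x : EuclideanSpace ℝ (Fin N)}
    (hx : ρ ≤ ‖x‖) : quadraticCutoff ρ R x ≤ 1 := by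
  rw [quadraticCutoff, div_le_one (by nlinarith)]
  nlinarith

theorem tendsto_quadraticCutoff :
    Tendsto (quadraticCutoff (N := N) ρ R) (towardsSphere N R) (𝓝 0) := by
  have := (((tendsto_norm_towardsSphere N R).pow 2).const_sub (R ^ 2)).div_const (R ^ 2 - ρ ^ 2)
  simpa [quadraticCutoff] using! this

/-- Two large solutions differ by at most a multiple of the distance to the outer sphere,
controlled by their difference on the inner sphere. -/
theorem sub_le_quadraticCutoff (hu : IsShellLargeSolution f ρ R u)
    (hv : IsShellLargeSolution f ρ R v) (hf : IsConvexAbsorption f) (hN : 2 ≤ N) (hρ : 0 < ρ)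
    (hρR : ρ < R) {M : ℝ} (hM0 : 0 ≤ M) (hM : ∀ x, ‖x‖ = ρ → v x - u x ≤ M)
    {x : EuclideanSpace ℝ (Fin N)} (hx : ρ ≤ ‖x‖) (hxR : ‖x‖ < R) :
    v x - u x ≤ M * quadraticCutoff ρ R x := by
  -- For finite `κ` the outer boundary condition needs only `v ≤ (1 + 1/κ) u`, which holds near the
  -- sphere even though `v - u` is not yet known to be bounded.
  have hκ : ∀ κ : ℝ, 0 < κ → 0 ≤ (1 + κ) * u x - κ * v x + κ * M * quadraticCutoff ρ R x := by
    intro κ hκ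
    refine nonneg_on_shell (h := fun x => (1 + κ) * u x - κ * v x + κ * M * quadraticCutoff ρ R x)
      ?_ ?_ ?_ ?_ x hx hxR
    · exact ((continuousOn_const.mul hu.continuousOn).sub
        (continuousOn_const.mul hv.continuousOn)).add
        (continuousOn_const.mul (contDiff_quadraticCutoff ρ R).continuous.continuousOn)
    · intro y hy
      have h1 := hu.pos y hy.ge (hy ▸ hρR)
      have h2 := mul_le_mul_of_nonneg_left (hM y hy) hκ.le
      rw [quadraticCutoff_eq_one hρ hρR hy]
      linarith
    · intro ε hε
      filter_upwards [hu.eventually_le_mul hv hf hN hρ hρR (one_div_pos.2 hκ),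
        eventually_mem_shell hρR] with y h1 h2
      have h3 := mul_nonneg (mul_nonneg hκ.le hM0) (quadraticCutoff_nonneg hρ hρR h2.2)
      have h4 := mul_le_mul_of_nonneg_left h1 hκ.le
      have h5 : κ * ((1 + 1 / κ) * u y) = (1 + κ) * u y := by field_simp; ring
      linarith
    · intro y hy hyR hneg hmin
      have hu2 := hu.contDiffAt y hy.le hyR
      have hv2 := hv.contDiffAt y hy.le hyR
      have hq2 := (contDiff_quadraticCutoff (N := N) ρ R).contDiffAt (x := y)
      have h1 := laplacian_nonneg_of_isLocalMin (((contDiffAt_const.mul hu2).sub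
        (contDiffAt_const.mul hv2)).add (contDiffAt_const.mul hq2)) hmin
      have h2 : (Laplacian.laplacian ((((1 + κ) • u) - (κ • v)) +
          ((κ * M) • quadraticCutoff ρ R)) : EuclideanSpace ℝ (Fin N) → ℝ) y =
          (1 + κ) * f (u y) - κ * f (v y) + κ * M * -(2 * N / (R ^ 2 - ρ ^ 2)) := by
        have hu3 : ContDiffAt ℝ 2 ((1 + κ) • u) y := hu2.const_smul (1 + κ)
        have hv3 : ContDiffAt ℝ 2 (κ • v) y := hv2.const_smul κ
        have hq3 : ContDiffAt ℝ 2 ((κ * M) • quadraticCutoff ρ R) y := hq2.const_smul (κ * M)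
        have huv : ContDiffAt ℝ 2 ((1 + κ) • u - κ • v) y := hu3.sub hv3
        rw [huv.laplacian_add hq3, hu3.laplacian_sub hv3,
          InnerProductSpace.laplacian_smul _ hu2, InnerProductSpace.laplacian_smul _ hv2,
          InnerProductSpace.laplacian_smul _ hq2, hu.laplacian_eq y hy.le hyR,
          hv.laplacian_eq y hy.le hyR, laplacian_quadraticCutoff]
        simp
      have h3 : 0 ≤ (1 + κ) * f (u y) - κ * f (v y) + κ * M * -(2 * N / (R ^ 2 - ρ ^ 2)) :=
        h2 ▸ h1
      have h4 : 0 ≤ κ * M * (2 * N / (R ^ 2 - ρ ^ 2)) := by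
        have : 0 < R ^ 2 - ρ ^ 2 := by nlinarith
        positivity
      -- As `u` is the convex combination of `z` and `v` with weights `1/(1+κ)` and `κ/(1+κ)`,
      -- convexity gives `(1+κ) f(u) - κ f(v) ≤ f(z)`, and `f(z) < 0` because `z < 0`.
      set z := (1 + κ) * u y - κ * v y with hz
      have hz0 : z < 0 := by
        have := mul_nonneg (mul_nonneg hκ.le hM0) (quadraticCutoff_nonneg hρ hρR hyR)
        linarith
      have hfz : f z < 0 := by simpa [hf.map_zero] using hf.strictMono hz0
      have hconv := hf.convexOn.2 (mem_univ z) (mem_univ (v y))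
        (show 0 ≤ 1 / (1 + κ) by positivity) (show 0 ≤ κ / (1 + κ) by positivity)
        (by field_simp)
      have h5 : (1 / (1 + κ)) • z + (κ / (1 + κ)) • v y = u y := by
        simp only [smul_eq_mul, hz]; field_simp; ring
      rw [h5] at hconv
      have h6 := mul_le_mul_of_nonneg_left hconv (by positivity : 0 ≤ 1 + κ)
      have h7 : (1 + κ) * ((1 / (1 + κ)) • f z + (κ / (1 + κ)) • f (v y)) =
          f z + κ * f (v y) := by
        simp only [smul_eq_mul]; field_simp
      linarith
  have hlim : Tendsto (fun κ : ℝ => u x / κ + M * quadraticCutoff ρ R x) atTop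
      (𝓝 (M * quadraticCutoff ρ R x)) := by
    simpa using (tendsto_const_nhds.div_atTop tendsto_id).add_const (M * quadraticCutoff ρ R x)
  refine ge_of_tendsto hlim ?_
  filter_upwards [eventually_gt_atTop 0] with κ hκ0
  have h1 := hκ κ hκ0
  have h2 : u x / κ + M * quadraticCutoff ρ R x - (v x - u x) =
      ((1 + κ) * u x - κ * v x + κ * M * quadraticCutoff ρ R x) / κ := by
    field_simp; ring
  have := div_nonneg h1 hκ0.le
  linarith

/-- Second-order version of `sub_le_quadraticCutoff`. -/
theorem add_sub_le_quadraticCutoff (hu : IsShellLargeSolution f ρ R u)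
    (hv₁ : IsShellLargeSolution f ρ R v₁) (hv₂ : IsShellLargeSolution f ρ R v₂)
    (hf : IsConvexAbsorption f) (hN : 2 ≤ N) (hρ : 0 < ρ)
    (hρR : ρ < R) {M : ℝ} (hM0 : 0 ≤ M) (hM : ∀ x, ‖x‖ = ρ → v₁ x + v₂ x - 2 * u x ≤ M)
    {x : EuclideanSpace ℝ (Fin N)} (hx : ρ ≤ ‖x‖) (hxR : ‖x‖ < R) :
    v₁ x + v₂ x - 2 * u x ≤ M * quadraticCutoff ρ R x := by
  -- The first-order estimate, with any bounds on the inner sphere, makes `v₁ - u` and `v₂ - u` at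
  -- most small near the outer sphere; this is the outer boundary condition.
  obtain ⟨M₁, hM₁0, hM₁⟩ := exists_le_on_sphere hρR (hv₁.continuousOn.sub hu.continuousOn)
  obtain ⟨M₂, hM₂0, hM₂⟩ := exists_le_on_sphere hρR (hv₂.continuousOn.sub hu.continuousOn)
  have key := nonneg_on_shell (ρ := ρ) (R := R)
    (h := fun x => M * quadraticCutoff ρ R x - v₁ x - v₂ x + 2 * u x) ?_ ?_ ?_ ?_ x hx hxR
  · linarith
  · exact (((continuousOn_const.mul (contDiff_quadraticCutoff ρ R).continuous.continuousOn).sub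
      hv₁.continuousOn).sub hv₂.continuousOn).add (continuousOn_const.mul hu.continuousOn)
  · intro y hy
    rw [quadraticCutoff_eq_one hρ hρR hy]
    linarith [hM y hy]
  · intro ε hε
    have h0 : Tendsto (fun x => (M₁ + M₂) * quadraticCutoff (N := N) ρ R x) (towardsSphere N R)
        (𝓝 0) := by
      simpa using (tendsto_quadraticCutoff (N := N) (ρ := ρ) (R := R)).const_mul (M₁ + M₂)
    filter_upwards [h0.eventually (eventually_le_nhds hε), eventually_mem_shell hρR] with y h1 h2
    have h3 := hu.sub_le_quadraticCutoff hv₁ hf hN hρ hρR hM₁0 hM₁ h2.1 h2.2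
    have h4 := hu.sub_le_quadraticCutoff hv₂ hf hN hρ hρR hM₂0 hM₂ h2.1 h2.2
    have h5 := mul_nonneg hM0 (quadraticCutoff_nonneg hρ hρR h2.2)
    linarith
  · intro y hy hyR hneg hmin
    have hu2 := hu.contDiffAt y hy.le hyR
    have hv2 := hv₁.contDiffAt y hy.le hyR
    have hw2 := hv₂.contDiffAt y hy.le hyR
    have hq2 := (contDiff_quadraticCutoff (N := N) ρ R).contDiffAt (x := y)
    have h1 := laplacian_nonneg_of_isLocalMin ((((contDiffAt_const.mul hq2).sub hv2).sub hw2).add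
      (contDiffAt_const.mul hu2)) hmin
    have h2 : (Laplacian.laplacian (((M • quadraticCutoff ρ R) - v₁ - v₂) + ((2 : ℝ) • u)) :
        EuclideanSpace ℝ (Fin N) → ℝ) y =
        M * -(2 * N / (R ^ 2 - ρ ^ 2)) - f (v₁ y) - f (v₂ y) + 2 * f (u y) := by
      have hu3 : ContDiffAt ℝ 2 ((2 : ℝ) • u) y := hu2.const_smul (2 : ℝ)
      have hq3 : ContDiffAt ℝ 2 (M • quadraticCutoff ρ R) y := hq2.const_smul M
      have hqv : ContDiffAt ℝ 2 (M • quadraticCutoff ρ R - v₁) y := hq3.sub hv2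
      have hqvw : ContDiffAt ℝ 2 (M • quadraticCutoff ρ R - v₁ - v₂) y := hqv.sub hw2
      rw [hqvw.laplacian_add hu3, hqv.laplacian_sub hw2, hq3.laplacian_sub hv2,
        InnerProductSpace.laplacian_smul _ hu2, InnerProductSpace.laplacian_smul _ hq2,
        hu.laplacian_eq y hy.le hyR, hv₁.laplacian_eq y hy.le hyR, hv₂.laplacian_eq y hy.le hyR,
        laplacian_quadraticCutoff]
      simp
    have h3 : 0 ≤ M * -(2 * N / (R ^ 2 - ρ ^ 2)) - f (v₁ y) - f (v₂ y) + 2 * f (u y) :=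
      h2 ▸ h1
    have h4 : 0 ≤ M * (2 * N / (R ^ 2 - ρ ^ 2)) := by
      have : 0 < R ^ 2 - ρ ^ 2 := by nlinarith
      positivity
    have h5 := mul_nonneg hM0 (quadraticCutoff_nonneg hρ hρR hyR)
    -- At a negative value `u` is below the mean of `v₁` and `v₂`; monotonicity and convexity give
    -- `2 f(u) < f(v₁) + f(v₂)`, so the Laplacian is negative there.
    have hmid : f (u y) < f ((1 / 2 : ℝ) • v₁ y + (1 / 2 : ℝ) • v₂ y) :=
      hf.strictMono (by simp only [smul_eq_mul]; linarith)
    have hconv := hf.convexOn.2 (mem_univ (v₁ y)) (mem_univ (v₂ y))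
      (show (0 : ℝ) ≤ 1 / 2 by norm_num) (show (0 : ℝ) ≤ 1 / 2 by norm_num) (by norm_num)
    simp only [smul_eq_mul] at hconv hmid
    linarith

end IsShellLargeSolution

/-! ### Rotations in a plane and second differences along circles. -/

section PlaneRotation

variable {E : Type*} [NormedAddCommGroup E] [InnerProductSpace ℝ E]

/-- The component of `y` in the plane spanned by the orthonormal pair `e₁, e₂`. -/
noncomputable def planePart (e₁ e₂ y : E) : E := inner ℝ e₁ y • e₁ + inner ℝ e₂ y • e₂

/-- The component of `y` in the plane spanned by `e₁, e₂`, turned by a right angle. -/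
noncomputable def planeTurn (e₁ e₂ y : E) : E := inner ℝ e₁ y • e₂ - inner ℝ e₂ y • e₁

/-- Rotation by the angle `θ` in the plane spanned by the orthonormal pair `e₁, e₂`. -/
noncomputable def planeRotationLinear (e₁ e₂ : E) (θ : ℝ) : E →ₗ[ℝ] E where
  toFun y := y + (Real.cos θ - 1) • planePart e₁ e₂ y + Real.sin θ • planeTurn e₁ e₂ y
  map_add' x y := by simp only [planePart, planeTurn, inner_add_right]; module
  map_smul' c y := by
    simp only [planePart, planeTurn, inner_smul_right, RingHom.id_apply]; module

theorem norm_planeRotationLinear {e₁ e₂ : E} (h₁ : ‖e₁‖ = 1) (h₂ : ‖e₂‖ = 1)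
    (h₁₂ : inner ℝ e₁ e₂ = 0) (θ : ℝ) (y : E) : ‖planeRotationLinear e₁ e₂ θ y‖ = ‖y‖ := by
  rw [← sq_eq_sq₀ (norm_nonneg _) (norm_nonneg _), ← real_inner_self_eq_norm_sq,
    ← real_inner_self_eq_norm_sq]
  have h₂₁ : inner ℝ e₂ e₁ = 0 := by rw [real_inner_comm]; exact h₁₂
  have h11 : inner ℝ e₁ e₁ = 1 := by rw [real_inner_self_eq_norm_sq, h₁]; norm_num
  have h22 : inner ℝ e₂ e₂ = 1 := by rw [real_inner_self_eq_norm_sq, h₂]; norm_num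
  simp only [planeRotationLinear, planePart, planeTurn, LinearMap.coe_mk, AddHom.coe_mk,
    inner_add_left, inner_add_right, inner_sub_left, inner_sub_right, inner_smul_left,
    inner_smul_right, h₁₂, h₂₁, h11, h22, real_inner_comm e₁ y, real_inner_comm e₂ y,
    RCLike.conj_to_real]
  have := Real.sin_sq_add_cos_sq θ
  linear_combination ((inner ℝ e₁ y) ^ 2 + (inner ℝ e₂ y) ^ 2) * this

variable [FiniteDimensional ℝ E]

/-- Rotation in a plane as a linear isometry. -/
noncomputable def planeRotation {e₁ e₂ : E} (h₁ : ‖e₁‖ = 1) (h₂ : ‖e₂‖ = 1)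
    (h₁₂ : inner ℝ e₁ e₂ = 0) (θ : ℝ) : E ≃ₗᵢ[ℝ] E :=
  LinearIsometry.toLinearIsometryEquiv
    ⟨planeRotationLinear e₁ e₂ θ, norm_planeRotationLinear h₁ h₂ h₁₂ θ⟩ rfl

theorem planeRotation_apply {e₁ e₂ : E} (h₁ : ‖e₁‖ = 1) (h₂ : ‖e₂‖ = 1)
    (h₁₂ : inner ℝ e₁ e₂ = 0) (θ : ℝ) (y : E) : planeRotation h₁ h₂ h₁₂ θ y =
      y + (Real.cos θ - 1) • planePart e₁ e₂ y + Real.sin θ • planeTurn e₁ e₂ y := rfl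

end PlaneRotation

section RotationCurve

variable {E : Type*} [NormedAddCommGroup E] [InnerProductSpace ℝ E]

theorem norm_planePart_le {e₁ e₂ : E} (h₁ : ‖e₁‖ = 1) (h₂ : ‖e₂‖ = 1) (y : E) :
    ‖planePart e₁ e₂ y‖ ≤ 2 * ‖y‖ := by
  have a1 := abs_real_inner_le_norm e₁ y
  have a2 := abs_real_inner_le_norm e₂ y
  rw [h₁, one_mul] at a1
  rw [h₂, one_mul] at a2
  refine (norm_add_le _ _).trans ?_
  rw [norm_smul, norm_smul, h₁, h₂, Real.norm_eq_abs, Real.norm_eq_abs]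
  linarith

theorem norm_planeTurn_le {e₁ e₂ : E} (h₁ : ‖e₁‖ = 1) (h₂ : ‖e₂‖ = 1) (y : E) :
    ‖planeTurn e₁ e₂ y‖ ≤ 2 * ‖y‖ := by
  have a1 := abs_real_inner_le_norm e₁ y
  have a2 := abs_real_inner_le_norm e₂ y
  rw [h₁, one_mul] at a1
  rw [h₂, one_mul] at a2
  refine (norm_sub_le _ _).trans ?_
  rw [norm_smul, norm_smul, h₁, h₂, Real.norm_eq_abs, Real.norm_eq_abs]
  linarith

/-- The circle `θ ↦ y + (cos θ - 1) P + sin θ Q` described by a point under plane rotations. -/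
noncomputable def circleCurve (y P Q : E) (θ : ℝ) : E :=
  y + (Real.cos θ - 1) • P + Real.sin θ • Q

theorem hasDerivAt_circleCurve (y P Q : E) (θ : ℝ) :
    HasDerivAt (circleCurve y P Q) (-Real.sin θ • P + Real.cos θ • Q) θ :=
  ((((Real.hasDerivAt_cos θ).sub_const 1).smul_const P).const_add y).add
    ((Real.hasDerivAt_sin θ).smul_const Q)

theorem hasDerivAt_comp_circleCurve {u : E → ℝ} {y P Q : E} {θ : ℝ}
    (hu : DifferentiableAt ℝ u (circleCurve y P Q θ)) :
    HasDerivAt (fun θ => u (circleCurve y P Q θ))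
      (fderiv ℝ u (circleCurve y P Q θ) (-Real.sin θ • P + Real.cos θ • Q)) θ :=
  hu.hasFDerivAt.comp_hasDerivAt θ (hasDerivAt_circleCurve y P Q θ)

theorem hasDerivAt_fderiv_circleCurve {u : E → ℝ} {y P Q : E} {θ : ℝ}
    (hu : ContDiffAt ℝ 2 u (circleCurve y P Q θ)) :
    HasDerivAt (fun θ => fderiv ℝ u (circleCurve y P Q θ) (-Real.sin θ • P + Real.cos θ • Q))
      (fderiv ℝ (fderiv ℝ u) (circleCurve y P Q θ) (-Real.sin θ • P + Real.cos θ • Q)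
        (-Real.sin θ • P + Real.cos θ • Q) +
        fderiv ℝ u (circleCurve y P Q θ) (-Real.cos θ • P + -Real.sin θ • Q)) θ := by
  have h1 : HasDerivAt (fun θ => fderiv ℝ u (circleCurve y P Q θ))
      (fderiv ℝ (fderiv ℝ u) (circleCurve y P Q θ) (-Real.sin θ • P + Real.cos θ • Q)) θ :=
    hu.differentiableAt_fderiv.hasFDerivAt.comp_hasDerivAt θ (hasDerivAt_circleCurve y P Q θ)
  have h2 : HasDerivAt (fun θ => -Real.sin θ • P + Real.cos θ • Q)
      (-Real.cos θ • P + -Real.sin θ • Q) θ :=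
    ((Real.hasDerivAt_sin θ).neg.smul_const P).add ((Real.hasDerivAt_cos θ).smul_const Q)
  exact h1.clm_apply h2

theorem norm_circle_combination_le {P Q : E} {K a b : ℝ} (hP : ‖P‖ ≤ K) (hQ : ‖Q‖ ≤ K)
    (ha : |a| ≤ 1) (hb : |b| ≤ 1) : ‖a • P + b • Q‖ ≤ 2 * K := by
  refine (norm_add_le _ _).trans ?_
  rw [norm_smul, norm_smul, Real.norm_eq_abs, Real.norm_eq_abs]
  nlinarith [norm_nonneg P, norm_nonneg Q, abs_nonneg a, abs_nonneg b]

end RotationCurve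

/-- Two integrations by monotonicity: `C s - φ' s` is monotone, hence so is `C s² - φ(s) - φ(-s)`
for `s ≥ 0`. -/
theorem second_difference_le {φ φ' φ'' : ℝ → ℝ} {C : ℝ} (h1 : ∀ t, HasDerivAt φ (φ' t) t)
    (h2 : ∀ t, HasDerivAt φ' (φ'' t) t) (hC : ∀ t, |φ'' t| ≤ C) (t : ℝ) :
    φ t + φ (-t) - 2 * φ 0 ≤ C * t ^ 2 := by
  have hd2 : ∀ s, HasDerivAt (fun s => C * s - φ' s) (C - φ'' s) s := fun s => by
    simpa using! ((hasDerivAt_id s).const_mul C).sub (h2 s)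
  have hmono : Monotone fun s => C * s - φ' s :=
    monotone_of_deriv_nonneg (fun s => (hd2 s).differentiableAt) fun s => by
      rw [(hd2 s).deriv]
      linarith [le_abs_self (φ'' s), hC s]
  have hd : ∀ s, HasDerivAt (fun s => C * s ^ 2 - (φ s + φ (-s))) (C * (2 * s) - (φ' s - φ' (-s))) s := by
    intro s
    have h3 : HasDerivAt (fun s => φ (-s)) (-φ' (-s)) s := by
      simpa using! (h1 (-s)).comp s (hasDerivAt_neg s)
    have h4 : HasDerivAt (fun s : ℝ => C * s ^ 2) (C * (2 * s)) s := by
      simpa using! (hasDerivAt_pow 2 s).const_mul C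
    simpa [sub_eq_add_neg] using! h4.sub ((h1 s).add h3)
  have key : ∀ t, 0 ≤ t → φ t + φ (-t) - 2 * φ 0 ≤ C * t ^ 2 := by
    intro t ht
    have hm : MonotoneOn (fun s => C * s ^ 2 - (φ s + φ (-s))) (Ici 0) := by
      apply monotoneOn_of_deriv_nonneg (convex_Ici 0)
      · exact fun s _ => (hd s).continuousAt.continuousWithinAt
      · exact fun s _ => (hd s).differentiableAt.differentiableWithinAt
      · intro s hs
        rw [interior_Ici] at hs
        rw [(hd s).deriv]
        have := hmono (by linarith [mem_Ioi.1 hs] : -s ≤ s)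
        simp only at this
        linarith
    have := hm (mem_Ici.2 le_rfl) (mem_Ici.2 ht) ht
    simp at this
    linarith
  rcases le_total 0 t with ht | ht
  · exact key t ht
  · have := key (-t) (by linarith)
    simp at this
    linarith

/-- The function `C s² - φ(s) - φ(-s)` has a minimum at `0`, where its second derivative is `2C -
2φ''`. -/
theorem le_of_second_difference_le {φ φ' : ℝ → ℝ} {φ'' C : ℝ} (h1 : ∀ t, HasDerivAt φ (φ' t) t)
    (h2 : HasDerivAt φ' φ'' 0) (hC : ∀ t, φ t + φ (-t) - 2 * φ 0 ≤ C * t ^ 2) : φ'' ≤ C := by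
  have hd : ∀ s, HasDerivAt (fun s => C * s ^ 2 - (φ s + φ (-s)))
      (C * (2 * s) - (φ' s - φ' (-s))) s := by
    intro s
    have h3 : HasDerivAt (fun s => φ (-s)) (-φ' (-s)) s := by
      simpa using! (h1 (-s)).comp s (hasDerivAt_neg s)
    have h4 : HasDerivAt (fun s : ℝ => C * s ^ 2) (C * (2 * s)) s := by
      simpa using! (hasDerivAt_pow 2 s).const_mul C
    simpa [sub_eq_add_neg] using! h4.sub ((h1 s).add h3)
  have hmin : IsLocalMin (fun s => C * s ^ 2 - (φ s + φ (-s))) 0 := by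
    refine Eventually.of_forall fun s => ?_
    have := hC s
    simp
    linarith
  have h5 := hmin.deriv_deriv_nonneg (hd 0).continuousAt
  rw [show deriv (fun s => C * s ^ 2 - (φ s + φ (-s))) = fun s => C * (2 * s) - (φ' s - φ' (-s))
    from funext fun s => (hd s).deriv] at h5
  have h6 : HasDerivAt (fun s => C * (2 * s) - (φ' s - φ' (-s))) (C * 2 - (φ'' - -φ'')) 0 := by
    have h7 : HasDerivAt (fun s => φ' (-s)) (-φ'') 0 := by
      have := HasDerivAt.comp (0 : ℝ) (h₂ := φ') (h := fun s => -s) (h₂' := φ'') (by simpa using h2)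
        (hasDerivAt_neg (0 : ℝ))
      simpa using! this
    have h8 : HasDerivAt (fun s : ℝ => C * (2 * s)) (C * 2) 0 := by
      simpa using! ((hasDerivAt_id (0 : ℝ)).const_mul 2).const_mul C
    exact h8.sub (h2.sub h7)
  rw [h6.deriv] at h5
  linarith

/-! ### Tangential derivatives from comparison with rotated solutions. -/

namespace IsShellLargeSolution

variable {N : ℕ} {f : ℝ → ℝ} {ρ R : ℝ} {u : EuclideanSpace ℝ (Fin N) → ℝ}

theorem comp_isometry (hu : IsShellLargeSolution f ρ R u)
    (L : EuclideanSpace ℝ (Fin N) ≃ₗᵢ[ℝ] EuclideanSpace ℝ (Fin N)) :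
    IsShellLargeSolution f ρ R fun x => u (L x) where
  contDiffAt x hx hxR := (hu.contDiffAt (L x) (by simpa) (by simpa)).comp x
    L.contDiff.contDiffAt
  laplacian_eq x hx hxR := by
    have := laplacian_comp_affineIsometry (u := u) L 0 x
      (by simpa using hu.contDiffAt (L x) (by simpa) (by simpa))
    simp only [zero_add] at this
    rw [this, hu.laplacian_eq (L x) (by simpa) (by simpa)]
  pos x hx hxR := hu.pos (L x) (by simpa) (by simpa)
  blowUp := by
    refine hu.blowUp.comp ?_
    rw [towardsSphere, tendsto_comap_iff]
    simpa [Function.comp_def] using! tendsto_comap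

theorem exists_derivative_bounds (hu : IsShellLargeSolution f ρ R u) (hρR : ρ < R) :
    ∃ K, 0 ≤ K ∧ ∀ x, ‖x‖ = ρ → ‖fderiv ℝ u x‖ ≤ K ∧ ‖fderiv ℝ (fderiv ℝ u) x‖ ≤ K := by
  have h1 : ContinuousOn (fun x => ‖fderiv ℝ u x‖) {x | ρ ≤ ‖x‖ ∧ ‖x‖ < R} := fun x hx =>
    ((hu.contDiffAt x hx.1 hx.2).continuousAt_fderiv (by simp)).norm.continuousWithinAt
  have h2 : ContinuousOn (fun x => ‖fderiv ℝ (fderiv ℝ u) x‖) {x | ρ ≤ ‖x‖ ∧ ‖x‖ < R} :=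
    fun x hx => ((((hu.contDiffAt x hx.1 hx.2).fderiv_right (m := 1)
      (by norm_num)).continuousAt_fderiv (by simp)).norm).continuousWithinAt
  obtain ⟨K₁, hK₁, h3⟩ := exists_le_on_sphere hρR h1
  obtain ⟨K₂, hK₂, h4⟩ := exists_le_on_sphere hρR h2
  exact ⟨max K₁ K₂, hK₁.trans (le_max_left _ _), fun x hx =>
    ⟨(h3 x hx).trans (le_max_left _ _), (h4 x hx).trans (le_max_right _ _)⟩⟩

theorem contDiffAt_circleCurve (hu : IsShellLargeSolution f ρ R u)
    {e₁ e₂ : EuclideanSpace ℝ (Fin N)} (h₁ : ‖e₁‖ = 1)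
    (h₂ : ‖e₂‖ = 1) (h₁₂ : inner ℝ e₁ e₂ = 0) {y : EuclideanSpace ℝ (Fin N)} (hy : ρ ≤ ‖y‖)
    (hyR : ‖y‖ < R) (θ : ℝ) :
    ContDiffAt ℝ 2 u (circleCurve y (planePart e₁ e₂ y) (planeTurn e₁ e₂ y) θ) := by
  have := (planeRotation h₁ h₂ h₁₂ θ).norm_map y
  rw [planeRotation_apply] at this
  exact hu.contDiffAt _ (by rwa [circleCurve, this]) (by rwa [circleCurve, this])

/-- First and second differences of `u` under rotations, on the inner sphere. -/
theorem exists_rotation_bounds (hu : IsShellLargeSolution f ρ R u) (hρ : 0 < ρ) (hρR : ρ < R) :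
    ∃ C, 0 ≤ C ∧ ∀ (e₁ e₂ : EuclideanSpace ℝ (Fin N)) (h₁ : ‖e₁‖ = 1) (h₂ : ‖e₂‖ = 1)
      (h₁₂ : inner ℝ e₁ e₂ = 0) (y : EuclideanSpace ℝ (Fin N)), ‖y‖ = ρ → ∀ θ,
      |u (planeRotation h₁ h₂ h₁₂ θ y) - u y| ≤ C * |θ| ∧
      u (planeRotation h₁ h₂ h₁₂ θ y) + u (planeRotation h₁ h₂ h₁₂ (-θ) y) - 2 * u y
        ≤ C * θ ^ 2 := by
  obtain ⟨K, hK0, hK⟩ := hu.exists_derivative_bounds hρR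
  -- Velocity and acceleration of the circle are bounded by `4ρ`, and the second derivative of `u`
  -- along it is `D²u(v, v) + Du(a)`.
  refine ⟨K * (4 * ρ) + K * (4 * ρ) * (4 * ρ), by positivity, fun e₁ e₂ h₁ h₂ h₁₂ y hy θ => ?_⟩
  set P := planePart e₁ e₂ y
  set Q := planeTurn e₁ e₂ y
  have hP : ‖P‖ ≤ 2 * ρ := hy ▸ norm_planePart_le h₁ h₂ y
  have hQ : ‖Q‖ ≤ 2 * ρ := hy ▸ norm_planeTurn_le h₁ h₂ y
  have hcurve : ∀ θ, planeRotation h₁ h₂ h₁₂ θ y = circleCurve y P Q θ := fun θ => rfl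
  have hnorm : ∀ θ, ‖circleCurve y P Q θ‖ = ρ := fun θ => by
    rw [← hcurve, LinearIsometryEquiv.norm_map, hy]
  have hC2 := fun θ => hu.contDiffAt_circleCurve h₁ h₂ h₁₂ hy.ge (hy ▸ hρR) θ
  have hd1 := fun θ => hasDerivAt_comp_circleCurve ((hC2 θ).differentiableAt (by simp))
  have hd2 := fun θ => hasDerivAt_fderiv_circleCurve (hC2 θ)
  have hv : ∀ θ : ℝ, ‖-Real.sin θ • P + Real.cos θ • Q‖ ≤ 4 * ρ := fun θ => by
    refine (norm_circle_combination_le hP hQ ?_ (Real.abs_cos_le_one θ)).trans (by linarith)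
    rw [abs_neg]; exact Real.abs_sin_le_one θ
  have ha : ∀ θ : ℝ, ‖-Real.cos θ • P + -Real.sin θ • Q‖ ≤ 4 * ρ := fun θ => by
    refine (norm_circle_combination_le hP hQ ?_ ?_).trans (by linarith)
    · rw [abs_neg]; exact Real.abs_cos_le_one θ
    · rw [abs_neg]; exact Real.abs_sin_le_one θ
  have hb1 : ∀ θ (w : EuclideanSpace ℝ (Fin N)), ‖w‖ ≤ 4 * ρ →
      |fderiv ℝ u (circleCurve y P Q θ) w| ≤ K * (4 * ρ) := fun θ w hw => by
    refine ((fderiv ℝ u (circleCurve y P Q θ)).le_opNorm w).trans ?_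
    exact mul_le_mul (hK _ (hnorm θ)).1 hw (norm_nonneg _) hK0
  have h0 : circleCurve y P Q 0 = y := by simp [circleCurve]
  constructor
  · have := Convex.norm_image_sub_le_of_norm_hasDerivWithin_le
      (f := fun θ => u (circleCurve y P Q θ)) (s := univ) (x := 0) (y := θ)
      (fun t _ => (hd1 t).hasDerivWithinAt) (fun t _ => hb1 t _ (hv t)) convex_univ
      (mem_univ _) (mem_univ _)
    rw [h0, sub_zero, Real.norm_eq_abs, Real.norm_eq_abs] at this
    rw [hcurve]
    refine this.trans (mul_le_mul_of_nonneg_right ?_ (abs_nonneg _))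
    have : 0 ≤ K * (4 * ρ) * (4 * ρ) := by positivity
    linarith
  · have := second_difference_le hd1 hd2 (C := K * (4 * ρ) + K * (4 * ρ) * (4 * ρ)) ?_ θ
    · rw [h0] at this
      rw [hcurve, hcurve]
      exact this
    · intro t
      refine (abs_add_le _ _).trans ?_
      have h3 := hb1 t _ (ha t)
      have h4 : |fderiv ℝ (fderiv ℝ u) (circleCurve y P Q t) (-Real.sin t • P + Real.cos t • Q)
          (-Real.sin t • P + Real.cos t • Q)| ≤ K * (4 * ρ) * (4 * ρ) := by
        refine ((fderiv ℝ (fderiv ℝ u) (circleCurve y P Q t)).le_opNorm₂ _ _).trans ?_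
        have h5 := (hK _ (hnorm t)).2
        have h6 := hv t
        exact mul_le_mul (mul_le_mul h5 h6 (norm_nonneg _) hK0) h6 (norm_nonneg _)
          (by positivity)
      linarith

/-- Tangential derivative bounds for large solutions. -/
theorem exists_tangential_bounds (hu : IsShellLargeSolution f ρ R u) (hf : IsConvexAbsorption f)
    (hN : 2 ≤ N) (hρ : 0 < ρ) (hρR : ρ < R) :
    ∃ C, 0 ≤ C ∧ ∀ x, ρ ≤ ‖x‖ → ‖x‖ < R → ∀ e, ‖e‖ = 1 → inner ℝ x e = 0 →
      ‖x‖ * |fderiv ℝ u x e| ≤ C * quadraticCutoff ρ R x ∧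
      ‖x‖ ^ 2 * fderiv ℝ (fderiv ℝ u) x e e - fderiv ℝ u x x ≤ C := by
  obtain ⟨C, hC0, hC⟩ := hu.exists_rotation_bounds hρ hρR
  refine ⟨C, hC0, fun x hx hxR e he hxe => ?_⟩
  have hx0 : 0 < ‖x‖ := hρ.trans_le hx
  set e₁ := ‖x‖⁻¹ • x with he₁
  have h₁ : ‖e₁‖ = 1 := by
    rw [he₁, norm_smul, norm_inv, norm_norm, inv_mul_cancel₀ hx0.ne']
  have h₁₂ : inner ℝ e₁ e = 0 := by rw [he₁, inner_smul_left, hxe, mul_zero]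
  have hx1 : inner ℝ e₁ x = ‖x‖ := by
    rw [he₁, inner_smul_left, real_inner_self_eq_norm_sq]
    simp; field_simp
  have hxx : ‖x‖ • e₁ = x := by rw [he₁, smul_inv_smul₀ hx0.ne']
  have hP : planePart e₁ e x = x := by
    rw [planePart, hx1, real_inner_comm, hxe, hxx]; simp
  have hQ : planeTurn e₁ e x = ‖x‖ • e := by
    rw [planeTurn, hx1, real_inner_comm, hxe]; simp
  have hC2 := fun θ => hu.contDiffAt_circleCurve h₁ he h₁₂ hx hxR θ
  rw [hP, hQ] at hC2
  have hd1 := fun θ => hasDerivAt_comp_circleCurve ((hC2 θ).differentiableAt (by simp))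
  have hd2 := hasDerivAt_fderiv_circleCurve (hC2 0)
  have hcurve : ∀ θ, planeRotation h₁ he h₁₂ θ x = circleCurve x x (‖x‖ • e) θ := fun θ => by
    rw [planeRotation_apply, hP, hQ, circleCurve]
  have h0 : circleCurve x x (‖x‖ • e) 0 = x := by simp [circleCurve]
  have hψ0 := quadraticCutoff_nonneg hρ hρR hxR
  have hψ1 := quadraticCutoff_le_one hρ hρR hx
  have hrot := fun θ => hu.comp_isometry (planeRotation h₁ he h₁₂ θ)
  constructor
  -- Comparing `u` with its rotation in both orders carries the Lipschitz bound in `θ` inward from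
  -- `|x| = ρ` to `x`, with the cutoff as a factor.
  · have hlip : ∀ θ, |u (circleCurve x x (‖x‖ • e) θ) - u (circleCurve x x (‖x‖ • e) 0)| ≤
        C * quadraticCutoff ρ R x * |θ - 0| := by
      intro θ
      rw [h0, ← hcurve, sub_zero, mul_right_comm, abs_le]
      have hM : 0 ≤ C * |θ| := by positivity
      have a1 := hu.sub_le_quadraticCutoff (hrot θ) hf hN hρ hρR hM
        (fun y hy => (le_abs_self _).trans (hC e₁ e h₁ he h₁₂ y hy θ).1) hx hxR
      have a2 := (hrot θ).sub_le_quadraticCutoff hu hf hN hρ hρR hM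
        (fun y hy => (le_abs_self _).trans
          ((abs_sub_comm _ _).trans_le (hC e₁ e h₁ he h₁₂ y hy θ).1)) hx hxR
      constructor <;> linarith
    have h3 := (hd1 0).le_of_lip' (C := C * quadraticCutoff ρ R x) (by positivity)
      (Eventually.of_forall hlip)
    rw [h0] at h3
    simpa [abs_mul] using h3
  -- The term `-Du(x) x` in the conclusion is the contribution of the circle's acceleration at `θ =
  -- 0`, which is `-x`.
  · have h3 := le_of_second_difference_le hd1 hd2 (C := C) fun θ => by
      rw [h0, ← hcurve, ← hcurve]
      have a1 := hu.add_sub_le_quadraticCutoff (hrot θ) (hrot (-θ)) hf hN hρ hρR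
        (by positivity : 0 ≤ C * θ ^ 2) (fun y hy => (hC e₁ e h₁ he h₁₂ y hy θ).2) hx hxR
      refine a1.trans ?_
      exact mul_le_of_le_one_right (by positivity) hψ1
    rw [h0] at h3
    simp at h3
    linarith

end IsShellLargeSolution

/-! ### Limits of the tangential gradient and of the radial derivative. -/

theorem radialDeriv_eq_fderiv {N : ℕ} (u : EuclideanSpace ℝ (Fin N) → ℝ)
    (x : EuclideanSpace ℝ (Fin N)) : radialDeriv u x = fderiv ℝ u x (‖x‖⁻¹ • x) := by
  rw [radialDeriv, gradient, InnerProductSpace.toDual_symm_apply]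

theorem inner_tangentialGradient_self {N : ℕ} (u : EuclideanSpace ℝ (Fin N) → ℝ)
    {x : EuclideanSpace ℝ (Fin N)} (hx : x ≠ 0) : inner ℝ x (tangentialGradient u x) = 0 := by
  have hx0 : ‖x‖ ≠ 0 := norm_ne_zero_iff.2 hx
  simp only [tangentialGradient, radialDeriv, inner_sub_right, inner_smul_right,
    real_inner_self_eq_norm_sq, real_inner_comm x]
  field_simp
  ring

theorem IsConvexAbsorption.mul_le {f : ℝ → ℝ} (hf : IsConvexAbsorption f) {t : ℝ} (ht : 1 ≤ t) :
    t * f 1 ≤ f t := by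
  have h0 : 0 < t := by linarith
  have := hf.convexOn.2 (mem_univ 0) (mem_univ t)
    (show 0 ≤ 1 - 1 / t by rw [sub_nonneg, div_le_one h0]; exact ht)
    (show 0 ≤ 1 / t by positivity) (by ring)
  simp only [smul_eq_mul, mul_zero, hf.map_zero, zero_add] at this
  rw [one_div_mul_cancel h0.ne', one_div, inv_mul_eq_div, le_div_iff₀ h0] at this
  linarith

theorem IsConvexAbsorption.tendsto_atTop {f : ℝ → ℝ} (hf : IsConvexAbsorption f) :
    Tendsto f atTop atTop := by
  refine tendsto_atTop_mono' _ ?_ (tendsto_id.atTop_mul_const (hf.apply_pos zero_lt_one))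
  filter_upwards [eventually_ge_atTop 1] with t ht using hf.mul_le ht

namespace IsShellLargeSolution

variable {N : ℕ} {f : ℝ → ℝ} {ρ R : ℝ} {u : EuclideanSpace ℝ (Fin N) → ℝ}

theorem tendsto_tangentialGradient (hu : IsShellLargeSolution f ρ R u)
    (hf : IsConvexAbsorption f) (hN : 2 ≤ N) (hρ : 0 < ρ) (hρR : ρ < R) :
    Tendsto (tangentialGradient u) (towardsSphere N R) (𝓝 0) := by
  obtain ⟨C, hC0, hC⟩ := hu.exists_tangential_bounds hf hN hρ hρR
  rw [tendsto_zero_iff_norm_tendsto_zero]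
  have hlim : Tendsto (fun x => C / ρ * quadraticCutoff (N := N) ρ R x) (towardsSphere N R)
      (𝓝 0) := by
    simpa using (tendsto_quadraticCutoff (N := N) (ρ := ρ) (R := R)).const_mul (C / ρ)
  refine squeeze_zero' (Eventually.of_forall fun _ => norm_nonneg _) ?_ hlim
  filter_upwards [eventually_mem_shell hρR] with x hx
  have hx0 : x ≠ 0 := norm_pos_iff.1 (hρ.trans_le hx.1)
  have hψ := quadraticCutoff_nonneg hρ hρR hx.2
  set τ := tangentialGradient u x with hτ
  have hxτ : inner ℝ x τ = 0 := inner_tangentialGradient_self u hx0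
  rcases eq_or_ne τ 0 with h0 | h0
  · rw [h0, norm_zero]; positivity
  have hτ0 : ‖τ‖ ≠ 0 := norm_ne_zero_iff.2 h0
  have he : ‖‖τ‖⁻¹ • τ‖ = 1 := by rw [norm_smul, norm_inv, norm_norm, inv_mul_cancel₀ hτ0]
  -- The direction of `τ` itself is the best test direction, since `Du(τ) = ‖τ‖²`.
  have h1 := (hC x hx.1 hx.2 (‖τ‖⁻¹ • τ) he (by rw [inner_smul_right, hxτ, mul_zero])).1
  have h2 : fderiv ℝ u x τ = ‖τ‖ ^ 2 := by
    have h3 : fderiv ℝ u x τ = inner ℝ (gradient u x) τ := by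
      rw [gradient, InnerProductSpace.toDual_symm_apply]
    have h4 : gradient u x = τ + radialDeriv u x • (‖x‖⁻¹ • x) := by
      rw [hτ, tangentialGradient]; abel
    rw [h3, h4, inner_add_left, inner_smul_left, inner_smul_left, hxτ, real_inner_self_eq_norm_sq]
    simp
  rw [map_smul, h2, smul_eq_mul, sq, inv_mul_cancel_left₀ hτ0, abs_of_nonneg (norm_nonneg _)] at h1
  rw [div_mul_eq_mul_div, le_div_iff₀ hρ]
  nlinarith [norm_nonneg τ, hx.1]

/-- Expand `Δu = f(u)` in an orthonormal basis whose first vector is radial and bound the other `N -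
1 = k + 1` second derivatives from above. What remains bounds the radial part of the Laplacian from
below. -/
theorem radial_second_derivative_ge (hu : IsShellLargeSolution f ρ R u) {C : ℝ} {k : ℕ}
    (hN : N = k + 2) (hρ : 0 < ρ)
    {x : EuclideanSpace ℝ (Fin N)} (hx : ρ ≤ ‖x‖) (hxR : ‖x‖ < R)
    (hC : ∀ e, ‖e‖ = 1 → inner ℝ x e = 0 →
      ‖x‖ ^ 2 * fderiv ℝ (fderiv ℝ u) x e e - fderiv ℝ u x x ≤ C) :
    ‖x‖ ^ 2 * f (u x) - (k + 1) * C ≤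
      ‖x‖ ^ 2 * fderiv ℝ (fderiv ℝ u) x (‖x‖⁻¹ • x) (‖x‖⁻¹ • x)
        + (k + 1) * fderiv ℝ u x x := by
  subst hN
  have hx0 : 0 < ‖x‖ := hρ.trans_le hx
  set σ := ‖x‖⁻¹ • x with hσ
  have hσ1 : ‖σ‖ = 1 := by rw [hσ, norm_smul, norm_inv, norm_norm, inv_mul_cancel₀ hx0.ne']
  obtain ⟨b, hb⟩ := Orthonormal.exists_orthonormalBasis_extension_of_card_eq (𝕜 := ℝ)
    (E := EuclideanSpace ℝ (Fin (k + 2))) (ι := Fin (k + 2)) (by simp)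
    (v := fun _ => σ) (s := {0}) (by
      constructor
      · intro _; simpa using hσ1
      · intro i j hij; exact absurd (Subsingleton.elim i j) hij)
  have hb0 : b 0 = σ := hb 0 rfl
  have hlap := laplacian_eq_sum_fderiv b u x
  rw [hu.laplacian_eq x hx hxR, Fin.sum_univ_succ, hb0] at hlap
  have hi : ∀ i : Fin (k + 1), ‖x‖ ^ 2 * fderiv ℝ (fderiv ℝ u) x (b i.succ) (b i.succ) ≤
      C + fderiv ℝ u x x := by
    intro i
    have h1 : inner ℝ σ (b i.succ) = 0 := by
      rw [← hb0]; exact b.orthonormal.2 (Fin.succ_ne_zero i).symm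
    have h2 : inner ℝ x (b i.succ) = 0 := by
      rw [hσ, inner_smul_left] at h1
      simpa [hx0.ne'] using h1
    linarith [hC (b i.succ) (b.orthonormal.1 _) h2]
  have hsum := Finset.sum_le_sum fun i (_ : i ∈ Finset.univ) => hi i
  rw [← Finset.mul_sum] at hsum
  simp only [Finset.sum_const, Finset.card_univ, Fintype.card_fin, nsmul_eq_mul] at hsum
  push_cast at hsum
  rw [hlap]
  linarith

theorem tendsto_radialDeriv (hu : IsShellLargeSolution f ρ R u)
    (hf : IsConvexAbsorption f) (hN : 2 ≤ N) (hρ : 0 < ρ) (hρR : ρ < R) :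
    Tendsto (radialDeriv u) (towardsSphere N R) atTop := by
  obtain ⟨C, hC0, hC⟩ := hu.exists_tangential_bounds hf hN hρ hρR
  obtain ⟨k, hk⟩ : ∃ k, N = k + 2 := ⟨N - 2, by omega⟩
  have hR : 0 < R := hρ.trans hρR
  have hlarge : ∀ᶠ x in towardsSphere N R, (k + 1) * C / ρ ^ 2 ≤ f (u x) :=
    (hf.tendsto_atTop.comp hu.blowUp).eventually_ge_atTop _
  obtain ⟨ρ₁, hρ₁, h1⟩ := eventually_towardsSphere.1 hlarge
  obtain ⟨ρ₂, hρ₂, hρ₂R⟩ : ∃ ρ₂, max ρ ρ₁ < ρ₂ ∧ ρ₂ < R := exists_between (max_lt hρR hρ₁)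
  have hρρ₂ : ρ < ρ₂ := (le_max_left _ _).trans_lt hρ₂
  have hρ₁ρ₂ : ρ₁ < ρ₂ := (le_max_right _ _).trans_lt hρ₂
  have hρ₂0 : 0 < ρ₂ := hρ.trans hρρ₂
  obtain ⟨M, hM0, hM⟩ := exists_le_on_sphere hρ₂R (hu.mono hρρ₂.le).continuousOn
  -- Along the ray `s^(k+1) ∂u/∂r` is nondecreasing beyond `ρ₂`, because `f(u)` dominates the
  -- tangential constant there. The mean value theorem finds a point on the ray where `∂u/∂r` is at
  -- least `(u x - M)/(R - ρ₂)`, and monotonicity carries this out to `x`.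
  have hray : ∀ x, ρ₂ < ‖x‖ → ‖x‖ < R → M < u x →
      (ρ₂ / R) ^ (k + 1) * ((u x - M) / (R - ρ₂)) ≤ radialDeriv u x := by
    intro x hx hxR hux
    have hx0 : 0 < ‖x‖ := hρ₂0.trans hx
    set σ := ‖x‖⁻¹ • x with hσ
    have hσ1 : ‖σ‖ = 1 := by rw [hσ, norm_smul, norm_inv, norm_norm, inv_mul_cancel₀ hx0.ne']
    have hxσ : ‖x‖ • σ = x := by rw [hσ, smul_inv_smul₀ hx0.ne']
    have hnorm : ∀ s : ℝ, 0 ≤ s → ‖s • σ‖ = s := fun s hs => by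
      rw [norm_smul, hσ1, mul_one, Real.norm_of_nonneg hs]
    have hpt : ∀ s, ρ₂ ≤ s → s ≤ ‖x‖ → ρ ≤ ‖s • σ‖ ∧ ‖s • σ‖ < R := fun s h2 h3 => by
      rw [hnorm s (hρ₂0.le.trans h2)]
      exact ⟨hρρ₂.le.trans h2, h3.trans_lt hxR⟩
    have hc : ∀ s : ℝ, HasDerivAt (fun s : ℝ => s • σ) σ s := fun s => by
      simpa using (hasDerivAt_id s).smul_const σ
    have hd1 : ∀ s, ρ₂ ≤ s → s ≤ ‖x‖ →
        HasDerivAt (fun s : ℝ => u (s • σ)) (fderiv ℝ u (s • σ) σ) s := fun s h2 h3 =>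
      (((hu.contDiffAt _ (hpt s h2 h3).1 (hpt s h2 h3).2).differentiableAt
        (by simp)).hasFDerivAt).comp_hasDerivAt s (hc s)
    have hd2 : ∀ s, ρ₂ ≤ s → s ≤ ‖x‖ →
        HasDerivAt (fun s : ℝ => fderiv ℝ u (s • σ) σ) (fderiv ℝ (fderiv ℝ u) (s • σ) σ σ) s :=
      fun s h2 h3 => by
        have h4 : HasDerivAt (fun s : ℝ => fderiv ℝ u (s • σ))
            (fderiv ℝ (fderiv ℝ u) (s • σ) σ) s :=
          ((hu.contDiffAt _ (hpt s h2 h3).1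
            (hpt s h2 h3).2).differentiableAt_fderiv.hasFDerivAt).comp_hasDerivAt s (hc s)
        simpa using h4.clm_apply (hasDerivAt_const s σ)
    have hd3 : ∀ s, ρ₂ ≤ s → s ≤ ‖x‖ →
        HasDerivAt (fun s : ℝ => s ^ (k + 1) * fderiv ℝ u (s • σ) σ)
          (((k + 1 : ℕ) : ℝ) * s ^ k * fderiv ℝ u (s • σ) σ
            + s ^ (k + 1) * fderiv ℝ (fderiv ℝ u) (s • σ) σ σ) s := fun s h2 h3 => by
      simpa using! (hasDerivAt_pow (k + 1) s).mul (hd2 s h2 h3)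
    have hmono : MonotoneOn (fun s : ℝ => s ^ (k + 1) * fderiv ℝ u (s • σ) σ) (Icc ρ₂ ‖x‖) := by
      apply monotoneOn_of_deriv_nonneg (convex_Icc _ _)
      · exact fun s hs => (hd3 s hs.1 hs.2).continuousAt.continuousWithinAt
      · exact fun s hs => (hd3 s (interior_subset hs).1
          (interior_subset hs).2).differentiableAt.differentiableWithinAt
      · intro s hs
        rw [interior_Icc] at hs
        rw [(hd3 s hs.1.le hs.2.le).deriv]
        have hs0 : 0 < s := hρ₂0.trans hs.1
        have hsp := hpt s hs.1.le hs.2.le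
        have hns := hnorm s hs0.le
        have h4 := hu.radial_second_derivative_ge hk hρ hsp.1 hsp.2
          fun e he1 he2 => (hC (s • σ) hsp.1 hsp.2 e he1 he2).2
        rw [hns, inv_smul_smul₀ hs0.ne', (fderiv ℝ u (s • σ)).map_smul s σ, smul_eq_mul] at h4
        have h5 := h1 (s • σ) (by rw [hns]; exact hρ₁ρ₂.trans hs.1) hsp.2
        rw [div_le_iff₀ (by positivity)] at h5
        have h6 : ρ ^ 2 ≤ s ^ 2 := by
          have : ρ ≤ s := (hρρ₂.trans hs.1).le
          gcongr
        have h7 : 0 ≤ f (u (s • σ)) := (hf.apply_pos (hu.pos _ hsp.1 hsp.2)).le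
        have h8 : 0 ≤ s * (s * fderiv ℝ (fderiv ℝ u) (s • σ) σ σ
            + (k + 1) * fderiv ℝ u (s • σ) σ) := by nlinarith
        have h9 := nonneg_of_mul_nonneg_right h8 hs0
        have h10 := mul_nonneg (pow_nonneg hs0.le k) h9
        push_cast
        calc (0 : ℝ) ≤ _ := h10
          _ = _ := by ring
    obtain ⟨ξ, hξ, hξd⟩ := exists_hasDerivAt_eq_slope (fun s : ℝ => u (s • σ))
      (fun s => fderiv ℝ u (s • σ) σ) hx
      (fun s hs => (hd1 s hs.1 hs.2).continuousAt.continuousWithinAt)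
      (fun s hs => hd1 s hs.1.le hs.2.le)
    simp only [hxσ] at hξd
    have hMx := hM (ρ₂ • σ) (hnorm _ hρ₂0.le)
    have hslope : (u x - M) / (R - ρ₂) ≤ fderiv ℝ u (ξ • σ) σ := by
      rw [hξd, div_le_div_iff₀ (by linarith) (by linarith)]
      nlinarith
    have h11 := hmono ⟨hξ.1.le, hξ.2.le⟩ ⟨hx.le, le_rfl⟩ hξ.2.le
    simp only [hxσ] at h11
    rw [radialDeriv_eq_fderiv]
    have h12 : 0 ≤ (u x - M) / (R - ρ₂) := div_nonneg (by linarith) (by linarith)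
    have hξ0 : 0 < ξ := hρ₂0.trans hξ.1
    have h13 : ρ₂ ^ (k + 1) * ((u x - M) / (R - ρ₂)) ≤ ‖x‖ ^ (k + 1) * fderiv ℝ u x σ := by
      refine le_trans (mul_le_mul ?_ hslope h12 (by positivity)) h11
      exact pow_le_pow_left₀ hρ₂0.le hξ.1.le _
    have h14 : 0 ≤ fderiv ℝ u x σ := by
      have : 0 ≤ ‖x‖ ^ (k + 1) * fderiv ℝ u x σ := le_trans (by positivity) h13
      exact nonneg_of_mul_nonneg_right this (by positivity)
    have h15 : ‖x‖ ^ (k + 1) * fderiv ℝ u x σ ≤ R ^ (k + 1) * fderiv ℝ u x σ :=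
      mul_le_mul_of_nonneg_right (pow_le_pow_left₀ hx0.le hxR.le _) h14
    rw [div_pow, div_mul_eq_mul_div, div_le_iff₀ (by positivity)]
    linarith
  have hlim : Tendsto (fun x => (ρ₂ / R) ^ (k + 1) * ((u x - M) / (R - ρ₂))) (towardsSphere N R)
      atTop := by
    refine Tendsto.const_mul_atTop (by positivity) (Tendsto.atTop_div_const (by linarith) ?_)
    simpa [sub_eq_add_neg] using! tendsto_atTop_add_const_right _ (-M) hu.blowUp
  refine tendsto_atTop_mono' _ ?_ hlim
  filter_upwards [eventually_towardsSphere.2 ⟨ρ₂, hρ₂R, fun x h2 h3 => And.intro h2 h3⟩,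
    hu.blowUp.eventually_gt_atTop M] with x hx hxM
  exact hray x hx.1 hx.2 hxM

end IsShellLargeSolution

/-! ### Return to the original equation. -/

/-- Near the outer sphere, a large solution of the original equation is, up to an additive
constant, a shell large solution for a normalised convex absorption. -/
theorem IsOuterLargeSolution.exists_isShellLargeSolution {N : ℕ} {r R : ℝ} (hr : 0 ≤ r)
    (hrR : r < R) {g : ℝ → ℝ} (hg : Continuous g) (hKO : ConvexKellerOsserman g)
    {u : EuclideanSpace ℝ (Fin N) → ℝ} (hu : IsOuterLargeSolution g r R u) :
    ∃ (f : ℝ → ℝ) (t₀ ρ : ℝ), IsConvexAbsorption f ∧ 0 < ρ ∧ ρ < R ∧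
      IsShellLargeSolution f ρ R fun x => u x - t₀ := by
  obtain ⟨f, t₀, b, hf, hb, hfg⟩ := hKO.exists_isConvexAbsorption hg
  obtain ⟨ρ₁, hρ₁, h1⟩ := eventually_towardsSphere.1 (hu.blowUp.eventually_ge_atTop b)
  -- On this shell `u ≥ b`, so `g (u) = f (u - t₀)`, and `u - t₀ > 0` because `t₀ < b`.
  obtain ⟨ρ, hρ, hρR⟩ : ∃ ρ, max r ρ₁ < ρ ∧ ρ < R := exists_between (max_lt hrR hρ₁)
  have hrρ : r < ρ := (le_max_left _ _).trans_lt hρ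
  have hρ₁ρ : ρ₁ < ρ := (le_max_right _ _).trans_lt hρ
  have hmem : ∀ x : EuclideanSpace ℝ (Fin N), ρ ≤ ‖x‖ → ‖x‖ < R → x ∈ annulus N r R :=
    fun x h2 h3 => ⟨hrρ.trans_le h2, h3⟩
  have hC2 : ∀ x, ρ ≤ ‖x‖ → ‖x‖ < R → ContDiffAt ℝ 2 u x := fun x h2 h3 =>
    hu.contDiffOn.contDiffAt ((isOpen_shell N r R).mem_nhds (hmem x h2 h3))
  have hub : ∀ x, ρ ≤ ‖x‖ → ‖x‖ < R → b ≤ u x := fun x h2 h3 => h1 x (hρ₁ρ.trans_le h2) h3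
  refine ⟨f, t₀, ρ, hf, hr.trans_lt hrρ, hρR, fun x h2 h3 => (hC2 x h2 h3).sub contDiffAt_const,
    fun x h2 h3 => ?_, fun x h2 h3 => by linarith [hub x h2 h3], ?_⟩
  · have h4 := (hC2 x h2 h3).laplacian_sub (contDiffAt_const (c := t₀))
    rw [InnerProductSpace.laplacian_const] at h4
    have h5 := hu.equation x (hmem x h2 h3)
    rw [hfg _ (hub x h2 h3)]
    refine h4.trans ?_
    simp only [Pi.zero_apply, sub_zero]
    linarith
  · simpa [sub_eq_add_neg] using! tendsto_atTop_add_const_right _ (-t₀) hu.blowUp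

theorem gradient_sub_const {N : ℕ} (u : EuclideanSpace ℝ (Fin N) → ℝ) (c : ℝ) :
    gradient (fun x => u x - c) = gradient u := by
  funext x
  rw [gradient, gradient, fderiv_sub_const]

theorem IsOuterLargeSolution.tendsto_gradient {N : ℕ} (hN : 2 ≤ N) {r R : ℝ} (hr : 0 ≤ r)
    (hrR : r < R) {g : ℝ → ℝ} (hg : Continuous g) (hKO : ConvexKellerOsserman g)
    {u : EuclideanSpace ℝ (Fin N) → ℝ} (hu : IsOuterLargeSolution g r R u) :
    Tendsto (tangentialGradient u) (towardsSphere N R) (𝓝 0) ∧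
      Tendsto (radialDeriv u) (towardsSphere N R) atTop := by
  obtain ⟨f, t₀, ρ, hf, hρ, hρR, h⟩ := hu.exists_isShellLargeSolution hr hrR hg hKO
  have h1 := h.tendsto_tangentialGradient hf hN hρ hρR
  have h2 := h.tendsto_radialDeriv hf hN hρ hρR
  have e2 : radialDeriv (fun x => u x - t₀) = radialDeriv u := by
    funext x
    rw [radialDeriv, radialDeriv, gradient_sub_const]
  have e1 : tangentialGradient (fun x => u x - t₀) = tangentialGradient u := by
    funext x
    rw [tangentialGradient, tangentialGradient, gradient_sub_const, e2]
  rw [e1] at h1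
  rw [e2] at h2
  exact ⟨h1, h2⟩

/-! ### Hopf's barrier. -/

theorem laplacian_exp_neg_sq {N : ℕ} (α : ℝ) (c x : EuclideanSpace ℝ (Fin N)) :
    Laplacian.laplacian (fun y => Real.exp (-α * ‖y - c‖ ^ 2)) x =
      (4 * α ^ 2 * ‖x - c‖ ^ 2 - 2 * α * N) * Real.exp (-α * ‖x - c‖ ^ 2) := by
  have hA : ∀ t : ℝ, HasDerivAt (fun t => Real.exp (-α * t)) (Real.exp (-α * t) * -α) t :=
    fun t => by simpa using ((hasDerivAt_id t).const_mul (-α)).exp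
  have hd : deriv (fun t => Real.exp (-α * t)) = fun t => Real.exp (-α * t) * -α :=
    funext fun t => (hA t).deriv
  have hdd : ∀ t, deriv (fun t => Real.exp (-α * t) * -α) t = Real.exp (-α * t) * -α * -α :=
    fun t => ((hA t).mul_const (-α)).deriv
  rw [laplacian_comp (A := fun t => Real.exp (-α * t)) (contDiffAt_sub_norm_sq c x)
    (by fun_prop), hd, hdd, laplacian_sub_norm_sq, norm_fderiv_sub_norm_sq,
    finrank_euclideanSpace_fin]
  ring

/-- Hopf's barrier in a spherical shell, for nonnegative supersolutions of `Δw = Lw`. -/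
theorem exists_hopf_barrier {N : ℕ} {w : EuclideanSpace ℝ (Fin N) → ℝ}
    {c : EuclideanSpace ℝ (Fin N)} {ρ₁ ρ L : ℝ} (hρ₁ : 0 < ρ₁) (hL : 0 ≤ L)
    (hc : ContinuousOn w (Metric.closedBall c ρ))
    (hC2 : ∀ x ∈ Metric.ball c ρ, ContDiffAt ℝ 2 w x)
    (hsup : ∀ x ∈ Metric.ball c ρ, Laplacian.laplacian w x ≤ L * w x)
    (hnn : ∀ x ∈ Metric.closedBall c ρ, 0 ≤ w x)
    (hpos : ∀ x, ‖x - c‖ = ρ₁ → 0 < w x) (hρ : ρ₁ < ρ) :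
    ∃ α > 0, ∃ ε > 0, ∀ x, ρ₁ ≤ ‖x - c‖ → ‖x - c‖ ≤ ρ →
      ε * (Real.exp (-α * ‖x - c‖ ^ 2) - Real.exp (-α * ρ ^ 2)) ≤ w x := by
  -- Large enough that `4α² |x - c|² - 2αN > L` for `|x - c| ≥ ρ₁`, which makes the exponential a
  -- strict subsolution of `Δh = Lh`; the added `1` gives `α ≥ 1`.
  set α := (2 * N + 1 + L) / (4 * ρ₁ ^ 2) + 1 with hα
  have hα1 : 1 ≤ α := by
    have : 0 ≤ (2 * N + 1 + L) / (4 * ρ₁ ^ 2) := by positivity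
    linarith
  have hα0 : 0 < α := by linarith
  have hαL : 2 * N + 1 + L ≤ 4 * α * ρ₁ ^ 2 := by
    have : 4 * α * ρ₁ ^ 2 = 2 * N + 1 + L + 4 * ρ₁ ^ 2 := by rw [hα]; field_simp
    nlinarith [sq_nonneg ρ₁]
  have hsphere : IsCompact {x : EuclideanSpace ℝ (Fin N) | ‖x - c‖ = ρ₁} := by
    refine (isCompact_closedBall c ρ).of_isClosed_subset
      (isClosed_eq (by fun_prop) continuous_const) fun x hx => ?_
    rw [mem_closedBall_iff_norm]
    exact (le_of_eq hx).trans hρ.le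
  obtain ⟨ε, hε, hεw⟩ := hsphere.exists_forall_le' (f := w) (a := 0)
    (hc.mono fun x hx => by
      rw [mem_closedBall_iff_norm]
      exact (le_of_eq hx).trans hρ.le) (fun x hx => hpos x hx)
  refine ⟨α, hα0, ε, hε, ?_⟩
  set h : EuclideanSpace ℝ (Fin N) → ℝ :=
    fun x => ε * (Real.exp (-α * ‖x - c‖ ^ 2) - Real.exp (-α * ρ ^ 2)) with hh
  have hnc : Continuous fun x : EuclideanSpace ℝ (Fin N) => ‖x - c‖ := by fun_prop
  have hK : IsCompact {x : EuclideanSpace ℝ (Fin N) | ρ₁ ≤ ‖x - c‖ ∧ ‖x - c‖ ≤ ρ} := by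
    refine (isCompact_closedBall c ρ).of_isClosed_subset
      ((isClosed_le continuous_const hnc).inter (isClosed_le hnc continuous_const)) fun x hx => ?_
    rw [mem_closedBall_iff_norm]
    exact hx.2
  by_contra! hcon
  obtain ⟨x₀, hx₀, hx₀ρ, hneg⟩ := hcon
  have hcont : ContinuousOn (fun x => w x - h x)
      {x : EuclideanSpace ℝ (Fin N) | ρ₁ ≤ ‖x - c‖ ∧ ‖x - c‖ ≤ ρ} := by
    refine (hc.mono fun x hx => ?_).sub (by fun_prop)
    rw [mem_closedBall_iff_norm]
    exact hx.2
  obtain ⟨y, hy, hymin⟩ := hK.exists_isMinOn ⟨x₀, hx₀, hx₀ρ⟩ hcont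
  have hyneg : w y - h y < 0 := (hymin (show x₀ ∈ _ from ⟨hx₀, hx₀ρ⟩)).trans_lt (sub_neg.2 hneg)
  have hy1 : ρ₁ < ‖y - c‖ := by
    refine lt_of_le_of_ne hy.1 fun h' => ?_
    have h1 := hεw y h'.symm
    have h2 : Real.exp (-α * ‖y - c‖ ^ 2) ≤ 1 := by
      rw [Real.exp_le_one_iff]; nlinarith [sq_nonneg ‖y - c‖]
    have h3 := Real.exp_pos (-α * ρ ^ 2)
    simp only [hh] at hyneg
    nlinarith
  have hyball : y ∈ Metric.closedBall c ρ := by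
    rw [mem_closedBall_iff_norm]; exact hy.2
  have hy2 : ‖y - c‖ < ρ := by
    refine lt_of_le_of_ne hy.2 fun h' => ?_
    simp only [hh, h', sub_self, mul_zero] at hyneg
    linarith [hnn y hyball]
  have hyb : y ∈ Metric.ball c ρ := by rwa [mem_ball_iff_norm]
  have hmin : IsLocalMin (fun x => w x - h x) y := by
    have hopen : IsOpen {x : EuclideanSpace ℝ (Fin N) | ρ₁ < ‖x - c‖ ∧ ‖x - c‖ < ρ} :=
      (isOpen_lt continuous_const hnc).inter (isOpen_lt hnc continuous_const)
    filter_upwards [hopen.mem_nhds ⟨hy1, hy2⟩] with x hx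
    exact hymin ⟨hx.1.le, hx.2.le⟩
  have hw2 := hC2 y hyb
  have he2 : ContDiffAt ℝ 2 (fun x => Real.exp (-α * ‖x - c‖ ^ 2)) y :=
    (contDiffAt_const.mul (contDiffAt_sub_norm_sq c y)).exp
  have he3 : ContDiffAt ℝ 2 ((fun x => Real.exp (-α * ‖x - c‖ ^ 2)) -
      fun _ => Real.exp (-α * ρ ^ 2)) y := he2.sub contDiffAt_const
  have hh2 : ContDiffAt ℝ 2 h y := contDiffAt_const.mul he3
  have h1 := laplacian_nonneg_of_isLocalMin (hw2.sub hh2) hmin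
  have h2 : Laplacian.laplacian h y = ε *
      ((4 * α ^ 2 * ‖y - c‖ ^ 2 - 2 * α * N) * Real.exp (-α * ‖y - c‖ ^ 2)) := by
    have h3 := InnerProductSpace.laplacian_smul ε he3
    rw [he2.laplacian_sub contDiffAt_const, InnerProductSpace.laplacian_const,
      laplacian_exp_neg_sq] at h3
    refine Eq.trans h3 ?_
    simp
  have h3 : (Laplacian.laplacian (w - h) : EuclideanSpace ℝ (Fin N) → ℝ) y =
      Laplacian.laplacian w y - Laplacian.laplacian h y := hw2.laplacian_sub hh2
  have h4 : 0 ≤ Laplacian.laplacian w y - Laplacian.laplacian h y := h3 ▸ h1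
  have h5 := hsup y hyb
  have hE := Real.exp_pos (-α * ‖y - c‖ ^ 2)
  have hE' := Real.exp_pos (-α * ρ ^ 2)
  have h6 : L < 4 * α ^ 2 * ‖y - c‖ ^ 2 - 2 * α * N := by
    have h7 : ρ₁ ^ 2 ≤ ‖y - c‖ ^ 2 := pow_le_pow_left₀ hρ₁.le hy1.le 2
    have h8 : 1 + L ≤ 4 * α * ‖y - c‖ ^ 2 - 2 * N := by nlinarith
    have h9 : 4 * α ^ 2 * ‖y - c‖ ^ 2 - 2 * α * N = α * (4 * α * ‖y - c‖ ^ 2 - 2 * N) := by ring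
    rw [h9]
    nlinarith
  have h7 : L * (ε * Real.exp (-α * ‖y - c‖ ^ 2)) < Laplacian.laplacian h y := by
    rw [h2]
    have := mul_lt_mul_of_pos_right h6 (mul_pos hε hE)
    linarith
  have h8 : h y ≤ ε * Real.exp (-α * ‖y - c‖ ^ 2) :=
    mul_le_mul_of_nonneg_left (by linarith) hε.le
  have h9 : L * w y ≤ L * (ε * Real.exp (-α * ‖y - c‖ ^ 2)) :=
    mul_le_mul_of_nonneg_left (by linarith) hL
  linarith

/-! ### Reflections, Hopf's lemma and the strong maximum principle in caps. -/

section HyperplaneReflection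

variable {N : ℕ}

/-- The linear reflection `x ↦ x - 2⟨x, e⟩e`. -/
noncomputable def hyperplaneReflectionLinear (e : EuclideanSpace ℝ (Fin N)) (he : ‖e‖ = 1) :
    EuclideanSpace ℝ (Fin N) ≃ₗᵢ[ℝ] EuclideanSpace ℝ (Fin N) :=
  LinearIsometry.toLinearIsometryEquiv
    { toFun := fun x => x - (2 * inner ℝ x e) • e
      map_add' := fun x y => by simp only [inner_add_left]; module
      map_smul' := fun c x => by
        simp only [inner_smul_left, RCLike.conj_to_real, RingHom.id_apply]; module
      norm_map' := fun x => by
        rw [← sq_eq_sq₀ (norm_nonneg _) (norm_nonneg _)]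
        simp only [LinearMap.coe_mk, AddHom.coe_mk]
        rw [norm_sub_sq_real, inner_smul_right, norm_smul, he, mul_one, Real.norm_eq_abs, sq_abs]
        ring } rfl

theorem hyperplaneReflectionLinear_apply {e : EuclideanSpace ℝ (Fin N)} (he : ‖e‖ = 1)
    (x : EuclideanSpace ℝ (Fin N)) :
    hyperplaneReflectionLinear e he x = x - (2 * inner ℝ x e) • e := rfl

/-- Reflection in the hyperplane `⟨x, e⟩ = l`. -/
noncomputable def hyperplaneReflection (e : EuclideanSpace ℝ (Fin N)) (l : ℝ)
    (x : EuclideanSpace ℝ (Fin N)) : EuclideanSpace ℝ (Fin N) :=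
  x + (2 * (l - inner ℝ x e)) • e

theorem hyperplaneReflection_eq {e : EuclideanSpace ℝ (Fin N)} (he : ‖e‖ = 1) (l : ℝ)
    (x : EuclideanSpace ℝ (Fin N)) :
    hyperplaneReflection e l x = (2 * l) • e + hyperplaneReflectionLinear e he x := by
  rw [hyperplaneReflectionLinear_apply, hyperplaneReflection]; module

theorem continuous_hyperplaneReflection (e : EuclideanSpace ℝ (Fin N)) :
    Continuous fun p : ℝ × EuclideanSpace ℝ (Fin N) => hyperplaneReflection e p.1 p.2 := by
  unfold hyperplaneReflection
  fun_prop

theorem hyperplaneReflection_of_inner_eq {e x : EuclideanSpace ℝ (Fin N)} {l : ℝ}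
    (h : inner ℝ x e = l) : hyperplaneReflection e l x = x := by
  simp [hyperplaneReflection, h]

theorem norm_add_smul_le {e x : EuclideanSpace ℝ (Fin N)} (he : ‖e‖ = 1) {l t : ℝ} (hl : 0 ≤ l)
    (h1 : 2 * (l - inner ℝ x e) ≤ t) (h2 : t ≤ 0) : ‖x + t • e‖ ≤ ‖x‖ := by
  rw [← sq_le_sq₀ (norm_nonneg _) (norm_nonneg _), norm_add_sq_real, inner_smul_right, norm_smul,
    he, mul_one, Real.norm_eq_abs, sq_abs]
  nlinarith

theorem norm_hyperplaneReflection_sq {e x : EuclideanSpace ℝ (Fin N)} (he : ‖e‖ = 1) (l : ℝ) :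
    ‖hyperplaneReflection e l x‖ ^ 2 = ‖x‖ ^ 2 + 4 * l * (l - inner ℝ x e) := by
  rw [hyperplaneReflection, norm_add_sq_real, inner_smul_right, norm_smul, he, mul_one,
    Real.norm_eq_abs, sq_abs]
  ring

theorem le_norm_hyperplaneReflection {e x : EuclideanSpace ℝ (Fin N)} (he : ‖e‖ = 1) (l : ℝ) :
    2 * l - inner ℝ x e ≤ ‖hyperplaneReflection e l x‖ := by
  have h1 := real_inner_le_norm (hyperplaneReflection e l x) e
  rw [he, mul_one, hyperplaneReflection, inner_add_left, inner_smul_left,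
    real_inner_self_eq_norm_sq, he] at h1
  simp at h1
  rw [hyperplaneReflection]
  linarith

theorem inner_le_norm_of_norm_eq_one {e x : EuclideanSpace ℝ (Fin N)} (he : ‖e‖ = 1) :
    inner ℝ x e ≤ ‖x‖ := by
  have := real_inner_le_norm x e
  rwa [he, mul_one] at this

end HyperplaneReflection

namespace IsOuterLargeSolution

variable {N : ℕ} {g : ℝ → ℝ} {r R : ℝ} {u : EuclideanSpace ℝ (Fin N) → ℝ}
  {e : EuclideanSpace ℝ (Fin N)} {l : ℝ}

theorem contDiffAt (hu : IsOuterLargeSolution g r R u) {x : EuclideanSpace ℝ (Fin N)}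
    (hx : x ∈ annulus N r R) : ContDiffAt ℝ 2 u x :=
  hu.contDiffOn.contDiffAt ((isOpen_shell N r R).mem_nhds hx)

/-- `u` is larger on the cap `⟨x, e⟩ > l` than at the reflected points. -/
def ReflectionLT (u : EuclideanSpace ℝ (Fin N) → ℝ) (R : ℝ) (e : EuclideanSpace ℝ (Fin N))
    (l : ℝ) : Prop :=
  ∀ x, l < inner ℝ x e → ‖x‖ < R → u (hyperplaneReflection e l x) < u x

theorem mem_annulus_of_le_inner (he : ‖e‖ = 1) (hl : (R + r) / 2 < l)
    {x : EuclideanSpace ℝ (Fin N)} (hx : l ≤ inner ℝ x e) (hxR : ‖x‖ < R) :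
    x ∈ annulus N r R :=
  ⟨by linarith [inner_le_norm_of_norm_eq_one (x := x) he], hxR⟩

/-- The whole segment from a cap point to its reflection stays in the annulus: norms do not exceed
`‖x‖`, and the component along `e` is at least `2l - ⟨x, e⟩ > (R + r) - R = r`. This is where the
threshold `(R + r) / 2` comes from. -/
theorem add_smul_mem_annulus (hr : 0 ≤ r) (hrR : r < R) (he : ‖e‖ = 1) (hl : (R + r) / 2 < l)
    {x : EuclideanSpace ℝ (Fin N)} (hxR : ‖x‖ < R) {t : ℝ}
    (h1 : 2 * (l - inner ℝ x e) ≤ t) (h2 : t ≤ 0) : x + t • e ∈ annulus N r R := by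
  refine ⟨?_, (norm_add_smul_le he (by linarith) h1 h2).trans_lt hxR⟩
  have h3 := inner_le_norm_of_norm_eq_one (x := x + t • e) he
  rw [inner_add_left, inner_smul_left, real_inner_self_eq_norm_sq, he] at h3
  simp at h3
  linarith [inner_le_norm_of_norm_eq_one (x := x) he]

theorem hyperplaneReflection_mem_annulus (hr : 0 ≤ r) (hrR : r < R) (he : ‖e‖ = 1)
    (hl : (R + r) / 2 < l) {x : EuclideanSpace ℝ (Fin N)} (hx : l ≤ inner ℝ x e)
    (hxR : ‖x‖ < R) : hyperplaneReflection e l x ∈ annulus N r R :=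
  add_smul_mem_annulus hr hrR he hl hxR le_rfl (by linarith)

theorem reflection_lt_of_fderiv_pos (hu : IsOuterLargeSolution g r R u) (hr : 0 ≤ r)
    (hrR : r < R) (he : ‖e‖ = 1) (hl : (R + r) / 2 < l) {x : EuclideanSpace ℝ (Fin N)}
    (hx : l < inner ℝ x e) (hxR : ‖x‖ < R)
    (h : ∀ t, 2 * (l - inner ℝ x e) ≤ t → t ≤ 0 → 0 < fderiv ℝ u (x + t • e) e) :
    u (hyperplaneReflection e l x) < u x := by
  have hd : ∀ t, 2 * (l - inner ℝ x e) ≤ t → t ≤ 0 →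
      HasDerivAt (fun t : ℝ => u (x + t • e)) (fderiv ℝ u (x + t • e) e) t := fun t h1 h2 =>
    hasDerivAt_line ((hu.contDiffAt
      (add_smul_mem_annulus hr hrR he hl hxR h1 h2)).differentiableAt (by simp))
  have hmono : StrictMonoOn (fun t : ℝ => u (x + t • e)) (Icc (2 * (l - inner ℝ x e)) 0) := by
    apply strictMonoOn_of_deriv_pos (convex_Icc _ _)
    · exact fun t ht => (hd t ht.1 ht.2).continuousAt.continuousWithinAt
    · intro t ht
      have ht := interior_subset ht
      rw [(hd t ht.1 ht.2).deriv]
      exact h t ht.1 ht.2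
  have h0 : 2 * (l - inner ℝ x e) < 0 := by linarith
  simpa [hyperplaneReflection] using
    hmono (left_mem_Icc.2 h0.le) (right_mem_Icc.2 h0.le) h0

theorem contDiffAt_comp_reflection (hu : IsOuterLargeSolution g r R u) (hr : 0 ≤ r)
    (hrR : r < R) (he : ‖e‖ = 1) (hl : (R + r) / 2 < l) {x : EuclideanSpace ℝ (Fin N)}
    (hx : l ≤ inner ℝ x e) (hxR : ‖x‖ < R) :
    ContDiffAt ℝ 2 (fun y => u (hyperplaneReflection e l y)) x ∧
      Laplacian.laplacian (fun y => u (hyperplaneReflection e l y)) x =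
        g (u (hyperplaneReflection e l x)) := by
  have hmem := hyperplaneReflection_mem_annulus hr hrR he hl hx hxR
  have h1 := hu.contDiffAt hmem
  constructor
  · refine ContDiffAt.comp x h1 ?_
    exact contDiffAt_id.add ((contDiffAt_const.mul (contDiffAt_const.sub
      (contDiffAt_id.inner ℝ contDiffAt_const))).smul contDiffAt_const)
  · have h2 := hu.equation _ hmem
    simp only [hyperplaneReflection_eq he] at h1 h2 ⊢
    rw [laplacian_comp_affineIsometry _ _ _ h1]
    linarith

/-- The difference of `u` and its reflection satisfies a linear differential inequality on compact
subsets of the cap. -/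
theorem exists_laplacian_sub_reflection_le (hu : IsOuterLargeSolution g r R u)
    (hg : LocallyLipschitz g) (hr : 0 ≤ r) (hrR : r < R) (he : ‖e‖ = 1) (hl : (R + r) / 2 < l)
    {K : Set (EuclideanSpace ℝ (Fin N))} (hK : IsCompact K)
    (hKcap : ∀ x ∈ K, l ≤ inner ℝ x e ∧ ‖x‖ < R) :
    ∃ L : ℝ, 0 ≤ L ∧ ∀ x ∈ K, 0 ≤ u x - u (hyperplaneReflection e l x) →
      Laplacian.laplacian (fun y => u y - u (hyperplaneReflection e l y)) x ≤
        L * (u x - u (hyperplaneReflection e l x)) := by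
  have hc1 : ContinuousOn u K := fun x hx => (hu.contDiffAt (mem_annulus_of_le_inner he hl
    (hKcap x hx).1 (hKcap x hx).2)).continuousAt.continuousWithinAt
  have hc2 : ContinuousOn (fun y => u (hyperplaneReflection e l y)) K := fun x hx =>
    (hu.contDiffAt_comp_reflection hr hrR he hl (hKcap x hx).1
      (hKcap x hx).2).1.continuousAt.continuousWithinAt
  have hcomp := (hK.image_of_continuousOn hc1).union (hK.image_of_continuousOn hc2)
  -- A single Lipschitz constant of `g` on the compact set of values taken on `K` by `u` and by its
  -- reflection.
  obtain ⟨L, hL⟩ := (hg.locallyLipschitzOn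
    (s := u '' K ∪ (fun y => u (hyperplaneReflection e l y)) '' K)).exists_lipschitzOnWith_of_compact
    hcomp
  refine ⟨L, L.2, fun x hx hnn => ?_⟩
  obtain ⟨h1, h2⟩ := hu.contDiffAt_comp_reflection hr hrR he hl (hKcap x hx).1 (hKcap x hx).2
  have hmem := mem_annulus_of_le_inner he hl (hKcap x hx).1 (hKcap x hx).2
  have h3 := (hu.contDiffAt hmem).laplacian_sub h1
  have h4 := hu.equation x hmem
  have h5 := hL.dist_le_mul (u x) (Or.inl ⟨x, hx, rfl⟩) (u (hyperplaneReflection e l x))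
    (Or.inr ⟨x, hx, rfl⟩)
  rw [Real.dist_eq, Real.dist_eq, abs_of_nonneg hnn] at h5
  rw [h2] at h3
  refine (le_of_eq h3).trans ?_
  linarith [le_abs_self (g (u x) - g (u (hyperplaneReflection e l x)))]

theorem nonneg_of_hasDerivAt_of_le {k : ℝ → ℝ} {k' δ : ℝ} (h : HasDerivAt k k' 0) (hδ : 0 < δ)
    (hk : ∀ t, 0 < t → t < δ → k 0 ≤ k t) : 0 ≤ k' := by
  refine ge_of_tendsto h.tendsto_slope_zero_right ?_
  filter_upwards [Ioo_mem_nhdsGT hδ] with t ht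
  have := hk t ht.1 ht.2
  simp only [zero_add, smul_eq_mul]
  exact mul_nonneg (inv_nonneg.2 ht.1.le) (by linarith)

/-- Hopf's lemma on the reflection hyperplane. -/
theorem fderiv_pos_of_reflectionLT (hu : IsOuterLargeSolution g r R u)
    (hg : LocallyLipschitz g) (hr : 0 ≤ r) (hrR : r < R) (he : ‖e‖ = 1) (hl : (R + r) / 2 < l)
    (h : ReflectionLT u R e l) {x : EuclideanSpace ℝ (Fin N)} (hx : inner ℝ x e = l)
    (hxR : ‖x‖ < R) : 0 < fderiv ℝ u x e := by
  -- The ball of radius `ρ` about `x + ρ e` touches the hyperplane at `x` from inside the cap, and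
  -- its points have norm at most `‖x‖ + 2ρ < R`.
  set ρ := (R - ‖x‖) / 3 with hρ
  have hρ0 : 0 < ρ := by rw [hρ]; linarith
  set c := x + ρ • e with hc
  have hee : inner ℝ e e = (1 : ℝ) := by rw [real_inner_self_eq_norm_sq, he]; norm_num
  have hcx : inner ℝ c e = l + ρ := by
    rw [hc, inner_add_left, inner_smul_left, hee, hx]; simp
  have hcn : ‖c‖ ≤ ‖x‖ + ρ := by
    refine (norm_add_le _ _).trans ?_
    rw [norm_smul, he, mul_one, Real.norm_of_nonneg hρ0.le]
  have hin : ∀ y, l + ρ - ‖y - c‖ ≤ inner ℝ y e := by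
    intro y
    have h1 := abs_real_inner_le_norm (y - c) e
    rw [he, mul_one, inner_sub_left, hcx] at h1
    linarith [neg_abs_le (inner ℝ y e - (l + ρ))]
  have hyn : ∀ y, ‖y‖ ≤ ‖y - c‖ + (‖x‖ + ρ) := fun y => by
    have := norm_add_le (y - c) c
    rw [sub_add_cancel] at this
    linarith
  have hcap : ∀ y ∈ Metric.closedBall c ρ, l ≤ inner ℝ y e ∧ ‖y‖ < R := by
    intro y hy
    rw [mem_closedBall_iff_norm] at hy
    exact ⟨by linarith [hin y], by linarith [hyn y]⟩
  have hpos : ∀ y, ‖y - c‖ < ρ → 0 < u y - u (hyperplaneReflection e l y) := by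
    intro y hy
    exact sub_pos.2 (h y (by linarith [hin y]) (by linarith [hyn y]))
  set w := fun y => u y - u (hyperplaneReflection e l y) with hw
  have hwC : ∀ y ∈ Metric.closedBall c ρ, ContDiffAt ℝ 2 w y := fun y hy =>
    (hu.contDiffAt (mem_annulus_of_le_inner he hl (hcap y hy).1 (hcap y hy).2)).sub
      (hu.contDiffAt_comp_reflection hr hrR he hl (hcap y hy).1 (hcap y hy).2).1
  have hnn : ∀ y ∈ Metric.closedBall c ρ, 0 ≤ w y := by
    intro y hy
    rcases (hcap y hy).1.eq_or_lt with h1 | h1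
    · simp [hw, hyperplaneReflection_of_inner_eq h1.symm]
    · exact (sub_pos.2 (h y h1 (hcap y hy).2)).le
  obtain ⟨L, hL0, hL⟩ := hu.exists_laplacian_sub_reflection_le hg hr hrR he hl
    (isCompact_closedBall c ρ) hcap
  obtain ⟨α, hα, ε, hε, hbar⟩ := exists_hopf_barrier (w := w) (c := c) (ρ₁ := ρ / 2) (ρ := ρ)
    (by linarith) hL0 (fun y hy => (hwC y hy).continuousAt.continuousWithinAt)
    (fun y hy => hwC y (Metric.ball_subset_closedBall hy))
    (fun y hy => hL y (Metric.ball_subset_closedBall hy)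
      (hnn y (Metric.ball_subset_closedBall hy))) hnn
    (fun y hy => hpos y (by rw [hy]; linarith)) (by linarith)
  have hxmem : x ∈ annulus N r R := mem_annulus_of_le_inner he hl hx.ge hxR
  have hrefl : ∀ t : ℝ, hyperplaneReflection e l (x + t • e) = x + (-t) • e := by
    intro t
    rw [hyperplaneReflection, inner_add_left, inner_smul_left, hee, hx]
    simp only [RCLike.conj_to_real]
    module
  have hdx : DifferentiableAt ℝ u x := (hu.contDiffAt hxmem).differentiableAt (by simp)
  have hd1 : HasDerivAt (fun t : ℝ => u (x + t • e)) (fderiv ℝ u x e) 0 := by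
    simpa using hasDerivAt_line (u := u) (x := x) (e := e) (t := 0) (by simpa using hdx)
  have hd2 : HasDerivAt (fun t : ℝ => u (x + (-t) • e)) (-fderiv ℝ u x e) 0 := by
    have := HasDerivAt.comp (0 : ℝ) (h₂ := fun t : ℝ => u (x + t • e)) (h := fun s => -s)
      (h₂' := fderiv ℝ u x e) (by simpa using hd1) (hasDerivAt_neg (0 : ℝ))
    rw [mul_neg_one] at this
    exact this
  have hd3 : HasDerivAt (fun t : ℝ => ε * (Real.exp (-α * (ρ - t) ^ 2) - Real.exp (-α * ρ ^ 2)))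
      (ε * (Real.exp (-α * ρ ^ 2) * (2 * α * ρ))) 0 := by
    have h1 : HasDerivAt (fun t : ℝ => -α * (ρ - t) ^ 2) (2 * α * ρ) 0 := by
      have := (((hasDerivAt_id (0 : ℝ)).const_sub ρ).pow 2).const_mul (-α)
      refine this.congr_deriv ?_
      simp; ring
    have h2 := (h1.exp.sub_const (Real.exp (-α * ρ ^ 2))).const_mul ε
    simpa using h2
  have hd4 := ((hd1.sub hd2).sub hd3)
  -- Both the difference and the barrier vanish at `x`, so their derivatives along `e` compare. That
  -- of the difference is `2 ∂u/∂e`, because the reflection reverses `e`; that of the barrier is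
  -- positive.
  have key := nonneg_of_hasDerivAt_of_le hd4 (by linarith : 0 < ρ / 2) fun t ht0 ht => by
    have hnorm : ‖x + t • e - c‖ = ρ - t := by
      rw [hc, show x + t • e - (x + ρ • e) = (t - ρ) • e by module, norm_smul, he, mul_one,
        Real.norm_eq_abs, abs_of_nonpos (by linarith)]
      ring
    have h1 := hbar (x + t • e) (by rw [hnorm]; linarith) (by rw [hnorm]; linarith)
    rw [hnorm] at h1
    simp only [hw, hrefl] at h1
    simp only [Pi.sub_apply]
    simp
    simp at h1
    linarith
  have hpos2 : 0 < ε * (Real.exp (-α * ρ ^ 2) * (2 * α * ρ)) := by positivity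
  linarith

theorem eventually_reflection_lt_of_norm_eq (hu : IsOuterLargeSolution g r R u) (hr : 0 ≤ r)
    (hrR : r < R) (he : ‖e‖ = 1) (hl : (R + r) / 2 < l) {y : EuclideanSpace ℝ (Fin N)}
    (hy : l < inner ℝ y e) (hyR : ‖y‖ = R) :
    ∀ᶠ p : ℝ × EuclideanSpace ℝ (Fin N) in 𝓝 (l, y), ‖p.2‖ < R →
      u (hyperplaneReflection e p.1 p.2) < u p.2 := by
  have hmem : hyperplaneReflection e l y ∈ annulus N r R := by
    constructor
    · have h1 := le_norm_hyperplaneReflection (x := y) he l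
      have h2 := inner_le_norm_of_norm_eq_one (x := y) he
      linarith
    · have h1 := norm_hyperplaneReflection_sq (x := y) he l
      rw [← sq_lt_sq₀ (norm_nonneg _) (by linarith), h1, hyR]
      nlinarith
  have h1 : ∀ᶠ p : ℝ × EuclideanSpace ℝ (Fin N) in 𝓝 (l, y),
      u (hyperplaneReflection e p.1 p.2) < u (hyperplaneReflection e l y) + 1 := by
    have hcont : ContinuousAt (fun p : ℝ × EuclideanSpace ℝ (Fin N) =>
        u (hyperplaneReflection e p.1 p.2)) (l, y) :=
      ContinuousAt.comp (f := fun p : ℝ × EuclideanSpace ℝ (Fin N) =>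
        hyperplaneReflection e p.1 p.2) (hu.contDiffAt hmem).continuousAt
        (continuous_hyperplaneReflection e).continuousAt
    exact hcont.eventually (gt_mem_nhds (lt_add_one _))
  obtain ⟨ρ, hρ, h2⟩ := eventually_towardsSphere.1
    (hu.blowUp.eventually_ge_atTop (u (hyperplaneReflection e l y) + 1))
  have h3 : ∀ᶠ p : ℝ × EuclideanSpace ℝ (Fin N) in 𝓝 (l, y), ρ < ‖p.2‖ :=
    (continuous_snd.norm.continuousAt (x := (l, y))).eventually (lt_mem_nhds (by simpa [hyR]))
  filter_upwards [h1, h3] with p hp1 hp2 hp3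
  exact hp1.trans_le (h2 p.2 hp2 hp3)

/-- The strong maximum principle in a cap. -/
theorem reflectionLT_of_le (hu : IsOuterLargeSolution g r R u)
    (hg : LocallyLipschitz g) (hr : 0 ≤ r) (hrR : r < R) (he : ‖e‖ = 1) (hl : (R + r) / 2 < l)
    (hlR : l < R)
    (h : ∀ x, l < inner ℝ x e → ‖x‖ < R → u (hyperplaneReflection e l x) ≤ u x) :
    ReflectionLT u R e l := by
  set w := fun y => u y - u (hyperplaneReflection e l y) with hw
  set S : Set (EuclideanSpace ℝ (Fin N)) := {x | l < inner ℝ x e} ∩ Metric.ball 0 R with hS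
  have hin : Continuous fun x : EuclideanSpace ℝ (Fin N) => inner ℝ x e := by fun_prop
  have hSo : IsOpen S := (isOpen_lt continuous_const hin).inter Metric.isOpen_ball
  have hSc : Convex ℝ S := by
    refine Convex.inter ?_ (convex_ball 0 R)
    refine convex_halfSpace_gt (f := fun x : EuclideanSpace ℝ (Fin N) => inner ℝ x e) ?_ l
    exact ⟨fun x y => inner_add_left x y e, fun c x => by simp [inner_smul_left]⟩
  have hSmem : ∀ x ∈ S, l ≤ inner ℝ x e ∧ ‖x‖ < R := fun x hx =>
    ⟨le_of_lt hx.1, by simpa using hx.2⟩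
  have hwC : ∀ x ∈ S, ContDiffAt ℝ 2 w x := fun x hx =>
    (hu.contDiffAt (mem_annulus_of_le_inner he hl (hSmem x hx).1 (hSmem x hx).2)).sub
      (hu.contDiffAt_comp_reflection hr hrR he hl (hSmem x hx).1 (hSmem x hx).2).1
  have hwnn : ∀ x ∈ S, 0 ≤ w x := fun x hx => sub_nonneg.2 (h x hx.1 (hSmem x hx).2)
  have hwcont : ContinuousOn w S := fun x hx => (hwC x hx).continuousAt.continuousWithinAt
  set U : Set (EuclideanSpace ℝ (Fin N)) := S ∩ w ⁻¹' Ioi 0 with hU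
  have hUo : IsOpen U := hwcont.isOpen_inter_preimage hSo isOpen_Ioi
  have hee : inner ℝ e e = (1 : ℝ) := by rw [real_inner_self_eq_norm_sq, he]; norm_num
  have hR0 : 0 < R := by linarith
  -- Near `R e` the function `u` is huge while its reflected values stay bounded, so equality
  -- throughout the cap is excluded.
  have hne : (S ∩ U).Nonempty := by
    have h1 : inner ℝ (R • e) e = R := by rw [inner_smul_left, hee]; simp
    have h2 := hu.eventually_reflection_lt_of_norm_eq hr hrR he hl (y := R • e) (by rwa [h1])
      (by rw [norm_smul, he, mul_one, Real.norm_of_nonneg hR0.le])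
    have h3 : Tendsto (fun s : ℝ => (l, s • e)) (𝓝[<] R) (𝓝 (l, R • e)) := by
      have : Continuous fun s : ℝ => (l, s • e) := by fun_prop
      exact (this.tendsto R).mono_left nhdsWithin_le_nhds
    obtain ⟨s, hs, hsl⟩ := ((h3.eventually h2).and (Ioo_mem_nhdsLT hlR)).exists
    have hs0 : 0 < s := by linarith [hsl.1]
    have hsn : ‖s • e‖ < R := by
      rw [norm_smul, he, mul_one, Real.norm_of_nonneg hs0.le]; exact hsl.2
    have hsS : s • e ∈ S := by
      refine ⟨?_, by simpa using hsn⟩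
      have : inner ℝ (s • e) e = s := by rw [inner_smul_left, hee]; simp
      simpa [this] using hsl.1
    exact ⟨s • e, hsS, hsS, sub_pos.2 (hs hsn)⟩
  -- The positivity set is relatively closed: the Hopf barrier, centred at a nearby point `y` of
  -- positivity in a ball of radius `2δ/3` reaching past `z`, is positive at `z`. Connectedness of
  -- the convex cap then concludes.
  have hclos : closure U ∩ S ⊆ U := by
    rintro z ⟨hzU, hzS⟩
    obtain ⟨δ, hδ, hδS⟩ := Metric.nhds_basis_closedBall.mem_iff.1 (hSo.mem_nhds hzS)
    obtain ⟨y, hyU, hyz⟩ := Metric.mem_closure_iff.1 hzU (δ / 3) (by linarith)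
    obtain ⟨η, hη, hηU⟩ := Metric.isOpen_iff.1 hUo y hyU
    set ρ₁ := min (η / 2) (δ / 3) with hρ₁
    have hρ₁0 : 0 < ρ₁ := by positivity
    have hsub : Metric.closedBall y (2 * δ / 3) ⊆ S := by
      refine Subset.trans (fun x hx => ?_) hδS
      rw [Metric.mem_closedBall] at hx ⊢
      have := dist_triangle x y z
      rw [dist_comm y z] at this
      linarith
    refine ⟨hzS, ?_⟩
    rcases lt_or_ge ‖z - y‖ ρ₁ with hzy | hzy
    · refine (hηU ?_).2
      rw [mem_ball_iff_norm]
      exact hzy.trans_le ((min_le_left _ _).trans (by linarith))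
    · obtain ⟨L, hL0, hL⟩ := hu.exists_laplacian_sub_reflection_le hg hr hrR he hl
        (isCompact_closedBall y (2 * δ / 3)) fun x hx => hSmem x (hsub hx)
      obtain ⟨α, hα, ε, hε, hbar⟩ := exists_hopf_barrier (w := w) (c := y) (ρ₁ := ρ₁)
        (ρ := 2 * δ / 3) hρ₁0 hL0 (hwcont.mono hsub)
        (fun x hx => hwC x (hsub (Metric.ball_subset_closedBall hx)))
        (fun x hx => hL x (Metric.ball_subset_closedBall hx)
          (hwnn x (hsub (Metric.ball_subset_closedBall hx))))
        (fun x hx => hwnn x (hsub hx))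
        (fun x hx => (hηU (by
          rw [mem_ball_iff_norm, hx]
          exact (min_le_left _ _).trans_lt (by linarith))).2)
        ((min_le_right _ _).trans_lt (by linarith))
      have hzy2 : ‖z - y‖ < δ / 3 := by rwa [← dist_eq_norm]
      have h1 := hbar z hzy (by linarith)
      refine lt_of_lt_of_le (mul_pos hε (sub_pos.2 (Real.exp_lt_exp.2 ?_))) h1
      have h2 : ‖z - y‖ ^ 2 < (2 * δ / 3) ^ 2 := by
        apply pow_lt_pow_left₀ (by linarith) (norm_nonneg _) two_ne_zero
      nlinarith
  have hSU := hSc.isPreconnected.subset_of_closure_inter_subset hUo hne hclos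
  intro x hx hxR
  have := (hSU ⟨hx, by simpa using hxR⟩ : x ∈ U).2
  exact sub_pos.1 this

end IsOuterLargeSolution

/-! ### The moving plane argument. -/

namespace IsOuterLargeSolution

variable {N : ℕ} {g : ℝ → ℝ} {r R : ℝ} {u : EuclideanSpace ℝ (Fin N) → ℝ}
  {e : EuclideanSpace ℝ (Fin N)} {l : ℝ}

/-- Near the outer sphere, `u` increases in the directions which make a definite acute angle with
the outer normal. -/
theorem exists_fderiv_pos (hR : 0 < R)
    (hτ : Tendsto (tangentialGradient u) (towardsSphere N R) (𝓝 0))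
    (hrad : Tendsto (radialDeriv u) (towardsSphere N R) atTop) (hl : 0 < l) (he : ‖e‖ = 1) :
    ∃ ρ < R, ∀ x, ρ < ‖x‖ → ‖x‖ < R → l ≤ inner ℝ x e → 0 < fderiv ℝ u x e := by
  have h1 : ∀ᶠ x in towardsSphere N R, ‖tangentialGradient u x‖ < 1 :=
    (tendsto_zero_iff_norm_tendsto_zero.1 hτ).eventually (gt_mem_nhds zero_lt_one)
  -- As `⟨x, e⟩ / ‖x‖ ≥ l / R`, the radial part contributes at least `1` to `∂u/∂e`, more than the
  -- tangential part can remove.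
  obtain ⟨ρ, hρ, h2⟩ := eventually_towardsSphere.1 (h1.and (hrad.eventually_ge_atTop (R / l)))
  refine ⟨ρ, hρ, fun x hx hxR hxl => ?_⟩
  obtain ⟨h3, h4⟩ := h2 x hx hxR
  have hx0 : 0 < ‖x‖ := hl.trans_le (hxl.trans (inner_le_norm_of_norm_eq_one he))
  have h5 : fderiv ℝ u x e = inner ℝ (tangentialGradient u x) e
      + radialDeriv u x * (‖x‖⁻¹ * inner ℝ x e) := by
    have h6 : fderiv ℝ u x e = inner ℝ (gradient u x) e := by
      rw [gradient, InnerProductSpace.toDual_symm_apply]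
    rw [h6, tangentialGradient, inner_sub_left, inner_smul_left, inner_smul_left]
    simp
  have h7 := abs_real_inner_le_norm (tangentialGradient u x) e
  rw [he, mul_one] at h7
  have h8 : l / R ≤ ‖x‖⁻¹ * inner ℝ x e := by
    rw [inv_mul_eq_div]
    exact div_le_div₀ (hl.le.trans hxl) hxl hx0 hxR.le
  have h9 : R / l * (l / R) ≤ radialDeriv u x * (‖x‖⁻¹ * inner ℝ x e) :=
    mul_le_mul h4 h8 (by positivity) (le_trans (by positivity) h4)
  have h10 : R / l * (l / R) = 1 := by field_simp
  linarith [neg_abs_le (inner ℝ (tangentialGradient u x) e)]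

/-- If the reflection inequality holds for one hyperplane, it holds for all neighbouring ones. -/
theorem eventually_reflectionLT (hu : IsOuterLargeSolution g r R u)
    (hg : LocallyLipschitz g) (hr : 0 ≤ r) (hrR : r < R) (he : ‖e‖ = 1)
    (hl : (R + r) / 2 < l) {ρ : ℝ} (hρ : ρ < R)
    (hnear : ∀ x, ρ < ‖x‖ → ‖x‖ < R → (R + r) / 2 ≤ inner ℝ x e → 0 < fderiv ℝ u x e)
    (h : ReflectionLT u R e l) : ∀ᶠ l' in 𝓝 l, ReflectionLT u R e l' := by
  have hin : Continuous fun x : EuclideanSpace ℝ (Fin N) => inner ℝ x e := by fun_prop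
  have key : ∀ᶠ l' in 𝓝 l, ∀ x ∈ Metric.closedBall (0 : EuclideanSpace ℝ (Fin N)) R,
      l' < inner ℝ x e → ‖x‖ < R → u (hyperplaneReflection e l' x) < u x := by
    -- Compactness reduces the claim to a neighbourhood of each `(l, y)` with `y` in the closed
    -- ball, including the outer sphere where `u` is not controlled. Points behind the plane impose
    -- nothing, and points ahead follow by continuity or by blow-up.
    refine IsCompact.eventually_forall_of_forall_eventually (isCompact_closedBall 0 R)
      fun y hy => ?_
    have hyR : ‖y‖ ≤ R := by simpa using hy
    rcases lt_trichotomy (inner ℝ y e) l with h1 | h1 | h1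
    · have h2 : ∀ᶠ p : ℝ × EuclideanSpace ℝ (Fin N) in 𝓝 (l, y), inner ℝ p.2 e < p.1 :=
        (isOpen_lt (hin.comp continuous_snd) continuous_fst).mem_nhds h1
      filter_upwards [h2] with p hp hp2
      exact absurd hp hp2.not_gt
    -- On the plane the inequality degenerates, so it is recovered from monotonicity along the short
    -- segment to the reflected point. Positivity of `∂u/∂e` comes from Hopf's lemma inside and from
    -- the limits of the gradient on the outer sphere.
    · obtain ⟨ε, hε, hball⟩ : ∃ ε > 0, ∀ z ∈ Metric.ball y ε, ‖z‖ < R → 0 < fderiv ℝ u z e := by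
        rcases hyR.lt_or_eq with hlt | heq
        · have h2 := hu.fderiv_pos_of_reflectionLT hg hr hrR he hl h h1 hlt
          have h3 := (hu.contDiffAt
            (mem_annulus_of_le_inner he hl h1.ge hlt)).continuousAt_fderiv (by simp)
          have h4 : ∀ᶠ z in 𝓝 y, 0 < fderiv ℝ u z e :=
            (h3.clm_apply continuousAt_const).eventually (lt_mem_nhds h2)
          obtain ⟨ε, hε, hb⟩ := Metric.eventually_nhds_iff_ball.1 h4
          exact ⟨ε, hε, fun z hz _ => hb z hz⟩
        · have h2 : ∀ᶠ z in 𝓝 y, ρ < ‖z‖ :=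
            continuous_norm.continuousAt.eventually (lt_mem_nhds (hρ.trans_eq heq.symm))
          have h3 : ∀ᶠ z in 𝓝 y, (R + r) / 2 < inner ℝ z e :=
            hin.continuousAt.eventually (lt_mem_nhds (hl.trans_eq h1.symm))
          obtain ⟨ε, hε, hb⟩ := Metric.eventually_nhds_iff_ball.1 (h2.and h3)
          exact ⟨ε, hε, fun z hz hzR => hnear z (hb z hz).1 hzR (hb z hz).2.le⟩
      have h2 : ∀ᶠ p : ℝ × EuclideanSpace ℝ (Fin N) in 𝓝 (l, y), ‖p.2 - y‖ < ε / 2 := by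
        have : Continuous fun p : ℝ × EuclideanSpace ℝ (Fin N) => ‖p.2 - y‖ := by fun_prop
        exact this.continuousAt.eventually (gt_mem_nhds (by simpa using hε))
      have h3 : ∀ᶠ p : ℝ × EuclideanSpace ℝ (Fin N) in 𝓝 (l, y),
          -(ε / 2) < 2 * (p.1 - inner ℝ p.2 e) := by
        have : Continuous fun p : ℝ × EuclideanSpace ℝ (Fin N) => 2 * (p.1 - inner ℝ p.2 e) := by
          fun_prop
        refine this.continuousAt.eventually (lt_mem_nhds ?_)
        simp only [h1, sub_self, mul_zero]
        linarith
      have h4 : ∀ᶠ p : ℝ × EuclideanSpace ℝ (Fin N) in 𝓝 (l, y), (R + r) / 2 < p.1 :=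
        continuous_fst.continuousAt.eventually (lt_mem_nhds hl)
      filter_upwards [h2, h3, h4] with p hp2 hp3 hp4 hp5 hp6
      refine hu.reflection_lt_of_fderiv_pos hr hrR he hp4 hp5 hp6 fun t ht1 ht2 => hball _ ?_ ?_
      · rw [mem_ball_iff_norm, show p.2 + t • e - y = (p.2 - y) + t • e by abel]
        refine (norm_add_le _ _).trans_lt ?_
        rw [norm_smul, he, mul_one, Real.norm_eq_abs, abs_of_nonpos ht2]
        linarith
      · exact (norm_add_smul_le he (by linarith) ht1 ht2).trans_lt hp6
    · rcases hyR.lt_or_eq with hlt | heq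
      · have hmem := mem_annulus_of_le_inner (r := r) he hl h1.le hlt
        have hmem' := hyperplaneReflection_mem_annulus hr hrR he hl h1.le hlt
        have hc1 : ContinuousAt (fun p : ℝ × EuclideanSpace ℝ (Fin N) => u p.2) (l, y) :=
          ContinuousAt.comp (f := fun p : ℝ × EuclideanSpace ℝ (Fin N) => p.2)
            (hu.contDiffAt hmem).continuousAt continuousAt_snd
        have hc2 : ContinuousAt (fun p : ℝ × EuclideanSpace ℝ (Fin N) =>
            u (hyperplaneReflection e p.1 p.2)) (l, y) :=
          ContinuousAt.comp (f := fun p : ℝ × EuclideanSpace ℝ (Fin N) =>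
            hyperplaneReflection e p.1 p.2) (hu.contDiffAt hmem').continuousAt
            (continuous_hyperplaneReflection e).continuousAt
        filter_upwards [hc2.eventually_lt hc1 (h y h1 hlt)] with p hp _ _
        exact hp
      · filter_upwards [hu.eventually_reflection_lt_of_norm_eq hr hrR he hl h1 heq] with p hp _ hp2
        exact hp hp2
  filter_upwards [key] with l' hl' x hx hxR
  exact hl' x (by simpa using hxR.le) hx hxR

/-- The moving plane method: reflected values are smaller, up to the hyperplane at which the
reflected cap touches the inner ball. -/
theorem reflectionLT (hu : IsOuterLargeSolution g r R u)
    (hg : LocallyLipschitz g) (hr : 0 ≤ r) (hrR : r < R)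
    (hτ : Tendsto (tangentialGradient u) (towardsSphere N R) (𝓝 0))
    (hrad : Tendsto (radialDeriv u) (towardsSphere N R) atTop) (he : ‖e‖ = 1)
    (hl : (R + r) / 2 < l) (hlR : l < R) : ReflectionLT u R e l := by
  obtain ⟨ρ, hρ, hnear⟩ := exists_fderiv_pos (l := (R + r) / 2) (by linarith) hτ hrad
    (by linarith) he
  set ρ' := max ρ ((R + r) / 2) with hρ'
  have hρ'R : ρ' < R := max_lt hρ (by linarith)
  -- For such `l'` every point of the segment has component along `e` at least `2l' - R > ρ'`, so it
  -- lies in the region where `∂u/∂e > 0`.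
  have hbase : ∀ l', (R + ρ') / 2 < l' → l' < R → ReflectionLT u R e l' := by
    intro l' h1 h2 x hx hxR
    have h3 : (R + r) / 2 ≤ ρ' := le_max_right _ _
    have h4 : ρ ≤ ρ' := le_max_left _ _
    refine hu.reflection_lt_of_fderiv_pos hr hrR he (by linarith) hx hxR fun t ht1 ht2 => ?_
    have h5 := (add_smul_mem_annulus hr hrR he (by linarith : (R + r) / 2 < l') hxR ht1 ht2).2
    have h6 : inner ℝ (x + t • e) e = inner ℝ x e + t := by
      rw [inner_add_left, inner_smul_left, real_inner_self_eq_norm_sq, he]; simp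
    have h7 := inner_le_norm_of_norm_eq_one (x := x) he
    have h8 := inner_le_norm_of_norm_eq_one (x := x + t • e) he
    rw [h6] at h8
    exact hnear _ (by linarith) h5 (by rw [h6]; linarith)
  by_contra hcon
  -- At the supremum `μ` of the failing positions the weak inequality survives by continuity, the
  -- strong maximum principle makes it strict, and openness excludes failures just below `μ`.
  set S := {l' | (R + r) / 2 < l' ∧ l' < R ∧ ¬ ReflectionLT u R e l'} with hS
  have hSub : ∀ l' ∈ S, l' ≤ (R + ρ') / 2 := fun l' h1 => by
    by_contra! h2
    exact h1.2.2 (hbase l' h2 h1.2.1)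
  have hSb : BddAbove S := ⟨_, hSub⟩
  have hSne : S.Nonempty := ⟨l, hl, hlR, hcon⟩
  set μ := sSup S with hμ
  have hlμ : l ≤ μ := le_csSup hSb ⟨hl, hlR, hcon⟩
  have hμl : (R + r) / 2 < μ := hl.trans_le hlμ
  have hμR : μ < R := (csSup_le hSne hSub).trans_lt (by linarith)
  have habove : ∀ l', μ < l' → l' < R → ReflectionLT u R e l' := by
    intro l' h1 h2
    by_contra h3
    exact absurd (le_csSup hSb ⟨hμl.trans h1, h2, h3⟩) h1.not_ge
  have hweak : ∀ x, μ < inner ℝ x e → ‖x‖ < R → u (hyperplaneReflection e μ x) ≤ u x := by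
    intro x hx hxR
    have hmem := hyperplaneReflection_mem_annulus hr hrR he hμl hx.le hxR
    have hc : ContinuousAt (fun l' : ℝ => u (hyperplaneReflection e l' x)) μ :=
      ContinuousAt.comp (f := fun l' : ℝ => hyperplaneReflection e l' x)
        (hu.contDiffAt hmem).continuousAt
        ((continuous_hyperplaneReflection e).comp
          (continuous_id.prodMk continuous_const)).continuousAt
    refine le_of_tendsto (hc.tendsto.mono_left (nhdsWithin_le_nhds (s := Ioi μ))) ?_
    filter_upwards [Ioo_mem_nhdsGT (lt_min hx hμR)] with l' hl'
    exact (habove l' hl'.1 (hl'.2.trans_le (min_le_right _ _)) x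
      (hl'.2.trans_le (min_le_left _ _)) hxR).le
  have hPμ := hu.reflectionLT_of_le hg hr hrR he hμl hμR hweak
  obtain ⟨δ, hδ, hb⟩ := Metric.eventually_nhds_iff_ball.1
    (hu.eventually_reflectionLT hg hr hrR he hμl hρ hnear hPμ)
  obtain ⟨l', hl'S, hl'⟩ := exists_lt_of_lt_csSup hSne (by linarith : μ - δ < μ)
  refine hl'S.2.2 (hb l' ?_)
  rw [Metric.mem_ball, Real.dist_eq, abs_lt]
  constructor <;> linarith [le_csSup hSb hl'S]

end IsOuterLargeSolution

theorem mainTheorem5 (N : ℕ) (hN : 2 ≤ N) (r R : ℝ) (hr : 0 ≤ r) (hrR : r < R)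
    (g : ℝ → ℝ) (hg : LocallyLipschitz g) (hKO : ConvexKellerOsserman g)
    (u : EuclideanSpace ℝ (Fin N) → ℝ) (hu : IsOuterLargeSolution g r R u) :
    Tendsto (tangentialGradient u) (towardsSphere N R) (𝓝 0) ∧
    Tendsto (radialDeriv u) (towardsSphere N R) atTop ∧
    ∀ x ∈ annulus N ((R + r) / 2) R, 0 < radialDeriv u x := by
  obtain ⟨h1, h2⟩ := hu.tendsto_gradient hN hr hrR hg.continuous hKO
  refine ⟨h1, h2, fun x hx => ?_⟩
  have hx0 : 0 < ‖x‖ := lt_trans (by linarith) hx.1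
  have he : ‖‖x‖⁻¹ • x‖ = 1 := by
    rw [norm_smul, norm_inv, norm_norm, inv_mul_cancel₀ hx0.ne']
  have hxe : inner ℝ x (‖x‖⁻¹ • x) = ‖x‖ := by
    rw [inner_smul_right, real_inner_self_eq_norm_sq]
    field_simp
  rw [radialDeriv_eq_fderiv]
  -- The plane orthogonal to `x` through `x` itself has `l = ‖x‖`, which is admissible exactly
  -- because `(R + r) / 2 < ‖x‖ < R`.
  exact hu.fderiv_pos_of_reflectionLT hg hr hrR he hx.1
    (hu.reflectionLT hg hr hrR h1 h2 he hx.1 hx.2) hxe hx.2
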